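/- \textbf{Conventions.} A time series of complexity $m\ge 1$ is the curve $\langle x_1,\dots,x_m\rangle:[0,1]\to\mathbb R$ obtained by linearly interpolating $x_1,\dots,x_m\in\mathbb R$. The Fréchet distance of curves $\pi,\tau:[0,1]\to\mathbb R$ is $\mathrm d_F(\pi,\tau)=\inf_{f,g}\max_{\alpha\in[0,1]}|\pi(f(\alpha))-\tau(g(\alpha))|$, where $f,g$ range over the continuous non-decreasing maps $[0,1]\to[0,1]$ that fix $0$ and $1$. In the $c$-ANN problem with distance threshold $r>0$ for input curves $\pi_1,\dots,\pi_n$, a query $\tau$ has to be answered as follows: if some $\pi_i$ has $\mathrm d_F(\pi_i,\tau)\le r$, report an input curve $\pi_j$ with $\mathrm d_F(\pi_j,\tau)\le cr$; if $\mathrm d_F(\pi_i,\tau)\ge cr$ for all $i$, answer ``no''; otherwise either report a $\pi_j$ with $\mathrm d_F(\pi_j,\tau)\le cr$ or answer ``no''. The model of computation is the real RAM: memory cells hold real numbers, and memory access, $+,-,\times,\div,\le$, the floor function and drawing an independent random number uniformly distributed on $[0,1]$ take constant time. Space is measured by the range of memory cells that are accessed. A curve is reported by its index. \textbf{Theorem.}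 There are a preprocessing program, a query program, and a constant $C>0$ such that for all $\epsilon\in(0,1]$, $r>0$, $n,m,k\ge 1$ and all time series $\pi_1,\dots,\pi_n$ of complexity $m$ the following holds. Given $n,m,k,\epsilon,r$ and the $\pi_i$, the preprocessing program builds a data structure for the $(5+\epsilon)$-ANN problem with distance threshold $r$ and queries of complexity $k$, in expected time at most $C\,nm\,(C/\epsilon)^k$. Whenever the preprocessing terminates, preprocessing and any sequence of queries together use space at most $n\,(C/\epsilon)^k+C\,nm$, and every query with a time series of complexity $k$ is answered correctly in worst-case time at most $C\,k$. In short: space $n\cdot O(1/\epsilon)^k+O(nm)$, expected preprocessing time $O(nm)\cdot O(1/\epsilon)^k$, query time $O(k)$. -/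

import Mathlib

open MeasureTheory Set
open scoped ENNReal unitInterval

noncomputable section

/-! ### Time series and the Fréchet distance -/

/-- The `i`-th entry (counted from `0`) of a finite sequence, and `0` beyond its end. -/
def seqAt {m : ℕ} (x : Fin m → ℝ) (i : ℕ) : ℝ := if h : i < m then x ⟨i, h⟩ else 0

/-- The time series `⟨x₀, …, x_{m-1}⟩ : [0,1] → ℝ` (`m ≥ 1`): the linear interpolation of the
sequence `x`, with the value `x i` at the parameter `i / (m - 1)`. For `m = 1` it is constant.
Consecutive entries may be equal or monotone, so every curve of complexity at most `m` is of this
form. -/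
def timeSeries {m : ℕ} (x : Fin m → ℝ) (t : I) : ℝ :=
  let s : ℝ := (t : ℝ) * ((m : ℝ) - 1)
  (1 - Int.fract s) * seqAt x ⌊s⌋₊ + Int.fract s * seqAt x (⌊s⌋₊ + 1)

/-- A matching: two continuous non-decreasing maps of `[0,1]` to itself that fix both ends. -/
structure Matching where
  f : I → I
  g : I → I
  continuous_f : Continuous f
  continuous_g : Continuous g
  monotone_f : Monotone f
  monotone_g : Monotone g
  f_zero : f 0 = 0
  g_zero : g 0 = 0
  f_one : f 1 = 1
  g_one : g 1 = 1

/-- The (continuous) Fréchet distance of two curves in `ℝ`. For continuous curves each supremum is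
a maximum, and the infimum is over a nonempty set of non-negative numbers. -/
def frechetDist (p q : I → ℝ) : ℝ := ⨅ φ : Matching, ⨆ a : I, |p (φ.f a) - q (φ.g a)|

/-- `ans` is an admissible answer to the query `q` in the `c`-ANN problem with distance threshold
`r` for the input curves `P`; `none` is the answer "no" and `some j` reports the curve `P j`. -/
def IsANNAnswer {n : ℕ} (c r : ℝ) (P : Fin n → I → ℝ) (q : I → ℝ) (ans : Option (Fin n)) : Prop :=
  ((∃ i, frechetDist (P i) q ≤ r) → ∃ j, ans = some j ∧ frechetDist (P j) q ≤ c * r) ∧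
  ((∀ i, c * r ≤ frechetDist (P i) q) → ans = none) ∧
  (∀ j, ans = some j → frechetDist (P j) q ≤ c * r)

/-! ### The real RAM with floor function and random numbers

The memory consists of cells `0, 1, 2, …`, each of which holds a real number. A program has random
access to its memory and to a read-only input sequence, the operations `+, -, *, /, ⌊·⌋` and the
comparison `≤` on reals cost one step each, and it may draw independent random numbers that are
uniformly distributed on `[0,1]`. Programs are finite and contain integer constants only. -/

/-- Expressions. `cell a` is the content of the memory cell with address `a`, `input a` is the
`a`-th number of the read-only input. -/
inductive RExpr where
  | const (c : ℤ)
  | cell (a : RExpr)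
  | input (a : RExpr)
  | add (a b : RExpr)
  | sub (a b : RExpr)
  | mul (a b : RExpr)
  | div (a b : RExpr)
  | floor (a : RExpr)

namespace RExpr

/-- The value of an expression on the input `x` and the memory contents `M`. An address is rounded
down to a natural number, and division by zero gives zero. -/
def eval (x M : ℕ → ℝ) : RExpr → ℝ
  | const c => c
  | cell a => M ⌊a.eval x M⌋₊
  | input a => x ⌊a.eval x M⌋₊
  | add a b => a.eval x M + b.eval x M
  | sub a b => a.eval x M - b.eval x M
  | mul a b => a.eval x M * b.eval x M
  | div a b => a.eval x M / b.eval x M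
  | floor a => (⌊a.eval x M⌋ : ℤ)

/-- The number of steps needed to evaluate an expression: one for each constant, each access to
the memory or the input, and each operation. -/
def cost : RExpr → ℕ
  | const _ => 1
  | cell a => a.cost + 1
  | input a => a.cost + 1
  | add a b => a.cost + b.cost + 1
  | sub a b => a.cost + b.cost + 1
  | mul a b => a.cost + b.cost + 1
  | div a b => a.cost + b.cost + 1
  | floor a => a.cost + 1

/-- The least `s` such that the evaluation reads only memory cells with address less than `s`. -/
def reach (x M : ℕ → ℝ) : RExpr → ℕ
  | const _ => 0
  | cell a => max (a.reach x M) (⌊a.eval x M⌋₊ + 1)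
  | input a => a.reach x M
  | add a b => max (a.reach x M) (b.reach x M)
  | sub a b => max (a.reach x M) (b.reach x M)
  | mul a b => max (a.reach x M) (b.reach x M)
  | div a b => max (a.reach x M) (b.reach x M)
  | floor a => a.reach x M

end RExpr

/-- Programs. `assign a e` writes the value of `e` into the cell with address `a`, `rand a` writes
a fresh random number into that cell, `ite e f p q` is "if `e ≤ f` then `p` else `q`", and
`loop e f p` is "while `e ≤ f` do `p`". -/
inductive RProg where
  | skip
  | assign (a e : RExpr)
  | rand (a : RExpr)
  | seq (p q : RProg)
  | ite (e f : RExpr) (p q : RProg)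
  | loop (e f : RExpr) (p : RProg)

/-- A state of the machine: the memory contents, the number of random numbers drawn so far, the
number of steps made so far, and the least number `peak` such that only memory cells with address
less than `peak` were read or written so far. -/
structure RState where
  mem : ℕ → ℝ
  draws : ℕ
  time : ℕ
  peak : ℕ

namespace RState

/-- The initial state: all memory cells hold `0`. -/
def init : RState := ⟨fun _ => 0, 0, 0, 0⟩

/-- The state in which the next program starts on the memory left by the previous one. -/
def restart (s : RState) : RState := ⟨s.mem, 0, 0, s.peak⟩

/-- Account for `t` more steps and for accesses to cells with addresses less than `b`. -/
def tick (s : RState) (t b : ℕ) : RState := ⟨s.mem, s.draws, s.time + t, max s.peak b⟩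

/-- Write `v` into the cell with address `i`. -/
def write (s : RState) (i : ℕ) (v : ℝ) : RState :=
  ⟨Function.update s.mem i v, s.draws, s.time + 1, max s.peak (i + 1)⟩

end RState

/-- The state after the comparison of the values of `e` and `f`. -/
def RState.compare (x : ℕ → ℝ) (e f : RExpr) (s : RState) : RState :=
  s.tick (e.cost + f.cost + 1) (max (e.reach x s.mem) (f.reach x s.mem))

/-- The outcomes of the random draws. -/
abbrev RandomSource : Type := ℕ → I

/-- The law of the random draws: they are independent and uniformly distributed on `[0,1]`. -/
def randomLaw : Measure RandomSource := Measure.infinitePi fun _ : ℕ => (volume : Measure I)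

/-- `Exec x ω p s s'`: started in state `s` on the input `x` and with the random numbers
`ω 0, ω 1, …`, the program `p` terminates in state `s'`. -/
inductive RProg.Exec (x : ℕ → ℝ) (ω : RandomSource) : RProg → RState → RState → Prop
  | skip (s : RState) : Exec x ω .skip s (s.tick 1 0)
  | assign (a e : RExpr) (s : RState) :
      Exec x ω (.assign a e) s
        ((s.tick (a.cost + e.cost) (max (a.reach x s.mem) (e.reach x s.mem))).write
          ⌊a.eval x s.mem⌋₊ (e.eval x s.mem))
  | rand (a : RExpr) (s : RState) :
      Exec x ω (.rand a) s
        { (s.tick a.cost (a.reach x s.mem)).write ⌊a.eval x s.mem⌋₊ (ω s.draws) with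
          draws := s.draws + 1 }
  | seq {p q : RProg} {s s' s'' : RState} :
      Exec x ω p s s' → Exec x ω q s' s'' → Exec x ω (.seq p q) s s''
  | ite_true {e f : RExpr} {p q : RProg} {s s' : RState} :
      e.eval x s.mem ≤ f.eval x s.mem → Exec x ω p (s.compare x e f) s' →
        Exec x ω (.ite e f p q) s s'
  | ite_false {e f : RExpr} {p q : RProg} {s s' : RState} :
      ¬ e.eval x s.mem ≤ f.eval x s.mem → Exec x ω q (s.compare x e f) s' →
        Exec x ω (.ite e f p q) s s'
  | loop_done {e f : RExpr} {p : RProg} {s : RState} :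
      ¬ e.eval x s.mem ≤ f.eval x s.mem → Exec x ω (.loop e f p) s (s.compare x e f)
  | loop_step {e f : RExpr} {p : RProg} {s s' s'' : RState} :
      e.eval x s.mem ≤ f.eval x s.mem → Exec x ω p (s.compare x e f) s' →
        Exec x ω (.loop e f p) s' s'' → Exec x ω (.loop e f p) s s''

/-- The number of steps that `p` makes on the input `x` with the random numbers `ω`, started on
empty memory; it is `∞` if `p` does not terminate. -/
def RProg.runtime (p : RProg) (x : ℕ → ℝ) (ω : RandomSource) : ℝ≥0∞ :=
  ⨅ (s : RState) (_ : p.Exec x ω RState.init s), (s.time : ℝ≥0∞)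

/-! ### The semantics is deterministic and running times are measurable

These facts show that the expected running time `∫⁻ ω, p.runtime x ω ∂randomLaw` is an expectation
in the usual sense. -/

namespace RProg

instance : MeasurableSpace RState :=
  MeasurableSpace.comap (fun s => (s.mem, s.draws, s.time, s.peak)) inferInstance

theorem measurable_tuple : Measurable (fun s : RState => (s.mem, s.draws, s.time, s.peak)) :=
  comap_measurable _
theorem measurable_mk {α : Type*} [MeasurableSpace α] {f : α → RState}
    (h1 : Measurable fun a => (f a).mem) (h2 : Measurable fun a => (f a).draws)
    (h3 : Measurable fun a => (f a).time) (h4 : Measurable fun a => (f a).peak) :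
    Measurable f := by
  rw [measurable_comap_iff]
  exact h1.prodMk (h2.prodMk (h3.prodMk h4))

theorem measurable_mem : Measurable RState.mem := measurable_tuple.fst
theorem measurable_draws : Measurable RState.draws := measurable_tuple.snd.fst
theorem measurable_time : Measurable RState.time := measurable_tuple.snd.snd.fst
theorem measurable_peak : Measurable RState.peak := measurable_tuple.snd.snd.snd

theorem measurable_apply_nat {α β : Type*} [MeasurableSpace α] [MeasurableSpace β] {F : α → ℕ → β} {g : α → ℕ}
    (hF : Measurable F) (hg : Measurable g) : Measurable fun a => F a (g a) := by
  have : Measurable fun q : (ℕ → β) × ℕ => q.1 q.2 :=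
    measurable_from_prod_countable_left fun n => measurable_pi_apply n
  exact this.comp (hF.prodMk hg)

theorem measurable_update_nat {α : Type*} [MeasurableSpace α] {F : α → ℕ → ℝ} {g : α → ℕ} {v : α → ℝ}
    (hF : Measurable F) (hg : Measurable g) (hv : Measurable v) :
    Measurable fun a => Function.update (F a) (g a) (v a) := by
  rw [measurable_pi_iff]
  intro i
  simp only [Function.update_apply]
  exact Measurable.ite (measurableSet_eq_fun measurable_const hg) hv ((measurable_pi_apply i).comp hF)

theorem measurable_eval (x : ℕ → ℝ) (e : RExpr) : Measurable fun M => e.eval x M := by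
  induction e with
  | const c => exact measurable_const
  | cell a ih => exact measurable_apply_nat measurable_id (Nat.measurable_floor.comp ih)
  | input a ih => exact (measurable_from_nat (f := x)).comp (Nat.measurable_floor.comp ih)
  | add a b iha ihb => exact iha.add ihb
  | sub a b iha ihb => exact iha.sub ihb
  | mul a b iha ihb => exact iha.mul ihb
  | div a b iha ihb => exact iha.div ihb
  | floor a ih => exact (measurable_of_countable _).comp (Int.measurable_floor.comp ih)

theorem measurable_reach (x : ℕ → ℝ) (e : RExpr) : Measurable fun M => e.reach x M := by
  induction e with
  | const c => exact measurable_const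
  | cell a ih => exact ih.max ((Nat.measurable_floor.comp (measurable_eval x a)).add_const 1)
  | input a ih => exact ih
  | add a b iha ihb => exact iha.max ihb
  | sub a b iha ihb => exact iha.max ihb
  | mul a b iha ihb => exact iha.max ihb
  | div a b iha ihb => exact iha.max ihb
  | floor a ih => exact ih

theorem measurable_tick {α : Type*} [MeasurableSpace α] {f : α → RState} {b : α → ℕ} (t : ℕ)
    (hf : Measurable f) (hb : Measurable b) : Measurable fun a => (f a).tick t (b a) := by
  have h1 : Measurable fun a => (f a).mem := measurable_mem.comp hf
  have h2 : Measurable fun a => (f a).draws := measurable_draws.comp hf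
  have h3 : Measurable fun a => (f a).time := measurable_time.comp hf
  have h4 : Measurable fun a => (f a).peak := measurable_peak.comp hf
  exact measurable_mk h1 h2 (h3.add_const t) (h4.max hb)

theorem measurable_write {α : Type*} [MeasurableSpace α] {f : α → RState} {i : α → ℕ} {v : α → ℝ}
    (hf : Measurable f) (hi : Measurable i) (hv : Measurable v) :
    Measurable fun a => (f a).write (i a) (v a) := by
  have h1 : Measurable fun a => (f a).mem := measurable_mem.comp hf
  have h2 : Measurable fun a => (f a).draws := measurable_draws.comp hf
  have h3 : Measurable fun a => (f a).time := measurable_time.comp hf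
  have h4 : Measurable fun a => (f a).peak := measurable_peak.comp hf
  exact measurable_mk (measurable_update_nat h1 hi hv) h2 (h3.add_const 1) (h4.max (hi.add_const 1))

theorem measurable_compare (x : ℕ → ℝ) (e f : RExpr) : Measurable (RState.compare x e f) :=
  measurable_tick _ measurable_id (((measurable_reach x e).comp measurable_mem).max ((measurable_reach x f).comp measurable_mem))

theorem exec_measurable (x : ℕ → ℝ) (p : RProg) : ∃ (D : Set (RandomSource × RState))
    (F : RandomSource × RState → RState), MeasurableSet D ∧ Measurable F ∧
      ∀ ω s s', p.Exec x ω s s' ↔ (ω, s) ∈ D ∧ s' = F (ω, s) := by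
  induction p with
  | skip =>
    refine ⟨univ, fun q => q.2.tick 1 0, .univ, measurable_tick _ measurable_snd measurable_const, ?_⟩
    intro ω s s'
    constructor
    · rintro ⟨⟩; simp
    · rintro ⟨-, rfl⟩; exact .skip s
  | assign a e =>
    have hm : Measurable fun q : RandomSource × RState => q.2.mem := measurable_mem.comp measurable_snd
    refine ⟨univ, fun q => (q.2.tick (a.cost + e.cost) (max (a.reach x q.2.mem)
      (e.reach x q.2.mem))).write ⌊a.eval x q.2.mem⌋₊ (e.eval x q.2.mem), .univ,
      measurable_write (measurable_tick _ measurable_snd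
        (((measurable_reach x a).comp hm).max ((measurable_reach x e).comp hm)))
        (Nat.measurable_floor.comp ((measurable_eval x a).comp hm)) ((measurable_eval x e).comp hm), ?_⟩
    intro ω s s'
    constructor
    · rintro ⟨⟩; simp
    · rintro ⟨-, rfl⟩; exact .assign a e s
  | rand a =>
    have hm : Measurable fun q : RandomSource × RState => q.2.mem := measurable_mem.comp measurable_snd
    have hd : Measurable fun q : RandomSource × RState => q.2.draws := measurable_draws.comp measurable_snd
    have hw : Measurable fun q : RandomSource × RState =>
        (q.2.tick a.cost (a.reach x q.2.mem)).write ⌊a.eval x q.2.mem⌋₊ (q.1 q.2.draws) :=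
      measurable_write (measurable_tick _ measurable_snd ((measurable_reach x a).comp hm))
        (Nat.measurable_floor.comp ((measurable_eval x a).comp hm))
        (measurable_subtype_coe.comp (measurable_apply_nat measurable_fst hd))
    have h1 : Measurable fun q : RandomSource × RState =>
        ((q.2.tick a.cost (a.reach x q.2.mem)).write ⌊a.eval x q.2.mem⌋₊ (q.1 q.2.draws)).mem :=
      measurable_mem.comp hw
    have h3 : Measurable fun q : RandomSource × RState =>
        ((q.2.tick a.cost (a.reach x q.2.mem)).write ⌊a.eval x q.2.mem⌋₊ (q.1 q.2.draws)).time :=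
      measurable_time.comp hw
    have h4 : Measurable fun q : RandomSource × RState =>
        ((q.2.tick a.cost (a.reach x q.2.mem)).write ⌊a.eval x q.2.mem⌋₊ (q.1 q.2.draws)).peak :=
      measurable_peak.comp hw
    refine ⟨univ, fun q => { (q.2.tick a.cost (a.reach x q.2.mem)).write ⌊a.eval x q.2.mem⌋₊
        (q.1 q.2.draws) with draws := q.2.draws + 1 }, .univ,
      measurable_mk h1 (hd.add_const 1) h3 h4, ?_⟩
    intro ω s s'
    constructor
    · rintro ⟨⟩; simp
    · rintro ⟨-, rfl⟩; exact .rand a s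
  | seq p q ihp ihq =>
    obtain ⟨D, F, hD, hF, h⟩ := ihp
    obtain ⟨D', F', hD', hF', h'⟩ := ihq
    have hg : Measurable fun z : RandomSource × RState => (z.1, F z) := measurable_fst.prodMk hF
    refine ⟨D ∩ (fun z => (z.1, F z)) ⁻¹' D', fun z => F' (z.1, F z), hD.inter (hg hD'),
      hF'.comp hg, ?_⟩
    intro ω s s'
    constructor
    · rintro ⟨⟩
      rename_i s1 h1 h2
      obtain ⟨a, rfl⟩ := (h _ _ _).1 h1
      obtain ⟨b, rfl⟩ := (h' _ _ _).1 h2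
      exact ⟨⟨a, b⟩, rfl⟩
    · rintro ⟨⟨a, b⟩, rfl⟩
      exact .seq ((h _ _ _).2 ⟨a, rfl⟩) ((h' _ _ _).2 ⟨b, rfl⟩)
  | ite e f p q ihp ihq =>
    obtain ⟨D, F, hD, hF, h⟩ := ihp
    obtain ⟨D', F', hD', hF', h'⟩ := ihq
    have hm : Measurable fun q : RandomSource × RState => q.2.mem := measurable_mem.comp measurable_snd
    have hg : Measurable fun z : RandomSource × RState => (z.1, z.2.compare x e f) :=
      measurable_fst.prodMk ((measurable_compare x e f).comp measurable_snd)
    have hB : MeasurableSet {z : RandomSource × RState | e.eval x z.2.mem ≤ f.eval x z.2.mem} :=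
      measurableSet_le ((measurable_eval x e).comp hm) ((measurable_eval x f).comp hm)
    classical
    refine ⟨{z | if e.eval x z.2.mem ≤ f.eval x z.2.mem then (z.1, z.2.compare x e f) ∈ D
        else (z.1, z.2.compare x e f) ∈ D'},
      fun z => if e.eval x z.2.mem ≤ f.eval x z.2.mem then F (z.1, z.2.compare x e f)
        else F' (z.1, z.2.compare x e f), ?_, Measurable.ite hB (hF.comp hg) (hF'.comp hg), ?_⟩
    · have := (hB.inter (hg hD)).union (hB.compl.inter (hg hD'))
      convert this using 1
      ext z
      by_cases hz : e.eval x z.2.mem ≤ f.eval x z.2.mem <;> simp [hz]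
    intro ω s s'
    constructor
    · rintro ⟨⟩
      · rename_i hc h1
        obtain ⟨a, rfl⟩ := (h _ _ _).1 h1
        simp [hc, a]
      · rename_i hc h1
        obtain ⟨a, rfl⟩ := (h' _ _ _).1 h1
        simp [hc, a]
    · rintro ⟨a, rfl⟩
      by_cases hc : e.eval x s.mem ≤ f.eval x s.mem
      · simp only [mem_ofPred_eq, hc, if_true] at a ⊢
        exact .ite_true hc ((h _ _ _).2 ⟨a, rfl⟩)
      · simp only [mem_ofPred_eq, hc, if_false] at a ⊢
        exact .ite_false hc ((h' _ _ _).2 ⟨a, rfl⟩)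
  | loop e f p ih =>
    obtain ⟨D, F, hD, hF, h⟩ := ih
    have hm : Measurable fun q : RandomSource × RState => q.2.mem := measurable_mem.comp measurable_snd
    have hc : Measurable fun z : RandomSource × RState => (z.1, z.2.compare x e f) :=
      measurable_fst.prodMk ((measurable_compare x e f).comp measurable_snd)
    set g : RandomSource × RState → RandomSource × RState :=
      fun z => (z.1, F (z.1, z.2.compare x e f)) with hgdef
    have hg : Measurable g := measurable_fst.prodMk (hF.comp hc)
    set B : Set (RandomSource × RState) := {z | e.eval x z.2.mem ≤ f.eval x z.2.mem} with hBdef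
    have hB : MeasurableSet B :=
      measurableSet_le ((measurable_eval x e).comp hm) ((measurable_eval x f).comp hm)
    -- the loop body is run exactly `n` times
    let E : ℕ → Set (RandomSource × RState) := fun n =>
      Nat.rec Bᶜ (fun _ S => B ∩ ((fun z => (z.1, z.2.compare x e f)) ⁻¹' D ∩ g ⁻¹' S)) n
    have hE : ∀ n, MeasurableSet (E n) := by
      intro n
      induction n with
      | zero => exact hB.compl
      | succ n ihn => exact hB.inter ((hc hD).inter (hg ihn))
    have hfst : ∀ n z, (g^[n] z).1 = z.1 := by
      intro n
      induction n with
      | zero => intro z; rfl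
      | succ n ihn => intro z; rw [Function.iterate_succ_apply, ihn]
    have key : ∀ n ω s s', (ω, s) ∈ E n → s' = ((g^[n] (ω, s)).2.compare x e f) →
        (RProg.loop e f p).Exec x ω s s' := by
      intro n
      induction n with
      | zero => intro ω s s' hz hs; subst hs; exact .loop_done hz
      | succ n ihn =>
        intro ω s s' hz hs
        exact .loop_step hz.1 ((h _ _ _).2 ⟨hz.2.1, rfl⟩) (ihn _ _ _ hz.2.2 hs)
    have key2 : ∀ q ω s s', RProg.Exec x ω q s s' → q = .loop e f p →
        ∃ n, (ω, s) ∈ E n ∧ s' = ((g^[n] (ω, s)).2.compare x e f) := by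
      intro q ω s s' hx
      induction hx with
      | loop_done hb => intro hq; cases hq; exact ⟨0, hb, rfl⟩
      | loop_step hb h1 h2 _ ih2 =>
        intro hq; cases hq
        obtain ⟨a, rfl⟩ := (h _ _ _).1 h1
        obtain ⟨n, hn, hs⟩ := ih2 rfl
        exact ⟨n + 1, ⟨hb, a, hn⟩, hs⟩
      | _ => intro hq; cases hq
    have disj : ∀ n l z, z ∈ E n → z ∈ E l → n = l := by
      intro n
      induction n with
      | zero =>
        intro l z hn hl
        cases l with
        | zero => rfl
        | succ l => exact absurd hl.1 hn
      | succ n ihn =>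
        intro l z hn hl
        cases l with
        | zero => exact absurd hn.1 hl
        | succ l => rw [ihn l _ hn.2.2 hl.2.2]
    classical
    obtain ⟨G, hG, hGE⟩ := exists_measurable_piecewise E hE
      (fun n z => ((g^[n] z).2.compare x e f))
      (fun n => (measurable_compare x e f).comp (measurable_snd.comp (hg.iterate n)))
      (by
        intro i j hij z hz
        exact absurd (disj i j z hz.1 hz.2) hij)
    refine ⟨⋃ n, E n, G, .iUnion hE, hG, ?_⟩
    intro ω s s'
    constructor
    · intro hx
      obtain ⟨n, hn, hs⟩ := key2 _ _ _ _ hx rfl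
      exact ⟨mem_iUnion.2 ⟨n, hn⟩, by rw [hGE n hn]; exact hs⟩
    · rintro ⟨hz, rfl⟩
      obtain ⟨n, hn⟩ := mem_iUnion.1 hz
      exact key n ω s _ hn (hGE n hn)

/-- The final state is determined by the program, the input and the random numbers. -/
theorem exec_det (x : ℕ → ℝ) (ω : RandomSource) (p : RProg) {s s1 s2 : RState}
    (h1 : p.Exec x ω s s1) (h2 : p.Exec x ω s s2) : s1 = s2 := by
  obtain ⟨D, F, -, -, h⟩ := exec_measurable x p
  rw [((h _ _ _).1 h1).2, ((h _ _ _).1 h2).2]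

/-- The running time is a random variable. -/
theorem measurable_runtime (x : ℕ → ℝ) (p : RProg) : Measurable (p.runtime x) := by
  obtain ⟨D, F, hD, hF, h⟩ := exec_measurable x p
  have hi : Measurable fun ω : RandomSource => (ω, RState.init) :=
    measurable_id.prodMk measurable_const
  classical
  have : p.runtime x = fun ω => if (ω, RState.init) ∈ D then
      ((F (ω, RState.init)).time : ℝ≥0∞) else ⊤ := by
    funext ω
    unfold RProg.runtime
    split_ifs with hz
    · apply le_antisymm
      · exact iInf₂_le _ ((h _ _ _).2 ⟨hz, rfl⟩)
      · refine le_iInf₂ fun s hs => ?_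
        rw [((h _ _ _).1 hs).2]
    · refine iInf_eq_top.2 fun s => iInf_eq_top.2 fun hs => absurd ((h _ _ _).1 hs).1 hz
  rw [this]
  exact Measurable.ite (hi hD) ((measurable_of_countable _).comp (measurable_time.comp (hF.comp hi)))
    measurable_const

end RProg

/-! ### Data structures: preprocessing and queries -/

/-- The input of the preprocessing: `n`, `m`, `k`, `ε`, `r`, and then the `n` sequences of length
`m` one after the other. -/
def preInput {n m : ℕ} (k : ℕ) (ε r : ℝ) (P : Fin n → Fin m → ℝ) (i : ℕ) : ℝ :=
  if i = 0 then n else if i = 1 then m else if i = 2 then k else if i = 3 then ε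
  else if i = 4 then r
  else if h : (i - 5) / m < n then seqAt (P ⟨(i - 5) / m, h⟩) ((i - 5) % m) else 0

/-- The states that are reached by preprocessing the input `x` with the program `pre` and the random
numbers `ω`, and then answering any finite number of queries of length `k` with the program `qry`,
one after the other on the same memory. A query gets the sequence `τ` as its input. -/
inductive Reachable (pre qry : RProg) (k : ℕ) (x : ℕ → ℝ) (ω : RandomSource) : RState → Prop
  | preprocess {s : RState} : pre.Exec x ω RState.init s → Reachable pre qry k x ω s
  | query {s s' : RState} (τ : Fin k → ℝ) (ω' : RandomSource) :
      Reachable pre qry k x ω s → qry.Exec (seqAt τ) ω' s.restart s' → Reachable pre qry k x ω s'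

/-- The answer left in a memory cell: `-1` for "no", and the index of the reported curve
otherwise. -/
def encodeAnswer {n : ℕ} : Option (Fin n) → ℝ
  | none => -1
  | some j => ((j : ℕ) : ℝ)

end

/-!
The data structure is a dictionary of curves with vertices on a grid of mesh `μ = εr/20`. A query
`τ` is simplified online, rounded to the grid and looked up.

*Simplification.* The play operator of radius `R` follows a curve lazily: it moves only as far as it
is needed to keep distance at most `R`. Its path is `R`-close to the curve (`FD.play`), has at most as
many vertices as the curve, and does not depend on the sampling of the curve (`Ref.playRun_eq`). A
query runs it with radius `2ρ`, where `ρ = r + μ`, in time `O(k)`.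

*Guided algorithm.* The dictionary must contain the rounded path `w` of every query `τ` with
`d_F(π, τ) ≤ r` for some input curve `π`, although `τ` is not known. For this the preprocessing runs,
for each input curve `π` and each number `c` below `64 * (16 * W) ^ k` with `W = O(1/ε)`, an algorithm
that takes its decisions from the digits of `c` and builds a grid curve along `π`. Whenever the play
operator of radius `ρ` on `π` starts or turns, at most two vertices may be added, each of them among
the `W` grid points around the current point; in between, the grid curve is followed as lazily as
possible at distance `D = 3ρ + 3μ`.

It is sound: every grid curve that is accepted is `D`-close to `π` (`Grid.Accepts.fd`). Hence a curve
`π` that is reported satisfies `d_F(π, τ) ≤ D + μ + 2ρ = 5r + 9μ < (5 + ε)r`.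

It is complete (`Grid.exists_code`): let `z` be the path of the play operator of radius `ρ` on `π`.
It is `2ρ`-close to `τ`, and hence the path on `τ` with radius `2ρ` never moves away from it
(`lazy_playSeq`) and, while `z` is monotone, has at most two turning points, which are close to the
place where `z` starts to be monotone (`Lazy.cases_of_monotone`). So two offers for every monotone
piece of `z` suffice. The same argument bounds the number of these pieces by `O(k)`
(`length_out_le_of_close`), so that the decisions fit into a code of the given size. They are made for
refinements of `π` and `τ` whose vertices are matched; `Grid.Accepts.of_ref` shows that the guided
algorithm need not know the refinement of `π`.

*Dictionary.* A word `w` over the grid is a natural number. A dictionary with keys `aᵢ` and values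
`vᵢ` is stored by the values of the polynomials `F = ∏ (X - aᵢ)²`, `Q = ∑ᵢ ∏_{j ≠ i} (X - aⱼ)²` and
`P = ∑ᵢ vᵢ ∏_{j ≠ i} (X - aⱼ)²` at one huge integer `B`. As `B ≡ a` modulo `B - a`, their values at
`a` are obtained by a division with remainder (`Dict.emod_eq`), which the real RAM performs with the
floor function. A key occurs if and only if `F a = 0`, and then its value is `P a / Q a`. So a lookup
takes constant time in the worst case. All programs are deterministic and use only the first `36`
memory cells.
-/

noncomputable section

/-! ### Verifying programs of the real RAM -/

/-- The memory cell with the fixed address `c`, used as a program variable. -/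
def RExpr.var (c : ℕ) : RExpr := .cell (.const c)

/-- The assignment of `e` to the program variable `c`. -/
def RProg.set (c : ℕ) (e : RExpr) : RProg := .assign (.const c) e

/-- The expression reads memory cells only at constant addresses less than `K`. -/
def RExpr.isStatic (K : ℕ) : RExpr → Bool
  | .const _ => true
  | .cell (.const c) => c.toNat < K
  | .cell _ => false
  | .input a => a.isStatic K
  | .add a b => a.isStatic K && b.isStatic K
  | .sub a b => a.isStatic K && b.isStatic K
  | .mul a b => a.isStatic K && b.isStatic K
  | .div a b => a.isStatic K && b.isStatic K
  | .floor a => a.isStatic K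

/-- The program draws no random numbers and accesses only memory cells with constant addresses
less than `K`. -/
def RProg.isStatic (K : ℕ) : RProg → Bool
  | .skip => true
  | .assign (.const c) e => decide (c.toNat < K) && e.isStatic K
  | .assign _ _ => false
  | .rand _ => false
  | .seq p q => p.isStatic K && q.isStatic K
  | .ite e f p q => e.isStatic K && f.isStatic K && p.isStatic K && q.isStatic K
  | .loop e f p => e.isStatic K && f.isStatic K && p.isStatic K

/-- The cells that a static program may write. -/
def RProg.writes : RProg → List ℕ
  | .assign (.const c) _ => [c.toNat]
  | .seq p q => p.writes ++ q.writes
  | .ite _ _ p q => p.writes ++ q.writes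
  | .loop _ _ p => p.writes
  | _ => []

theorem floor_const (c : ℤ) : ⌊(c : ℝ)⌋₊ = c.toNat := by
  rw [← Int.floor_toNat, Int.floor_intCast]

theorem RExpr.reach_le {K : ℕ} (x M : ℕ → ℝ) (e : RExpr) (h : e.isStatic K = true) :
    e.reach x M ≤ K := by
  induction e with
  | const c => simp [reach]
  | cell a ih =>
    cases a with
    | const c =>
      simp only [isStatic, decide_eq_true_eq] at h
      simp only [reach, eval, floor_const]
      omega
    | _ => simp [isStatic] at h
  | input a ih => exact ih h
  | floor a ih => exact ih h
  | _ a b iha ihb =>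
    simp only [isStatic, Bool.and_eq_true] at h
    exact max_le (iha h.1) (ihb h.2)

theorem RProg.Exec.peak_le {K : ℕ} {x : ℕ → ℝ} {ω : RandomSource} {p : RProg} {s s' : RState}
    (hx : p.Exec x ω s s') (h : p.isStatic K = true) : s'.peak ≤ max s.peak K := by
  induction hx with
  | skip s => simp [RState.tick]
  | assign a e s =>
    cases a with
    | const c =>
      simp only [isStatic, Bool.and_eq_true, decide_eq_true_eq] at h
      have := e.reach_le x s.mem h.2
      simp only [RState.write, RState.tick, RExpr.reach, RExpr.eval, floor_const]
      omega
    | _ => simp [isStatic] at h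
  | rand a s => simp [isStatic] at h
  | seq _ _ ih1 ih2 =>
    simp only [isStatic, Bool.and_eq_true] at h
    have := ih1 h.1; have := ih2 h.2; omega
  | @ite_true e f p q s s' hc _ ih =>
    simp only [isStatic, Bool.and_eq_true] at h
    have := ih h.1.2
    have := e.reach_le x s.mem h.1.1.1
    have := f.reach_le x s.mem h.1.1.2
    simp only [RState.compare, RState.tick] at *
    omega
  | @ite_false e f p q s s' hc _ ih =>
    simp only [isStatic, Bool.and_eq_true] at h
    have := ih h.2
    have := e.reach_le x s.mem h.1.1.1
    have := f.reach_le x s.mem h.1.1.2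
    simp only [RState.compare, RState.tick] at *
    omega
  | @loop_done e f p s hc =>
    simp only [isStatic, Bool.and_eq_true] at h
    have := e.reach_le x s.mem h.1.1
    have := f.reach_le x s.mem h.1.2
    simp only [RState.compare, RState.tick] at *
    omega
  | @loop_step e f p s s' s'' hc _ _ ih1 ih2 =>
    have h' := h
    simp only [isStatic, Bool.and_eq_true] at h
    have := ih1 h.2
    have := ih2 h'
    have := e.reach_le x s.mem h.1.1
    have := f.reach_le x s.mem h.1.2
    simp only [RState.compare, RState.tick] at *
    omega

theorem RProg.Exec.mem_eq {K : ℕ} {x : ℕ → ℝ} {ω : RandomSource} {p : RProg} {s s' : RState}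
    (hx : p.Exec x ω s s') (h : p.isStatic K = true) {a : ℕ} (ha : a ∉ p.writes) :
    s'.mem a = s.mem a := by
  induction hx with
  | skip s => rfl
  | assign b e s =>
    cases b with
    | const c =>
      simp only [writes, List.mem_singleton] at ha
      simp [RState.write, RState.tick, RExpr.eval, floor_const, ha]
    | _ => simp [isStatic] at h
  | rand a s => simp [isStatic] at h
  | seq _ _ ih1 ih2 =>
    simp only [isStatic, Bool.and_eq_true] at h
    simp only [writes, List.mem_append, not_or] at ha
    rw [ih2 h.2 ha.2, ih1 h.1 ha.1]
  | ite_true hc _ ih =>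
    simp only [isStatic, Bool.and_eq_true] at h
    simp only [writes, List.mem_append, not_or] at ha
    rw [ih h.1.2 ha.1]; rfl
  | ite_false hc _ ih =>
    simp only [isStatic, Bool.and_eq_true] at h
    simp only [writes, List.mem_append, not_or] at ha
    rw [ih h.2 ha.2]; rfl
  | loop_done hc => rfl
  | loop_step hc _ _ ih1 ih2 =>
    have h' := h
    simp only [isStatic, Bool.and_eq_true] at h
    rw [ih2 h' ha, ih1 h.2 ha]; rfl

/-- Total correctness with a time bound: started on memory that satisfies `Pre`, the program
terminates within `t` steps, and then the memory satisfies `Post`. -/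
def Tri (x : ℕ → ℝ) (p : RProg) (t : ℕ) (Pre Post : (ℕ → ℝ) → Prop) : Prop :=
  ∀ (ω : RandomSource) (s : RState), Pre s.mem →
    ∃ s' : RState, p.Exec x ω s s' ∧ s'.time ≤ s.time + t ∧ Post s'.mem

/-- The memory after a loop-free program without random draws. -/
def RProg.lf (x : ℕ → ℝ) : RProg → (ℕ → ℝ) → (ℕ → ℝ)
  | .assign a e, M => Function.update M ⌊a.eval x M⌋₊ (e.eval x M)
  | .seq p q, M => q.lf x (p.lf x M)
  | .ite e f p q, M => if e.eval x M ≤ f.eval x M then p.lf x M else q.lf x M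
  | _, M => M

/-- The program has no loops and no random draws. -/
def RProg.isLoopFree : RProg → Bool
  | .skip => true
  | .assign _ _ => true
  | .rand _ => false
  | .seq p q => p.isLoopFree && q.isLoopFree
  | .ite _ _ p q => p.isLoopFree && q.isLoopFree
  | .loop _ _ _ => false

/-- A bound for the number of steps of a loop-free program. -/
def RProg.lfTime : RProg → ℕ
  | .assign a e => a.cost + e.cost + 1
  | .seq p q => p.lfTime + q.lfTime
  | .ite e f p q => e.cost + f.cost + 1 + (p.lfTime + q.lfTime)
  | _ => 1

theorem RProg.exec_lf (x : ℕ → ℝ) (ω : RandomSource) (p : RProg) (h : p.isLoopFree = true)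
    (s : RState) : ∃ s', p.Exec x ω s s' ∧ s'.time ≤ s.time + p.lfTime ∧
      s'.mem = p.lf x s.mem := by
  induction p generalizing s with
  | skip => exact ⟨_, .skip s, by simp [RState.tick, lfTime], rfl⟩
  | assign a e =>
    exact ⟨_, .assign a e s, by simp [RState.tick, RState.write, lfTime, add_assoc], rfl⟩
  | rand a => simp [isLoopFree] at h
  | seq p q ihp ihq =>
    simp only [isLoopFree, Bool.and_eq_true] at h
    obtain ⟨s1, e1, t1, m1⟩ := ihp h.1 s
    obtain ⟨s2, e2, t2, m2⟩ := ihq h.2 s1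
    exact ⟨s2, .seq e1 e2, by simp only [lfTime]; omega, by rw [m2, m1]; rfl⟩
  | ite e f p q ihp ihq =>
    simp only [isLoopFree, Bool.and_eq_true] at h
    by_cases hc : e.eval x s.mem ≤ f.eval x s.mem
    · obtain ⟨s1, e1, t1, m1⟩ := ihp h.1 (s.compare x e f)
      refine ⟨s1, .ite_true hc e1, ?_, ?_⟩
      · simp only [lfTime, RState.compare, RState.tick] at *; omega
      · rw [m1]; simp [lf, hc, RState.compare, RState.tick]
    · obtain ⟨s1, e1, t1, m1⟩ := ihq h.2 (s.compare x e f)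
      refine ⟨s1, .ite_false hc e1, ?_, ?_⟩
      · simp only [lfTime, RState.compare, RState.tick] at *; omega
      · rw [m1]; simp [lf, hc, RState.compare, RState.tick]
  | loop e f p => simp [isLoopFree] at h

namespace Tri

variable {x : ℕ → ℝ} {p q : RProg} {t u : ℕ} {Pre Post Mid : (ℕ → ℝ) → Prop}

theorem of_lf (h : p.isLoopFree = true) (hp : ∀ M, Pre M → Post (p.lf x M)) :
    Tri x p p.lfTime Pre Post := by
  intro ω s hs
  obtain ⟨s', h1, h2, h3⟩ := p.exec_lf x ω h s
  exact ⟨s', h1, h2, h3 ▸ hp _ hs⟩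

theorem seq (h1 : Tri x p t Pre Mid) (h2 : Tri x q u Mid Post) :
    Tri x (.seq p q) (t + u) Pre Post := by
  intro ω s hs
  obtain ⟨s1, e1, t1, m1⟩ := h1 ω s hs
  obtain ⟨s2, e2, t2, m2⟩ := h2 ω s1 m1
  exact ⟨s2, .seq e1 e2, by omega, m2⟩

theorem weaken (h : Tri x p t Pre Post) {Pre' Post' : (ℕ → ℝ) → Prop} (htu : t ≤ u)
    (h1 : ∀ M, Pre' M → Pre M) (h2 : ∀ M, Post M → Post' M) : Tri x p u Pre' Post' := by
  intro ω s hs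
  obtain ⟨s', e, ht, m⟩ := h ω s (h1 _ hs)
  exact ⟨s', e, by omega, h2 _ m⟩

/-- A loop whose body is run exactly `N` times; `Inv j` holds after `j` rounds. -/
theorem loop {e f : RExpr} (N : ℕ) (Inv : ℕ → (ℕ → ℝ) → Prop)
    (hg : ∀ j ≤ N, ∀ M, Inv j M → (e.eval x M ≤ f.eval x M ↔ j < N))
    (hb : ∀ j < N, Tri x p t (Inv j) (Inv (j + 1))) :
    Tri x (.loop e f p) (N * (t + (e.cost + f.cost + 1)) + (e.cost + f.cost + 1))
      (Inv 0) (Inv N) := by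
  have key : ∀ l j, j + l = N → Tri x (.loop e f p)
      (l * (t + (e.cost + f.cost + 1)) + (e.cost + f.cost + 1)) (Inv j) (Inv N) := by
    intro l
    induction l with
    | zero =>
      intro j hj ω s hs
      obtain rfl : j = N := by omega
      refine ⟨_, .loop_done ?_, ?_, hs⟩
      · rw [hg j le_rfl _ hs]; omega
      · simp [RState.compare, RState.tick]
    | succ l ih =>
      intro j hj ω s hs
      obtain ⟨s1, e1, t1, m1⟩ := hb j (by omega) ω (s.compare x e f) hs
      obtain ⟨s2, e2, t2, m2⟩ := ih (j + 1) (by omega) ω s1 m1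
      refine ⟨s2, .loop_step ((hg j (by omega) _ hs).2 (by omega)) e1 e2, ?_, m2⟩
      have : s1.time ≤ s.time + (e.cost + f.cost + 1) + t := by
        simpa [RState.compare, RState.tick] using t1
      calc s2.time ≤ s1.time + (l * (t + (e.cost + f.cost + 1)) + (e.cost + f.cost + 1)) := t2
        _ ≤ _ := by rw [Nat.succ_mul]; omega
  exact key N 0 (by omega)

end Tri

/-! ### Notation for programs -/

instance : Add RExpr := ⟨.add⟩
instance : Sub RExpr := ⟨.sub⟩
instance : Mul RExpr := ⟨.mul⟩
instance : Div RExpr := ⟨.div⟩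
instance (n : ℕ) : OfNat RExpr n := ⟨.const n⟩

infixr:50 " ;; " => RProg.seq

/-- "If `e = f` then `p` else `q`". -/
def RProg.ifEq (e f : RExpr) (p q : RProg) : RProg := .ite e f (.ite f e p q) q

/-- Clear the flag `c` unless `e ≤ f`. -/
def RProg.check (c : ℕ) (e f : RExpr) : RProg := .ite e f .skip (.set c 0)

section

variable (x M : ℕ → ℝ)

@[simp] theorem eval_add (a b : RExpr) : (a + b).eval x M = a.eval x M + b.eval x M := rfl
@[simp] theorem eval_sub (a b : RExpr) : (a - b).eval x M = a.eval x M - b.eval x M := rfl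
@[simp] theorem eval_mul (a b : RExpr) : (a * b).eval x M = a.eval x M * b.eval x M := rfl
@[simp] theorem eval_div (a b : RExpr) : (a / b).eval x M = a.eval x M / b.eval x M := rfl
@[simp] theorem eval_floor (a : RExpr) : a.floor.eval x M = (⌊a.eval x M⌋ : ℤ) := rfl
@[simp] theorem eval_input (a : RExpr) : a.input.eval x M = x ⌊a.eval x M⌋₊ := rfl
@[simp] theorem eval_ofNat (n : ℕ) [n.AtLeastTwo] :
    (no_index (OfNat.ofNat n) : RExpr).eval x M = OfNat.ofNat n := by
  change (((OfNat.ofNat n : ℕ) : ℤ) : ℝ) = _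
  simp
@[simp] theorem eval_zero : (0 : RExpr).eval x M = 0 := Int.cast_zero
@[simp] theorem eval_one : (1 : RExpr).eval x M = 1 := Int.cast_one

@[simp] theorem eval_var (c : ℕ) : (RExpr.var c).eval x M = M c := by
  simp [RExpr.eval, RExpr.var]

@[simp] theorem lf_skip : RProg.skip.lf x M = M := rfl

@[simp] theorem lf_seq (p q : RProg) : (p ;; q).lf x M = q.lf x (p.lf x M) := rfl

@[simp] theorem lf_ite (e f : RExpr) (p q : RProg) : (RProg.ite e f p q).lf x M =
    if e.eval x M ≤ f.eval x M then p.lf x M else q.lf x M := rfl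

@[simp] theorem lf_set (c : ℕ) (e : RExpr) :
    (RProg.set c e).lf x M = Function.update M c (e.eval x M) := by
  simp [RProg.lf, RExpr.eval, RProg.set]

@[simp] theorem lf_ifEq (e f : RExpr) (p q : RProg) : (RProg.ifEq e f p q).lf x M =
    if e.eval x M = f.eval x M then p.lf x M else q.lf x M := by
  simp only [RProg.ifEq, lf_ite]
  split_ifs with h1 h2 h3 h3 h3
  · rfl
  · exact absurd (le_antisymm h1 h2) h3
  · exact absurd h3.ge h2
  · rfl
  · exact absurd h3.le h1
  · rfl

@[simp] theorem lf_check (c : ℕ) (e f : RExpr) : (RProg.check c e f).lf x M =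
    Function.update M c (if e.eval x M ≤ f.eval x M then M c else 0) := by
  simp only [RProg.check, lf_ite]
  split_ifs <;> simp

/-- A static program changes only the cells that it writes. -/
theorem RProg.lf_eq_of_notMem {K : ℕ} {p : RProg} (h : p.isStatic K = true) {a : ℕ}
    (ha : a ∉ p.writes) : p.lf x M a = M a := by
  induction p generalizing M with
  | assign b e =>
    cases b with
    | const c =>
      simp only [writes, List.mem_singleton] at ha
      simp [lf, RExpr.eval, floor_const, ha]
    | _ => simp [isStatic] at h
  | seq p q ihp ihq =>
    simp only [isStatic, Bool.and_eq_true] at h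
    simp only [writes, List.mem_append, not_or] at ha
    rw [lf, ihq _ h.2 ha.2, ihp _ h.1 ha.1]
  | ite e f p q ihp ihq =>
    simp only [isStatic, Bool.and_eq_true] at h
    simp only [writes, List.mem_append, not_or] at ha
    rw [lf]
    split_ifs
    · exact ihp _ h.1.2 ha.1
    · exact ihq _ h.2 ha.2
  | _ => rfl

end

/-! ### A dictionary in three numbers -/

namespace Dict

/-- `∏ (X - a)²` over the keys `a` of the list of pairs `(key, value)`. -/
def F : List (ℤ × ℤ) → ℤ → ℤ
  | [], _ => 1
  | (a, _) :: L, X => F L X * (X - a) ^ 2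

/-- `∑ᵢ ∏_{j ≠ i} (X - aⱼ)²` over the keys `aᵢ`. -/
def Q : List (ℤ × ℤ) → ℤ → ℤ
  | [], _ => 0
  | (a, _) :: L, X => Q L X * (X - a) ^ 2 + F L X

/-- `∑ᵢ vᵢ ∏_{j ≠ i} (X - aⱼ)²` over the pairs `(aᵢ, vᵢ)`. -/
def P : List (ℤ × ℤ) → ℤ → ℤ
  | [], _ => 0
  | (a, v) :: L, X => P L X * (X - a) ^ 2 + v * F L X

theorem F_nonneg (L : List (ℤ × ℤ)) (X : ℤ) : 0 ≤ F L X := by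
  induction L with
  | nil => simp [F]
  | cons p L ih => exact mul_nonneg ih (sq_nonneg _)

theorem F_eq_zero {L : List (ℤ × ℤ)} {X : ℤ} : F L X = 0 ↔ X ∈ L.map Prod.fst := by
  induction L with
  | nil => simp [F]
  | cons p L ih =>
    simp only [F, mul_eq_zero, ih, List.map_cons, List.mem_cons, pow_eq_zero_iff two_ne_zero,
      sub_eq_zero]
    tauto

/-- At a key, the quotient `P / Q` is the value stored with it. -/
theorem Q_pos_and_P_eq {L : List (ℤ × ℤ)} (hL : (L.map Prod.fst).Nodup) {a v : ℤ}
    (h : (a, v) ∈ L) : 0 < Q L a ∧ P L a = v * Q L a := by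
  induction L with
  | nil => simp at h
  | cons p L ih =>
    obtain ⟨b, u⟩ := p
    simp only [List.map_cons, List.nodup_cons] at hL
    rcases List.mem_cons.1 h with h | h
    · obtain ⟨rfl, rfl⟩ := Prod.mk.inj h
      have h1 : F L a ≠ 0 := fun h0 => hL.1 (F_eq_zero.1 h0)
      have := lt_of_le_of_ne (F_nonneg L a) h1.symm
      simp [Q, P, this]
    · have ha : a ∈ L.map Prod.fst := List.mem_map.2 ⟨_, h, rfl⟩
      have hne : a - b ≠ 0 := fun h0 => hL.1 (by rwa [← sub_eq_zero.1 h0])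
      obtain ⟨h1, h2⟩ := ih hL.2 h
      have h3 : 0 < (a - b) ^ 2 := by positivity
      simp only [Q, P, F_eq_zero.2 ha, h2]
      exact ⟨by positivity, by ring⟩

theorem bounds {L : List (ℤ × ℤ)} {K n a : ℤ} (hK : 0 ≤ K) (hn : 0 ≤ n)
    (hL : ∀ p ∈ L, 0 ≤ p.1 ∧ p.1 ≤ K ∧ 0 ≤ p.2 ∧ p.2 ≤ n) (ha : 0 ≤ a) (haK : a ≤ K) :
    F L a ≤ (2 * (K + 1) ^ 2) ^ L.length ∧
    (0 ≤ Q L a ∧ Q L a ≤ (2 * (K + 1) ^ 2) ^ L.length) ∧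
    (0 ≤ P L a ∧ P L a ≤ n * (2 * (K + 1) ^ 2) ^ L.length) := by
  induction L with
  | nil => simp [F, Q, P, hn]
  | cons p L ih =>
    obtain ⟨b, v⟩ := p
    obtain ⟨hF, ⟨hQ0, hQ⟩, hP0, hP⟩ := ih fun q hq => hL q (List.mem_cons_of_mem _ hq)
    obtain ⟨hb0, hbK, hv0, hvn⟩ := hL (b, v) (by simp)
    simp only at hb0 hbK hv0 hvn
    have hF0 := F_nonneg L a
    have hs0 : 0 ≤ (a - b) ^ 2 := sq_nonneg _
    have hs : (a - b) ^ 2 ≤ (K + 1) ^ 2 := by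
      apply sq_le_sq'
      · linarith
      · linarith
    set G := (K + 1) ^ 2 with hG
    have hG1 : 1 ≤ G := by rw [hG]; nlinarith
    set E := (2 * G) ^ L.length with hE
    have hE0 : 0 ≤ E := by positivity
    have e1 : F L a * (a - b) ^ 2 ≤ E * G := mul_le_mul hF hs hs0 hE0
    have e2 : Q L a * (a - b) ^ 2 ≤ E * G := mul_le_mul hQ hs hs0 hE0
    have e3 : P L a * (a - b) ^ 2 ≤ n * E * G := mul_le_mul hP hs hs0 (by positivity)
    have e4 : v * F L a ≤ n * E := mul_le_mul hvn hF hF0 hn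
    have e5 : E ≤ E * G := by nlinarith
    have e6 : n * E ≤ n * E * G := by nlinarith [mul_nonneg hn hE0]
    simp only [F, Q, P, List.length_cons, pow_succ (2 * G), ← hE]
    refine ⟨by nlinarith, ⟨add_nonneg (mul_nonneg hQ0 hs0) hF0, by nlinarith⟩,
      add_nonneg (mul_nonneg hP0 hs0) (mul_nonneg hv0 hF0), by nlinarith⟩

theorem modEq (L : List (ℤ × ℤ)) (B a : ℤ) :
    F L B ≡ F L a [ZMOD (B - a)] ∧ Q L B ≡ Q L a [ZMOD (B - a)] ∧
      P L B ≡ P L a [ZMOD (B - a)] := by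
  have hB : B ≡ a [ZMOD (B - a)] := (Int.modEq_iff_dvd.2 ⟨-1, by ring⟩)
  induction L with
  | nil => simp [F, Q, P, Int.ModEq.refl]
  | cons p L ih =>
    obtain ⟨hF, hQ, hP⟩ := ih
    have hs : (B - p.1) ^ 2 ≡ (a - p.1) ^ 2 [ZMOD (B - a)] := (hB.sub_right _).pow 2
    exact ⟨hF.mul hs, (hQ.mul hs).add hF, (hP.mul hs).add (hF.mul_left _)⟩

/-- A polynomial that is stored as its value at a huge number `B` can be evaluated at `a` by one
division with remainder, as `B ≡ a` modulo `B - a`. -/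
theorem emod_eq {L : List (ℤ × ℤ)} {K n a B : ℤ} (hK : 0 ≤ K) (hn : 1 ≤ n)
    (hL : ∀ p ∈ L, 0 ≤ p.1 ∧ p.1 ≤ K ∧ 0 ≤ p.2 ∧ p.2 ≤ n) (ha : 0 ≤ a) (haK : a ≤ K)
    {N : ℕ} (hN : L.length ≤ N) (hB : K + n * (2 * (K + 1) ^ 2) ^ N < B) :
    F L B % (B - a) = F L a ∧ Q L B % (B - a) = Q L a ∧ P L B % (B - a) = P L a := by
  obtain ⟨h1, ⟨h2, h3⟩, h4, h5⟩ := bounds hK (by omega : 0 ≤ n) hL ha haK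
  obtain ⟨m1, m2, m3⟩ := modEq L B a
  have hG : 1 ≤ 2 * (K + 1) ^ 2 := by nlinarith
  have hE : (2 * (K + 1) ^ 2) ^ L.length ≤ (2 * (K + 1) ^ 2) ^ N := pow_le_pow_right₀ hG hN
  have hE0 : 0 ≤ (2 * (K + 1) ^ 2) ^ N := by positivity
  have hE1 : (2 * (K + 1) ^ 2) ^ N ≤ n * (2 * (K + 1) ^ 2) ^ N := by nlinarith
  have hE2 : n * (2 * (K + 1) ^ 2) ^ L.length ≤ n * (2 * (K + 1) ^ 2) ^ N :=
    mul_le_mul_of_nonneg_left hE (by omega)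
  refine ⟨?_, ?_, ?_⟩
  · rw [m1, Int.emod_eq_of_lt (F_nonneg L a) (by linarith)]
  · rw [m2, Int.emod_eq_of_lt h2 (by linarith)]
  · rw [m3, Int.emod_eq_of_lt h4 (by linarith)]

end Dict

theorem floor_intCast_div (p : ℤ) {q : ℤ} (hq : 0 < q) : ⌊(p : ℝ) / q⌋ = p / q := by
  have hq' : (0 : ℝ) < q := by exact_mod_cast hq
  rw [Int.floor_eq_iff, le_div_iff₀ hq', div_lt_iff₀ hq']
  have h1 := Int.ediv_mul_le p hq.ne'
  have h2 := Int.lt_ediv_add_one_mul_self p hq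
  exact ⟨by exact_mod_cast h1, by exact_mod_cast h2⟩

/-- The remainder of a division, by floor arithmetic. -/
theorem sub_mul_floor_div (p : ℤ) {q : ℤ} (hq : 0 < q) :
    (p : ℝ) - q * (⌊(p : ℝ) / q⌋ : ℤ) = ((p % q : ℤ) : ℝ) := by
  rw [floor_intCast_div p hq, Int.emod_def]; push_cast; ring

/-! ### Piecewise linear interpolation -/

/-- The linear interpolation of `f 0, …, f N` with the value `f i` at the parameter `i`, extended
by constants. -/
def lin (f : ℕ → ℝ) : ℕ → ℝ → ℝ
  | 0, _ => f 0
  | N + 1, u => lin f N u + (f (N + 1) - f N) * max 0 (min 1 (u - N))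

theorem lin_of_ge (f : ℕ → ℝ) {N : ℕ} {u : ℝ} (h : (N : ℝ) ≤ u) : lin f N u = f N := by
  induction N with
  | zero => rfl
  | succ N ih =>
    push_cast at h
    rw [lin, ih (by linarith), min_eq_left (by linarith), max_eq_right zero_le_one]; ring

theorem lin_cell (f : ℕ → ℝ) {N j : ℕ} (hj : j < N) {u : ℝ} (h1 : (j : ℝ) ≤ u) (h2 : u ≤ j + 1) :
    lin f N u = f j + (f (j + 1) - f j) * (u - j) := by
  induction N with
  | zero => omega
  | succ N ih =>
    rcases Nat.lt_succ_iff_lt_or_eq.1 hj with h | h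
    · have : (j : ℝ) + 1 ≤ N := by exact_mod_cast h
      rw [lin, ih h, min_eq_right (by linarith), max_eq_left (by linarith)]; ring
    · subst h
      rw [lin, lin_of_ge f h1, min_eq_right (by linarith), max_eq_right (by linarith)]

theorem lin_natCast (f : ℕ → ℝ) {N j : ℕ} (hj : j ≤ N) : lin f N j = f j := by
  rcases hj.lt_or_eq with h | h
  · rw [lin_cell f h le_rfl (by linarith)]; ring
  · rw [h, lin_of_ge f le_rfl]

theorem continuous_lin (f : ℕ → ℝ) (N : ℕ) : Continuous (lin f N) := by
  induction N with
  | zero => exact continuous_const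
  | succ N ih =>
    change Continuous fun u => lin f N u + (f (N + 1) - f N) * max 0 (min 1 (u - N))
    fun_prop

theorem monotone_lin {f : ℕ → ℝ} {N : ℕ} (h : ∀ i < N, f i ≤ f (i + 1)) :
    Monotone (lin f N) := by
  induction N with
  | zero => exact monotone_const
  | succ N ih =>
    intro u v huv
    have h1 := ih (fun i hi => h i (by omega)) huv
    have h2 : 0 ≤ f (N + 1) - f N := sub_nonneg.2 (h N (by omega))
    have h3 : max 0 (min 1 (u - N)) ≤ max 0 (min 1 (v - N)) := by gcongr
    exact add_le_add h1 (mul_le_mul_of_nonneg_left h3 h2)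

theorem lin_congr {f g : ℕ → ℝ} {N : ℕ} (h : ∀ i ≤ N, f i = g i) (u : ℝ) :
    lin f N u = lin g N u := by
  induction N with
  | zero => exact h 0 le_rfl
  | succ N ih =>
    rw [lin, lin, ih fun i hi => h i (by omega), h (N + 1) le_rfl, h N (by omega)]

/-- On each unit cell, the interpolation is affine. -/
theorem lin_affine (f : ℕ → ℝ) (N j : ℕ) {a b l : ℝ} (ha : (j : ℝ) ≤ a) (hab : a ≤ b)
    (hb : b ≤ j + 1) (h0 : 0 ≤ l) (h1 : l ≤ 1) :
    lin f N (a + (b - a) * l) = lin f N a + (lin f N b - lin f N a) * l := by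
  have e1 : a ≤ a + (b - a) * l := by nlinarith
  have e2 : a + (b - a) * l ≤ b := by nlinarith
  rcases lt_or_ge j N with h | h
  · rw [lin_cell f h ha (by linarith), lin_cell f h (by linarith) hb,
      lin_cell f h (by linarith) (by linarith)]; ring
  · have : (N : ℝ) ≤ j := by exact_mod_cast h
    rw [lin_of_ge f (by linarith), lin_of_ge f (by linarith), lin_of_ge f (by linarith)]; ring

theorem lin_comp {f g s : ℕ → ℝ} {N k : ℕ} (hs : ∀ c < N, s c ≤ s (c + 1))
    (hc : ∀ c < N, ∃ j : ℕ, (j : ℝ) ≤ s c ∧ s (c + 1) ≤ j + 1)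
    (hf : ∀ c ≤ N, f c = lin g k (s c)) {u : ℝ} (hu : 0 ≤ u) :
    lin f N u = lin g k (lin s N u) := by
  rcases le_or_gt (N : ℝ) u with h | h
  · rw [lin_of_ge f h, lin_of_ge s h, hf N le_rfl]
  · have h1 : ((⌊u⌋₊ : ℕ) : ℝ) ≤ u := Nat.floor_le hu
    have h2 : u ≤ (⌊u⌋₊ : ℕ) + 1 := (Nat.lt_floor_add_one u).le
    have h3 : ⌊u⌋₊ < N := by
      have : ((⌊u⌋₊ : ℕ) : ℝ) < N := lt_of_le_of_lt h1 h
      exact_mod_cast this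
    obtain ⟨j, hj1, hj2⟩ := hc _ h3
    rw [lin_cell f h3 h1 h2, lin_cell s h3 h1 h2,
      lin_affine g k j hj1 (hs _ h3) hj2 (by linarith) (by linarith), hf _ h3.le, hf _ h3]

theorem abs_lin_sub_lin_le {f g : ℕ → ℝ} {N : ℕ} {D : ℝ} (h : ∀ i ≤ N, |f i - g i| ≤ D)
    {u : ℝ} (hu : 0 ≤ u) : |lin f N u - lin g N u| ≤ D := by
  rcases le_or_gt (N : ℝ) u with h0 | h0
  · rw [lin_of_ge f h0, lin_of_ge g h0]; exact h N le_rfl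
  · have h1 : ((⌊u⌋₊ : ℕ) : ℝ) ≤ u := Nat.floor_le hu
    have h2 : u ≤ (⌊u⌋₊ : ℕ) + 1 := (Nat.lt_floor_add_one u).le
    have h3 : ⌊u⌋₊ < N := by
      have : ((⌊u⌋₊ : ℕ) : ℝ) < N := lt_of_le_of_lt h1 h0
      exact_mod_cast this
    rw [lin_cell f h3 h1 h2, lin_cell g h3 h1 h2]
    have a := abs_le.1 (h _ h3.le)
    have b := abs_le.1 (h _ h3)
    set l := u - (⌊u⌋₊ : ℕ)
    have hl0 : 0 ≤ l := by linarith
    have hl1 : l ≤ 1 := by linarith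
    rw [abs_le]
    constructor <;> nlinarith

theorem timeSeries_eq_lin {m : ℕ} (hm : 1 ≤ m) (x : Fin m → ℝ) (t : I) :
    timeSeries x t = lin (seqAt x) (m - 1) ((t : ℝ) * (m - 1 : ℕ)) := by
  have hc : ((m - 1 : ℕ) : ℝ) = (m : ℝ) - 1 := by push_cast [hm]; ring
  rw [hc]
  unfold timeSeries
  simp only
  set s : ℝ := (t : ℝ) * ((m : ℝ) - 1) with hs
  have hm1 : (0 : ℝ) ≤ (m : ℝ) - 1 := by rw [← hc]; positivity
  have hs0 : 0 ≤ s := mul_nonneg t.2.1 hm1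
  have hs1 : s ≤ (m : ℝ) - 1 := by nlinarith [t.2.2]
  have hfr : Int.fract s = s - (⌊s⌋₊ : ℕ) := by
    rw [Int.fract, natCast_floor_eq_intCast_floor hs0]
  have h1 : ((⌊s⌋₊ : ℕ) : ℝ) ≤ s := Nat.floor_le hs0
  have h2 : s ≤ (⌊s⌋₊ : ℕ) + 1 := (Nat.lt_floor_add_one s).le
  rcases lt_or_ge ⌊s⌋₊ (m - 1) with h | h
  · rw [lin_cell _ h h1 h2, hfr]; ring
  · have h3 : ((m - 1 : ℕ) : ℝ) ≤ (⌊s⌋₊ : ℕ) := by exact_mod_cast h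
    have h4 : ⌊s⌋₊ = m - 1 := by
      have : ((⌊s⌋₊ : ℕ) : ℝ) = (m - 1 : ℕ) := by linarith
      exact_mod_cast this
    have h5 : Int.fract s = 0 := by rw [hfr]; linarith
    rw [lin_of_ge _ (by linarith), h5, h4]; ring

theorem continuous_timeSeries {m : ℕ} (hm : 1 ≤ m) (x : Fin m → ℝ) :
    Continuous (timeSeries x) := by
  have : timeSeries x = fun t : I => lin (seqAt x) (m - 1) ((t : ℝ) * (m - 1 : ℕ)) :=
    funext fun t => timeSeries_eq_lin hm x t
  rw [this]
  exact (continuous_lin _ _).comp (by fun_prop)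

/-! ### Matchings of bounded width -/

/-- Some matching of `p` and `q` has width at most `D`. -/
def FD (D : ℝ) (p q : I → ℝ) : Prop := ∃ φ : Matching, ∀ a, |p (φ.f a) - q (φ.g a)| ≤ D

theorem FD.frechetDist_le {D : ℝ} {p q : I → ℝ} (h : FD D p q) : frechetDist p q ≤ D := by
  obtain ⟨φ, hφ⟩ := h
  refine (ciInf_le ⟨0, ?_⟩ φ).trans (ciSup_le hφ)
  rintro _ ⟨ψ, rfl⟩
  exact Real.iSup_nonneg fun a => abs_nonneg _

instance : Nonempty Matching :=
  ⟨⟨id, id, continuous_id, continuous_id, monotone_id, monotone_id, rfl, rfl, rfl, rfl⟩⟩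

theorem FD.of_frechetDist_lt {D : ℝ} {p q : I → ℝ} (hp : Continuous p) (hq : Continuous q)
    (h : frechetDist p q < D) : FD D p q := by
  obtain ⟨φ, hφ⟩ := exists_lt_of_ciInf_lt h
  refine ⟨φ, fun a => (le_ciSup (f := fun a => |p (φ.f a) - q (φ.g a)|) ?_ a).trans hφ.le⟩
  have hc : Continuous fun a => |p (φ.f a) - q (φ.g a)| :=
    ((hp.comp φ.continuous_f).sub (hq.comp φ.continuous_g)).abs
  exact (isCompact_range hc).bddAbove

theorem FD.symm {D : ℝ} {p q : I → ℝ} (h : FD D p q) : FD D q p := by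
  obtain ⟨φ, hφ⟩ := h
  exact ⟨⟨φ.g, φ.f, φ.continuous_g, φ.continuous_f, φ.monotone_g, φ.monotone_f, φ.g_zero, φ.f_zero,
    φ.g_one, φ.f_one⟩, fun a => by rw [abs_sub_comm]; exact hφ a⟩

/-- Two reparametrizations of `[0,1]` have a common refinement. For `c ∈ [0,2]`, take the largest
`s ≤ c` with `g s ≤ f (c - s)`; both `s` and `c - s` are non-decreasing in `c`. -/
theorem exists_common_reparametrization {f g : I → I} (hf : Continuous f) (hg : Continuous g)
    (mf : Monotone f) (mg : Monotone g) (f0 : f 0 = 0) (g0 : g 0 = 0) (f1 : f 1 = 1)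
    (g1 : g 1 = 1) : ∃ φ : Matching, ∀ a, g (φ.f a) = f (φ.g a) := by
  have h01 : (0 : ℝ) ≤ 1 := zero_le_one
  let pr : ℝ → I := projIcc 0 1 h01
  have pc : Continuous pr := continuous_projIcc
  have pm : Monotone pr := monotone_projIcc h01
  have pr0 : ∀ x ≤ 0, pr x = 0 := fun x hx => projIcc_of_le_left h01 hx
  have pr1 : ∀ x, 1 ≤ x → pr x = 1 := fun x hx => projIcc_of_right_le h01 hx
  let A : ℝ → ℝ := fun x => g (pr x)
  let B : ℝ → ℝ := fun x => f (pr x)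
  have cA : Continuous A := continuous_subtype_val.comp (hg.comp pc)
  have cB : Continuous B := continuous_subtype_val.comp (hf.comp pc)
  have mA : Monotone A := fun x y h => mg (pm h)
  have mB : Monotone B := fun x y h => mf (pm h)
  have A0 : ∀ x ≤ 0, A x = 0 := fun x hx => by simp [A, pr0 x hx, g0]
  have B0 : ∀ x ≤ 0, B x = 0 := fun x hx => by simp [B, pr0 x hx, f0]
  have A1 : ∀ x, 1 ≤ x → A x = 1 := fun x hx => by simp [A, pr1 x hx, g1]
  have B1 : ∀ x, 1 ≤ x → B x = 1 := fun x hx => by simp [B, pr1 x hx, f1]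
  have An : ∀ x, 0 ≤ A x := fun x => (g (pr x)).2.1
  have Bn : ∀ x, 0 ≤ B x := fun x => (f (pr x)).2.1
  have Al : ∀ x, A x ≤ 1 := fun x => (g (pr x)).2.2
  have Bl : ∀ x, B x ≤ 1 := fun x => (f (pr x)).2.2
  let S : ℝ → Set ℝ := fun c => {s | 0 ≤ s ∧ s ≤ 1 ∧ s ≤ c ∧ A s ≤ B (c - s)}
  have hSb : ∀ c, BddAbove (S c) := fun c => ⟨1, fun s hs => hs.2.1⟩
  have hS0 : ∀ c, 0 ≤ c → (0 : ℝ) ∈ S c := fun c hc =>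
    ⟨le_rfl, h01, hc, by rw [A0 0 le_rfl]; exact Bn _⟩
  have hScl : ∀ c, IsClosed (S c) := fun c =>
    (isClosed_le continuous_const continuous_id).inter <|
      (isClosed_le continuous_id continuous_const).inter <|
        (isClosed_le continuous_id continuous_const).inter <|
          isClosed_le cA (cB.comp (continuous_const.sub continuous_id))
  let τ : ℝ → ℝ := fun c => sSup (S c)
  have hτ : ∀ c, 0 ≤ c → τ c ∈ S c := fun c hc =>
    (hScl c).csSup_mem ⟨0, hS0 c hc⟩ (hSb c)
  have hle : ∀ c s, s ∈ S c → s ≤ τ c := fun c s hs => le_csSup (hSb c) hs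
  have hmono : ∀ c c', 0 ≤ c → c ≤ c' → τ c ≤ τ c' := by
    intro c c' hc hcc
    obtain ⟨a1, a2, a3, a4⟩ := hτ c hc
    exact hle _ _ ⟨a1, a2, by linarith, a4.trans (mB (by linarith))⟩
  have hlip : ∀ c c', 0 ≤ c → c ≤ c' → τ c' - (c' - c) ≤ τ c := by
    intro c c' hc hcc
    obtain ⟨a1, a2, a3, a4⟩ := hτ c' (hc.trans hcc)
    rcases le_or_gt 0 (τ c' - (c' - c)) with h | h
    · refine hle _ _ ⟨h, by linarith, by linarith, ?_⟩
      calc A (τ c' - (c' - c)) ≤ A (τ c') := mA (by linarith)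
        _ ≤ B (c' - τ c') := a4
        _ = _ := by congr 1; ring
    · exact h.le.trans (hτ c hc).1
  have hlow : ∀ c, 0 ≤ c → c ≤ 2 → c - 1 ≤ τ c := by
    intro c hc hc2
    rcases le_or_gt c 1 with h | h
    · have := (hτ c hc).1; linarith
    · exact hle _ _ ⟨by linarith, by linarith, by linarith, by
        rw [B1 _ (by linarith)]; exact Al _⟩
  have heq : ∀ c, 0 ≤ c → A (τ c) = B (c - τ c) := by
    intro c hc
    obtain ⟨a1, a2, a3, a4⟩ := hτ c hc
    by_contra hne
    have hlt : A (τ c) < B (c - τ c) := lt_of_le_of_ne a4 hne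
    have h1 : τ c < 1 := by
      refine lt_of_le_of_ne a2 fun h => ?_
      rw [h, A1 1 le_rfl] at hlt
      exact absurd hlt (not_lt.2 (Bl _))
    have h2 : τ c < c := by
      refine lt_of_le_of_ne a3 fun h => ?_
      rw [B0 (c - τ c) (by linarith)] at hlt
      exact absurd hlt (not_lt.2 (An _))
    have hev : ∀ᶠ s in nhds (τ c), A s < B (c - s) :=
      (cA.tendsto _).eventually_lt ((cB.comp (continuous_const.sub continuous_id)).tendsto _) hlt
    have hev2 : ∀ᶠ s in nhds (τ c), s < 1 ∧ s < c := (gt_mem_nhds h1).and (gt_mem_nhds h2)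
    obtain ⟨s, ⟨hs1, hs2⟩, hs3⟩ :=
      (((hev.and hev2).filter_mono nhdsWithin_le_nhds).and
        (self_mem_nhdsWithin (a := τ c) (s := Ioi (τ c)))).exists
    exact absurd (hle c s ⟨a1.trans (le_of_lt hs3), hs2.1.le, hs2.2.le, hs1.le⟩) (not_le.2 hs3)
  have hτc : LipschitzOnWith 1 τ (Ici 0) := by
    refine LipschitzOnWith.of_dist_le_mul fun c hc c' hc' => ?_
    rw [NNReal.coe_one, one_mul, Real.dist_eq, Real.dist_eq]
    rcases le_total c c' with h | h
    · have e1 := hmono c c' hc h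
      have e2 := hlip c c' hc h
      rw [abs_sub_comm, abs_of_nonneg (by linarith), abs_sub_comm, abs_of_nonneg (by linarith)]
      linarith
    · have e1 := hmono c' c hc' h
      have e2 := hlip c' c hc' h
      rw [abs_of_nonneg (by linarith), abs_of_nonneg (by linarith)]
      linarith
  have hcont : Continuous fun a : I => τ (2 * (a : ℝ)) :=
    hτc.continuousOn.comp_continuous (by fun_prop)
      fun a => mul_nonneg zero_le_two a.2.1
  have h2 : ∀ a : I, (0 : ℝ) ≤ 2 * (a : ℝ) := fun a => mul_nonneg zero_le_two a.2.1
  have h2' : ∀ a : I, 2 * (a : ℝ) ≤ 2 := fun a => by linarith [a.2.2]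
  have prv : ∀ (x : ℝ) (h : x ∈ I), pr x = ⟨x, h⟩ := fun x h => projIcc_of_mem h01 h
  refine ⟨⟨fun a => ⟨τ (2 * a), (hτ _ (h2 a)).1, (hτ _ (h2 a)).2.1⟩,
    fun a => ⟨2 * a - τ (2 * a), by linarith [(hτ _ (h2 a)).2.2.1],
      by linarith [hlow _ (h2 a) (h2' a)]⟩,
    hcont.subtype_mk _, ((continuous_const.mul continuous_subtype_val).sub hcont).subtype_mk _, ?_, ?_, ?_, ?_, ?_, ?_⟩, ?_⟩
  · intro a b hab
    exact hmono _ _ (h2 a) (mul_le_mul_of_nonneg_left hab zero_le_two)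
  · intro a b hab
    have := hlip _ _ (h2 a) (mul_le_mul_of_nonneg_left hab zero_le_two)
    change 2 * (a : ℝ) - τ (2 * a) ≤ 2 * (b : ℝ) - τ (2 * b)
    linarith
  · have := hτ (2 * (0 : ℝ)) (by norm_num)
    exact Subtype.ext (le_antisymm (by simpa using this.2.2.1) this.1)
  · have := hτ (2 * (0 : ℝ)) (by norm_num)
    refine Subtype.ext ?_
    have e : τ (2 * (0 : ℝ)) = 0 := le_antisymm (by simpa using this.2.2.1) this.1
    change 2 * (0 : ℝ) - τ (2 * 0) = 0
    linarith
  · have e1 := hlow (2 * (1 : ℝ)) (by norm_num) (by norm_num)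
    have e2 := (hτ (2 * (1 : ℝ)) (by norm_num)).2.1
    exact Subtype.ext (le_antisymm e2 (by change (1 : ℝ) ≤ τ (2 * 1); linarith))
  · have e1 := hlow (2 * (1 : ℝ)) (by norm_num) (by norm_num)
    have e2 := (hτ (2 * (1 : ℝ)) (by norm_num)).2.1
    refine Subtype.ext ?_
    change 2 * (1 : ℝ) - τ (2 * 1) = 1
    linarith
  · intro a
    have := heq _ (h2 a)
    simp only [A, B] at this
    rw [prv _ ⟨(hτ _ (h2 a)).1, (hτ _ (h2 a)).2.1⟩,
      prv _ ⟨by linarith [(hτ _ (h2 a)).2.2.1], by linarith [hlow _ (h2 a) (h2' a)]⟩] at this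
    exact Subtype.ext this

theorem FD.trans {D E : ℝ} {p q w : I → ℝ} (h1 : FD D p q) (h2 : FD E q w) :
    FD (D + E) p w := by
  obtain ⟨φ, hφ⟩ := h1
  obtain ⟨ψ, hψ⟩ := h2
  obtain ⟨χ, hχ⟩ := exists_common_reparametrization ψ.continuous_f φ.continuous_g ψ.monotone_f
    φ.monotone_g ψ.f_zero φ.g_zero ψ.f_one φ.g_one
  refine ⟨⟨φ.f ∘ χ.f, ψ.g ∘ χ.g, φ.continuous_f.comp χ.continuous_f,
    ψ.continuous_g.comp χ.continuous_g, φ.monotone_f.comp χ.monotone_f,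
    ψ.monotone_g.comp χ.monotone_g, ?_, ?_, ?_, ?_⟩, fun a => ?_⟩
  · simp [χ.f_zero, φ.f_zero]
  · simp [χ.g_zero, ψ.g_zero]
  · simp [χ.f_one, φ.f_one]
  · simp [χ.g_one, ψ.g_one]
  · have e1 := hφ (χ.f a)
    have e2 := hψ (χ.g a)
    rw [hχ a] at e1
    calc |p (φ.f (χ.f a)) - w (ψ.g (χ.g a))|
        = |(p (φ.f (χ.f a)) - q (ψ.f (χ.g a))) + (q (ψ.f (χ.g a)) - w (ψ.g (χ.g a)))| := by
          congr 1; ring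
      _ ≤ _ := (abs_add_le _ _).trans (add_le_add e1 e2)

/-! ### Refinements of polylines -/

/-- The vertex with index `i` of a polyline, given by the list of its vertices in reverse order. -/
def node (l : List ℝ) (i : ℕ) : ℝ := l.reverse.getD i 0

/-- The curve through the vertices of a reversed list. -/
def curve (l : List ℝ) (t : I) : ℝ :=
  lin (node l) (l.length - 1) ((t : ℝ) * (l.length - 1 : ℕ))

/-- The reversed list `[f t, …, f 0]`. -/
def pre (f : ℕ → ℝ) : ℕ → List ℝ
  | 0 => [f 0]
  | t + 1 => f (t + 1) :: pre f t

theorem length_pre (f : ℕ → ℝ) (t : ℕ) : (pre f t).length = t + 1 := by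
  induction t with
  | zero => rfl
  | succ t ih => simp [pre, ih]

theorem node_cons_of_lt {x : ℝ} {l : List ℝ} {i : ℕ} (h : i < l.length) :
    node (x :: l) i = node l i := by
  simp only [node, List.reverse_cons]
  rw [List.getD_append _ _ _ _ (by simpa using h)]

theorem node_cons_length (x : ℝ) (l : List ℝ) : node (x :: l) l.length = x := by
  simp only [node, List.reverse_cons]
  rw [List.getD_append_right _ _ _ _ (by simp)]
  simp

theorem node_pre {f : ℕ → ℝ} {t i : ℕ} (h : i ≤ t) : node (pre f t) i = f i := by
  induction t with
  | zero => obtain rfl : i = 0 := by omega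
            rfl
  | succ t ih =>
    rcases Nat.lt_or_ge i (t + 1) with h' | h'
    · rw [pre, node_cons_of_lt (by rw [length_pre]; exact h'), ih (by omega)]
    · obtain rfl : i = t + 1 := by omega
      have := node_cons_length (f (t + 1)) (pre f t)
      rwa [length_pre] at this

theorem curve_pre (f : ℕ → ℝ) (N : ℕ) (t : I) :
    curve (pre f N) t = lin f N ((t : ℝ) * N) := by
  unfold curve
  rw [length_pre, Nat.add_sub_cancel]
  exact lin_congr (fun i hi => node_pre hi) _

theorem curve_pre_seqAt {m : ℕ} (hm : 1 ≤ m) (x : Fin m → ℝ) :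
    curve (pre (seqAt x) (m - 1)) = timeSeries x := by
  funext t
  rw [curve_pre, timeSeries_eq_lin hm]

/-- `Ref Y l`: the polyline `Y` arises from the polyline `l` by inserting points on its edges and
repeating vertices. All lists are reversed. The rules build both polylines from their starts: `l`
gets a new vertex, the last vertex of `l` is moved further along the last edge, or `Y` repeats its
end. -/
inductive Ref : List ℝ → List ℝ → Prop
  | single (x : ℝ) : Ref [x] [x]
  | vertex {Y l : List ℝ} (x : ℝ) : Ref Y l → Ref (x :: Y) (x :: l)
  | slide {Y w : List ℝ} {p q : ℝ} (p' : ℝ) :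
      Ref Y (p :: q :: w) → p ∈ uIcc q p' → Ref (p' :: Y) (p' :: q :: w)
  | stay {Y l : List ℝ} {x : ℝ} : Ref Y (x :: l) → Ref (x :: Y) (x :: l)

theorem Ref.refl {l : List ℝ} (hl : l ≠ []) : Ref l l := by
  induction l with
  | nil => exact absurd rfl hl
  | cons x l ih =>
    cases l with
    | nil => exact .single x
    | cons y l => exact .vertex x (ih (by simp))

theorem le_last_of_chain {s : ℕ → ℝ} {N : ℕ} (hs : ∀ c < N, s c ≤ s (c + 1)) {c : ℕ}
    (hc : c ≤ N) : s c ≤ s N := by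
  induction N with
  | zero => obtain rfl : c = 0 := by omega
            rfl
  | succ N ih =>
    rcases Nat.lt_or_ge c (N + 1) with h | h
    · exact (ih (fun i hi => hs i (by omega)) (by omega)).trans (hs N (by omega))
    · obtain rfl : c = N + 1 := by omega
      rfl

/-- The positions of the points of a refinement on the refined polyline. -/
theorem Ref.exists_positions {Y l : List ℝ} (h : Ref Y l) :
    ∃ (N k : ℕ) (s : ℕ → ℝ), Y.length = N + 1 ∧ l.length = k + 1 ∧ s 0 = 0 ∧ s N = k ∧
      (∀ c < N, s c ≤ s (c + 1)) ∧
      (∀ c < N, ∃ j : ℕ, (j : ℝ) ≤ s c ∧ s (c + 1) ≤ j + 1) ∧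
      ∀ c ≤ N, node Y c = lin (node l) k (s c) := by
  induction h with
  | single x => exact ⟨0, 0, fun _ => 0, rfl, rfl, rfl, by simp, by simp, by simp, by
      intro c hc; obtain rfl : c = 0 := by omega
      rfl⟩
  | @vertex Y l x h ih =>
    obtain ⟨N, k, s, hY, hl, s0, sN, sm, sc, sv⟩ := ih
    refine ⟨N + 1, k + 1, fun c => if c ≤ N then s c else k + 1, by simp [hY], by simp [hl],
      by simp [s0], by simp, ?_, ?_, ?_⟩
    · intro c hc
      rcases Nat.lt_or_ge c N with h' | h'
      · simpa [h', h'.le] using sm c h'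
      · obtain rfl : c = N := by omega
        simp [sN]
    · intro c hc
      rcases Nat.lt_or_ge c N with h' | h'
      · simpa [h', h'.le] using sc c h'
      · obtain rfl : c = N := by omega
        exact ⟨k, by simp [sN]⟩
    · intro c hc
      rcases Nat.lt_or_ge c (N + 1) with h' | h'
      · have h1 : s c ≤ k := sN ▸ le_last_of_chain sm (Nat.lt_succ_iff.1 h')
        simp only [Nat.lt_succ_iff.1 h', if_true]
        rw [node_cons_of_lt (by omega), sv c (by omega), lin, max_eq_left
          ((min_le_right _ _).trans (by linarith)), mul_zero, add_zero]
        exact (lin_congr (fun i hi => node_cons_of_lt (by omega)) _).symm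
      · obtain rfl : c = N + 1 := by omega
        have e1 : node (x :: Y) (N + 1) = x := hY ▸ node_cons_length x Y
        have e2 : node (x :: l) (k + 1) = x := hl ▸ node_cons_length x l
        simp only [Nat.not_succ_le_self, if_false]
        rw [e1, lin_of_ge _ (by simp), e2]
  | @slide Y w p q p' h hp ih =>
    obtain ⟨N, k, s, hY, hl, s0, sN, sm, sc, sv⟩ := ih
    obtain ⟨L, rfl⟩ : ∃ L, k = L + 1 := ⟨w.length, by simp at hl; omega⟩
    have hw : w.length = L := by simp at hl; omega
    rw [← segment_eq_uIcc, segment_eq_image'] at hp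
    obtain ⟨r, ⟨hr0, hr1⟩, hr⟩ := hp
    simp only [smul_eq_mul] at hr
    have hq : node (p :: q :: w) L = q := by
      rw [node_cons_of_lt (by simp [hw])]; exact hw ▸ node_cons_length q w
    have hq' : node (p' :: q :: w) L = q := by
      rw [node_cons_of_lt (by simp [hw])]; exact hw ▸ node_cons_length q w
    have hpn : node (p :: q :: w) (L + 1) = p := by
      have := node_cons_length p (q :: w); rwa [List.length_cons, hw] at this
    have hpn' : node (p' :: q :: w) (L + 1) = p' := by
      have := node_cons_length p' (q :: w); rwa [List.length_cons, hw] at this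
    have hcg : ∀ u, lin (node (p' :: q :: w)) L u = lin (node (p :: q :: w)) L u := fun u =>
      lin_congr (fun i hi => by
        rw [node_cons_of_lt (x := p') (l := q :: w) (by simp [hw]; omega),
          node_cons_of_lt (x := p) (l := q :: w) (by simp [hw]; omega)]) u
    have hsL : ∀ c ≤ N, s c ≤ L + 1 := fun c hc => by
      have := le_last_of_chain sm hc; rw [sN] at this; push_cast at this; exact this
    -- positions on the last edge are rescaled
    let g : ℝ → ℝ := fun u => if u ≤ L then u else L + r * (u - L)
    have g1 : ∀ u, (L : ℝ) ≤ u → u ≤ L + 1 → (L : ℝ) ≤ g u ∧ g u ≤ L + 1 := by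
      intro u h1 h2
      simp only [g]
      split_ifs
      · exact ⟨h1, h2⟩
      · constructor <;> nlinarith
    have gm : ∀ u v, u ≤ v → g u ≤ g v := by
      intro u v huv
      simp only [g]
      split_ifs with h1 h2 h2
      · exact huv
      · nlinarith
      · linarith
      · nlinarith
    refine ⟨N + 1, L + 1, fun c => if c ≤ N then g (s c) else L + 1, by simp [hY], by simp [hw],
      ?_, by simp, ?_, ?_, ?_⟩
    · simp [g, s0]
    · intro c hc
      rcases Nat.lt_or_ge c N with h' | h'
      · simpa [h', h'.le] using gm _ _ (sm c h')
      · obtain rfl : c = N := by omega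
        simpa using (g1 (s c) (by rw [sN]; push_cast; linarith) (hsL c le_rfl)).2
    · intro c hc
      rcases Nat.lt_or_ge c N with h' | h'
      · obtain ⟨j, hj1, hj2⟩ := sc c h'
        simp only [h'.le, if_true, Nat.succ_le_iff.2 h']
        rcases Nat.lt_or_ge j L with hjL | hjL
        · have : (j : ℝ) + 1 ≤ L := by exact_mod_cast hjL
          refine ⟨j, ?_, ?_⟩
          · have : s c ≤ L := by linarith [sm c h']
            simpa [g, this] using hj1
          · have : s (c + 1) ≤ L := by linarith
            simpa [g, this] using hj2
        · have : (L : ℝ) ≤ j := by exact_mod_cast hjL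
          exact ⟨L, (g1 _ (by linarith) (hsL c h'.le)).1,
            (g1 _ (by linarith [sm c h']) (hsL _ h')).2⟩
      · obtain rfl : c = N := by omega
        have := g1 (s c) (by rw [sN]; push_cast; linarith) (hsL c le_rfl)
        exact ⟨L, by simpa using this.1, by simp⟩
    · intro c hc
      rcases Nat.lt_or_ge c (N + 1) with h' | h'
      · have h'' := Nat.lt_succ_iff.1 h'
        simp only [h'', if_true]
        rw [node_cons_of_lt (by omega), sv c h'']
        rcases le_or_gt (s c) (L : ℝ) with hle | hgt
        · have e : max 0 (min 1 (s c - L)) = 0 :=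
            max_eq_left ((min_le_right _ _).trans (by linarith))
          simp only [g, hle, if_true]
          rw [lin, lin, e, hcg]; ring
        · have h1 := g1 _ hgt.le (hsL c h'')
          have e : g (s c) = L + r * (s c - L) := by simp [g, not_le.2 hgt]
          rw [lin_cell _ (Nat.lt_succ_self L) hgt.le (hsL c h''),
            lin_cell _ (Nat.lt_succ_self L) h1.1 h1.2, hq, hq', hpn, hpn', e, ← hr]
          ring
      · obtain rfl : c = N + 1 := by omega
        have e1 : node (p' :: Y) (N + 1) = p' := hY ▸ node_cons_length p' Y
        simp only [Nat.not_succ_le_self, if_false]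
        rw [e1, lin_of_ge _ (by simp), hpn']
  | @stay Y l x h ih =>
    obtain ⟨N, k, s, hY, hl, s0, sN, sm, sc, sv⟩ := ih
    refine ⟨N + 1, k, fun c => if c ≤ N then s c else k, by simp [hY], hl, by simp [s0], by simp,
      ?_, ?_, ?_⟩
    · intro c hc
      rcases Nat.lt_or_ge c N with h' | h'
      · simpa [h', h'.le] using sm c h'
      · obtain rfl : c = N := by omega
        simp [sN]
    · intro c hc
      rcases Nat.lt_or_ge c N with h' | h'
      · simpa [h', h'.le] using sc c h'
      · obtain rfl : c = N := by omega
        exact ⟨k, by simp [sN]⟩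
    · intro c hc
      rcases Nat.lt_or_ge c (N + 1) with h' | h'
      · simp only [Nat.lt_succ_iff.1 h', if_true]
        rw [node_cons_of_lt (by omega), sv c (by omega)]
      · obtain rfl : c = N + 1 := by omega
        have e1 : node (x :: Y) (N + 1) = x := hY ▸ node_cons_length x Y
        have e2 : node (x :: l) k = x := by
          have : l.length = k := by simpa using hl
          exact this ▸ node_cons_length x l
        simp only [Nat.not_succ_le_self, if_false]
        rw [e1, lin_of_ge _ le_rfl, e2]

theorem Ref.exists_reparametrization {Y l : List ℝ} (h : Ref Y l) :
    ∃ φ : I → I, Continuous φ ∧ Monotone φ ∧ φ 0 = 0 ∧ φ 1 = 1 ∧ ∀ t, curve Y t = curve l (φ t) := by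
  obtain ⟨N, k, s, hY, hl, s0, sN, sm, sc, sv⟩ := h.exists_positions
  have hc : ∀ t : I, curve Y t = lin (node l) k (lin s N ((t : ℝ) * N)) := by
    intro t
    unfold curve
    rw [hY, Nat.add_sub_cancel]
    exact lin_comp sm sc sv (mul_nonneg t.2.1 (Nat.cast_nonneg N))
  rcases Nat.eq_zero_or_pos k with rfl | hk
  · refine ⟨id, continuous_id, monotone_id, rfl, rfl, fun t => ?_⟩
    rw [hc]; unfold curve; rw [hl]; rfl
  · have hk' : (0 : ℝ) < k := by exact_mod_cast hk
    have lm := monotone_lin sm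
    have l0 : lin s N 0 = 0 := by
      have := lin_natCast s (Nat.zero_le N); rw [Nat.cast_zero] at this; rw [this, s0]
    have lN : lin s N N = k := by rw [lin_of_ge s le_rfl, sN]
    have r0 : ∀ t : I, 0 ≤ lin s N ((t : ℝ) * N) := fun t =>
      l0 ▸ lm (mul_nonneg t.2.1 (Nat.cast_nonneg N))
    have r1 : ∀ t : I, lin s N ((t : ℝ) * N) ≤ k := fun t =>
      lN ▸ lm (mul_le_of_le_one_left (Nat.cast_nonneg N) t.2.2)
    refine ⟨fun t => ⟨lin s N ((t : ℝ) * N) / k, div_nonneg (r0 t) hk'.le,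
      (div_le_one hk').2 (r1 t)⟩, ?_, ?_, ?_, ?_, ?_⟩
    · exact (((continuous_lin s N).comp (by fun_prop)).div_const _).subtype_mk _
    · intro a b hab
      have : lin s N ((a : ℝ) * N) ≤ lin s N ((b : ℝ) * N) :=
        lm (mul_le_mul_of_nonneg_right hab (Nat.cast_nonneg N))
      exact div_le_div_of_nonneg_right this hk'.le
    · apply Subtype.ext; simp [l0]
    · apply Subtype.ext; simp [lN, hk'.ne']
    · intro t
      rw [hc]
      unfold curve
      rw [hl, Nat.add_sub_cancel]
      simp only
      rw [div_mul_cancel₀ _ hk'.ne']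

theorem forall₂_node {D : ℝ} {X Y : List ℝ} (h : List.Forall₂ (fun a b => |a - b| ≤ D) X Y) :
    ∀ i < X.length, |node X i - node Y i| ≤ D := by
  induction h with
  | nil => simp
  | @cons a b X Y hab h ih =>
    intro i hi
    have hlen := h.length_eq
    simp only [List.length_cons] at hi
    rcases Nat.lt_or_ge i X.length with h' | h'
    · rw [node_cons_of_lt h', node_cons_of_lt (by omega)]; exact ih i h'
    · obtain rfl : i = X.length := by omega
      rw [node_cons_length]
      rw [hlen, node_cons_length]; exact hab

/-- Two polylines with refinements that are pointwise close have small Fréchet distance. -/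
theorem FD.of_ref {D : ℝ} {X Y l l' : List ℝ} (hX : Ref X l) (hY : Ref Y l')
    (h : List.Forall₂ (fun a b => |a - b| ≤ D) X Y) : FD D (curve l) (curve l') := by
  obtain ⟨φ, c1, m1, z1, o1, e1⟩ := hX.exists_reparametrization
  obtain ⟨ψ, c2, m2, z2, o2, e2⟩ := hY.exists_reparametrization
  obtain ⟨N, -, -, hN, -⟩ := hX.exists_positions
  have hlen := h.length_eq
  refine ⟨⟨φ, ψ, c1, c2, m1, m2, z1, z2, o1, o2⟩, fun t => ?_⟩
  change |curve l (φ t) - curve l' (ψ t)| ≤ D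
  rw [← e1, ← e2]
  unfold curve
  rw [← hlen]
  exact abs_lin_sub_lin_le (fun i hi => forall₂_node h i (by omega))
    (mul_nonneg t.2.1 (Nat.cast_nonneg _))

/-- The initial part up to the parameter `s` of the polyline `f 0, f 1, …, f N`. -/
def cut (f : ℕ → ℝ) (N : ℕ) (s : ℝ) : List ℝ :=
  match ⌈s⌉₊ with
  | 0 => [f 0]
  | a + 1 => lin f N s :: pre f a

theorem cut_natCast {f : ℕ → ℝ} {N a : ℕ} (h : a ≤ N) : cut f N a = pre f a := by
  unfold cut
  rw [Nat.ceil_natCast]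
  cases a with
  | zero => rfl
  | succ a => simp only; rw [lin_natCast f h]; rfl

theorem head_cut {f : ℕ → ℝ} {N : ℕ} {s : ℝ} (hs : 0 ≤ s) :
    ∃ l, cut f N s = lin f N s :: l := by
  unfold cut
  rcases h : ⌈s⌉₊ with _ | a
  · have : s = 0 := le_antisymm (Nat.ceil_eq_zero.1 h) hs
    refine ⟨[], ?_⟩
    have e := lin_natCast f (Nat.zero_le N)
    rw [Nat.cast_zero] at e
    simp [this, e]
  · exact ⟨_, rfl⟩

theorem Ref.cut_step {f : ℕ → ℝ} {N : ℕ} {Y : List ℝ} {s s' : ℝ} (hs : 0 ≤ s) (hss : s ≤ s')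
    (hs' : s' ≤ N) (h1 : s' ≤ ⌊s⌋₊ + 1) (h : Ref Y (cut f N s)) :
    Ref (lin f N s' :: Y) (cut f N s') := by
  rcases hss.eq_or_lt with rfl | hlt
  · obtain ⟨l, hl⟩ := head_cut (f := f) (N := N) hs
    rw [hl] at h ⊢
    exact .stay h
  have hfl : ((⌊s⌋₊ : ℕ) : ℝ) ≤ s := Nat.floor_le hs
  have hceil : ⌈s'⌉₊ = ⌊s⌋₊ + 1 := by
    rw [Nat.ceil_eq_iff (by omega)]
    constructor
    · simp; linarith
    · push_cast; exact h1
  have hN : ⌊s⌋₊ < N := by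
    have : ((⌊s⌋₊ : ℕ) : ℝ) < N := by linarith
    exact_mod_cast this
  have e' : cut f N s' = lin f N s' :: pre f ⌊s⌋₊ := by unfold cut; rw [hceil]
  rw [e']
  rcases hfl.eq_or_lt with heq | hlt2
  · have : cut f N s = pre f ⌊s⌋₊ := by
      conv_lhs => rw [← heq]
      exact cut_natCast hN.le
    rw [this] at h
    exact .vertex _ h
  · have hceil2 : ⌈s⌉₊ = ⌊s⌋₊ + 1 := by
      rw [Nat.ceil_eq_iff (by omega)]
      constructor
      · simpa using hlt2
      · push_cast; linarith
    have e : cut f N s = lin f N s :: pre f ⌊s⌋₊ := by unfold cut; rw [hceil2]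
    rw [e] at h
    obtain ⟨w, hw⟩ : ∃ w, pre f ⌊s⌋₊ = f ⌊s⌋₊ :: w := by
      cases ⌊s⌋₊ with
      | zero => exact ⟨[], rfl⟩
      | succ a => exact ⟨_, rfl⟩
    rw [hw] at h ⊢
    refine .slide _ h ?_
    rw [lin_cell f hN hfl (by linarith), lin_cell f hN (by linarith) h1]
    set a := f ⌊s⌋₊
    set b := f (⌊s⌋₊ + 1)
    set u := s - (⌊s⌋₊ : ℕ)
    have hu : 0 ≤ u := by simp only [u]; linarith
    have hv : u ≤ s' - (⌊s⌋₊ : ℕ) := by simp only [u]; linarith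
    rw [mem_uIcc]
    rcases le_total a b with hab | hab
    · left; constructor <;> nlinarith
    · right; constructor <;> nlinarith

/-- Two curves at Fréchet distance at most `D` have refinements of the same length that are
pointwise `D`-close: sample a matching whenever one of the curves reaches a vertex. -/
theorem FD.exists_ref {D : ℝ} {f g : ℕ → ℝ} {M N : ℕ}
    (h : FD D (curve (pre f M)) (curve (pre g N))) :
    ∃ X Y, Ref X (pre f M) ∧ Ref Y (pre g N) ∧ List.Forall₂ (fun a b => |a - b| ≤ D) X Y := by
  obtain ⟨φ, hφ⟩ := h
  let F : I → ℝ := fun t => (φ.f t : ℝ) * M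
  let G : I → ℝ := fun t => (φ.g t : ℝ) * N
  have cF : Continuous F := (continuous_subtype_val.comp φ.continuous_f).mul continuous_const
  have cG : Continuous G := (continuous_subtype_val.comp φ.continuous_g).mul continuous_const
  have mF : Monotone F := fun a b hab =>
    mul_le_mul_of_nonneg_right (φ.monotone_f hab) (Nat.cast_nonneg M)
  have mG : Monotone G := fun a b hab =>
    mul_le_mul_of_nonneg_right (φ.monotone_g hab) (Nat.cast_nonneg N)
  have F0 : F 0 = 0 := by simp [F, φ.f_zero]
  have G0 : G 0 = 0 := by simp [G, φ.g_zero]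
  have F1 : F 1 = M := by simp [F, φ.f_one]
  have G1 : G 1 = N := by simp [G, φ.g_one]
  have Fn : ∀ t, 0 ≤ F t := fun t => mul_nonneg (φ.f t).2.1 (Nat.cast_nonneg M)
  have Gn : ∀ t, 0 ≤ G t := fun t => mul_nonneg (φ.g t).2.1 (Nat.cast_nonneg N)
  have Fl : ∀ t, F t ≤ M := fun t => mul_le_of_le_one_left (Nat.cast_nonneg M) (φ.f t).2.2
  have Gl : ∀ t, G t ≤ N := fun t => mul_le_of_le_one_left (Nat.cast_nonneg N) (φ.g t).2.2
  have hd : ∀ t, |lin f M (F t) - lin g N (G t)| ≤ D := by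
    intro t
    have := hφ t
    rwa [curve_pre, curve_pre] at this
  -- the time at which a function reaches its next integer value
  have next : ∀ (H : I → ℝ) (K : ℕ), Continuous H → Monotone H → H 1 = K → ∀ t : I, 0 ≤ H t →
      ∃ t' : I, t ≤ t' ∧ H t' ≤ ⌊H t⌋₊ + 1 ∧ (t' < 1 → ⌊H t⌋₊ + 1 ≤ ⌊H t'⌋₊) := by
    intro H K cH mH H1 t ht
    rcases le_or_gt (K : ℝ) (⌊H t⌋₊ + 1) with hK | hK
    · exact ⟨1, t.2.2, by rw [H1]; exact hK, fun h => absurd h (lt_irrefl _)⟩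
    · have hiv : ((⌊H t⌋₊ : ℝ) + 1) ∈ Icc (H t) (H 1) :=
        ⟨(Nat.lt_floor_add_one _).le, by rw [H1]; exact hK.le⟩
      obtain ⟨t', ⟨ht', -⟩, e⟩ := intermediate_value_Icc (show t ≤ 1 from t.2.2) cH.continuousOn hiv
      refine ⟨t', ht', e.le, fun _ => ?_⟩
      rw [e]
      exact Nat.le_floor (by push_cast; exact le_rfl)
  have key : ∀ n : ℕ, ∀ t : I, (M + N) - (⌊F t⌋₊ + ⌊G t⌋₊) = n →
      (∃ X Y, Ref X (cut f M (F t)) ∧ Ref Y (cut g N (G t)) ∧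
        List.Forall₂ (fun a b => |a - b| ≤ D) X Y) →
      ∃ X Y, Ref X (cut f M (F 1)) ∧ Ref Y (cut g N (G 1)) ∧
        List.Forall₂ (fun a b => |a - b| ≤ D) X Y := by
    intro n
    induction n using Nat.strong_induction_on with
    | _ n ih =>
      rintro t hn ⟨X, Y, hX, hY, hXY⟩
      obtain ⟨t1, a1, a2, a3⟩ := next F M cF mF F1 t (Fn t)
      obtain ⟨t2, b1, b2, b3⟩ := next G N cG mG G1 t (Gn t)
      have hstep : ∃ X Y, Ref X (cut f M (F (min t1 t2))) ∧ Ref Y (cut g N (G (min t1 t2))) ∧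
          List.Forall₂ (fun a b => |a - b| ≤ D) X Y :=
        ⟨_, _, hX.cut_step (Fn t) (mF (le_min a1 b1)) (Fl _) ((mF (min_le_left _ _)).trans a2),
          hY.cut_step (Gn t) (mG (le_min a1 b1)) (Gl _) ((mG (min_le_right _ _)).trans b2),
          .cons (hd _) hXY⟩
      have hfm : ⌊F t⌋₊ ≤ ⌊F (min t1 t2)⌋₊ := Nat.floor_mono (mF (le_min a1 b1))
      have hgm : ⌊G t⌋₊ ≤ ⌊G (min t1 t2)⌋₊ := Nat.floor_mono (mG (le_min a1 b1))
      by_cases h1 : min t1 t2 = 1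
      · rwa [h1] at hstep
      · have hlt : min t1 t2 < 1 := lt_of_le_of_ne (min t1 t2).2.2 h1
        have hFM : ⌊F (min t1 t2)⌋₊ ≤ M := Nat.floor_le_of_le (Fl _)
        have hGN : ⌊G (min t1 t2)⌋₊ ≤ N := Nat.floor_le_of_le (Gl _)
        refine ih _ ?_ (min t1 t2) rfl hstep
        rcases min_choice t1 t2 with e | e
        · have := a3 (by rwa [e] at hlt)
          rw [e] at hfm hgm hFM hGN ⊢
          omega
        · have := b3 (by rwa [e] at hlt)
          rw [e] at hfm hgm hFM hGN ⊢
          omega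
  have h0 : ∀ (f : ℕ → ℝ) (M : ℕ), cut f M 0 = [f 0] := fun f M => by
    have := cut_natCast (f := f) (Nat.zero_le M); rw [Nat.cast_zero] at this; exact this
  have l0 : ∀ (f : ℕ → ℝ) (M : ℕ), lin f M 0 = f 0 := fun f M => by
    have := lin_natCast f (Nat.zero_le M); rw [Nat.cast_zero] at this; exact this
  have hd0 := hd 0
  rw [F0, G0, l0, l0] at hd0
  obtain ⟨X, Y, hX, hY, hXY⟩ := key _ 0 rfl ⟨[f 0], [g 0], by rw [F0, h0]; exact .single _,
    by rw [G0, h0]; exact .single _, .cons hd0 .nil⟩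
  rw [F1, cut_natCast le_rfl] at hX
  rw [G1, cut_natCast le_rfl] at hY
  exact ⟨X, Y, hX, hY, hXY⟩

/-! ### The play operator -/

/-- The state of an online algorithm on a reversed list. -/
def run {α : Type} (init : ℝ → α) (step : α → ℝ → α) : List ℝ → α
  | [] => init 0
  | [x] => init x
  | x :: y :: l => step (run init step (y :: l)) x

theorem run_cons {α : Type} (init : ℝ → α) (step : α → ℝ → α) (x : ℝ) {l : List ℝ} (hl : l ≠ []) :
    run init step (x :: l) = step (run init step l) x := by
  cases l with
  | nil => exact absurd rfl hl
  | cons y l => rfl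

theorem pre_ne_nil (f : ℕ → ℝ) (t : ℕ) : pre f t ≠ [] := by cases t <;> simp [pre]

theorem run_pre_succ {α : Type} (init : ℝ → α) (step : α → ℝ → α) (f : ℕ → ℝ) (t : ℕ) :
    run init step (pre f (t + 1)) = step (run init step (pre f t)) (f (t + 1)) :=
  run_cons _ _ _ (pre_ne_nil f t)

theorem eq_pre_node {l : List ℝ} {N : ℕ} (h : l.length = N + 1) : l = pre (node l) N := by
  induction N generalizing l with
  | zero =>
    obtain ⟨x, rfl⟩ := List.length_eq_one_iff.1 h
    rfl
  | succ N ih =>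
    obtain ⟨x, l, rfl⟩ : ∃ x l', l = x :: l' := by
      cases l with
      | nil => simp at h
      | cons x l => exact ⟨x, l, rfl⟩
    have hl : l.length = N + 1 := by simpa using h
    have e : ∀ t ≤ N, pre (node (x :: l)) t = pre (node l) t := by
      intro t
      induction t with
      | zero => intro _; simp [pre, node_cons_of_lt (x := x) (show 0 < l.length by omega)]
      | succ t iht =>
        intro ht
        simp [pre, iht (by omega), node_cons_of_lt (x := x) (show t + 1 < l.length by omega)]
    rw [pre, e N le_rfl, ← ih hl, ← hl, node_cons_length]

theorem Ref.ne_nil {Y l : List ℝ} (h : Ref Y l) : Y ≠ [] ∧ l ≠ [] := by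
  cases h <;> simp

theorem Ref.exists_head {Y l : List ℝ} (h : Ref Y l) :
    ∃ x Y' l', Y = x :: Y' ∧ l = x :: l' := by
  cases h with
  | single x => exact ⟨x, _, _, rfl, rfl⟩
  | vertex x h => exact ⟨x, _, _, rfl, rfl⟩
  | slide p' h hp => exact ⟨_, _, _, rfl, rfl⟩
  | stay h => exact ⟨_, _, _, rfl, rfl⟩

/-- The state of the play operator: the last direction of movement (`1`, `-1`, or `0` before the
first movement), the current position, and the start and the turning points so far, the latest
first. -/
structure PlayState where
  dir : ℝ
  y : ℝ
  out : List ℝ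

/-- The initial state at the position `x`, with `d` as the direction of the last movement. -/
def playInit (d x : ℝ) : PlayState := ⟨d, x, [x]⟩

/-- The position `y` follows the input lazily: it moves only as far as it is needed to keep the
distance from the input at most `R`. -/
def playStep (R : ℝ) (S : PlayState) (x : ℝ) : PlayState :=
  if R < x - S.y then ⟨1, x - R, if S.dir = -1 then S.y :: S.out else S.out⟩
  else if R < S.y - x then ⟨-1, x + R, if S.dir = 1 then S.y :: S.out else S.out⟩
  else S

theorem playStep_up {R : ℝ} {S : PlayState} {x : ℝ} (h : R < x - S.y) :
    playStep R S x = ⟨1, x - R, if S.dir = -1 then S.y :: S.out else S.out⟩ := if_pos h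

theorem playStep_down {R : ℝ} (hR : 0 ≤ R) {S : PlayState} {x : ℝ} (h : R < S.y - x) :
    playStep R S x = ⟨-1, x + R, if S.dir = 1 then S.y :: S.out else S.out⟩ := by
  unfold playStep; rw [if_neg (by linarith), if_pos h]

theorem playStep_of_near {R : ℝ} {S : PlayState} {x : ℝ} (h : |x - S.y| ≤ R) :
    playStep R S x = S := by
  rw [abs_le] at h
  unfold playStep
  rw [if_neg (by linarith), if_neg (by linarith)]

theorem playStep_cases (R : ℝ) (S : PlayState) (x : ℝ) :
    R < x - S.y ∨ R < S.y - x ∨ |x - S.y| ≤ R := by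
  rcases lt_or_ge R (x - S.y) with h | h
  · exact .inl h
  rcases lt_or_ge R (S.y - x) with h' | h'
  · exact .inr (.inl h')
  · exact .inr (.inr (by rw [abs_le]; constructor <;> linarith))

theorem playStep_near {R : ℝ} (hR : 0 ≤ R) (S : PlayState) (x : ℝ) :
    |x - (playStep R S x).y| ≤ R := by
  rcases playStep_cases R S x with h | h | h
  · rw [playStep_up h]; simp [abs_of_nonneg hR]
  · rw [playStep_down hR h]; simp [abs_of_nonneg hR]
  · rwa [playStep_of_near h]

theorem playRun_near {R : ℝ} (hR : 0 ≤ R) (d x : ℝ) (l : List ℝ) :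
    |x - (run (playInit d) (playStep R) (x :: l)).y| ≤ R := by
  cases l with
  | nil => simp [run, playInit, hR]
  | cons y l => exact playStep_near hR _ _

/-- Reading an intermediate point first makes no difference. -/
theorem playStep_skip {R : ℝ} (hR : 0 ≤ R) {S : PlayState} {q p x : ℝ} (hq : |q - S.y| ≤ R)
    (hp : p ∈ uIcc q x) :
    playStep R (playStep R S p) x = playStep R S x ∧
      (playStep R S p = S ∨ (playStep R S p).dir = (playStep R S x).dir) := by
  rw [abs_le] at hq
  rw [mem_uIcc] at hp
  rcases lt_or_ge R (p - S.y) with h1 | h1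
  · have hx : p ≤ x := by rcases hp with h | h <;> linarith
    have e1 : playStep R S p = ⟨1, p - R, if S.dir = -1 then S.y :: S.out else S.out⟩ := by
      unfold playStep; rw [if_pos h1]
    have e2 : playStep R S x = ⟨1, x - R, if S.dir = -1 then S.y :: S.out else S.out⟩ := by
      unfold playStep; rw [if_pos (by linarith)]
    refine ⟨?_, .inr (by rw [e1, e2])⟩
    rw [e1, e2]
    unfold playStep
    rcases hx.eq_or_lt with rfl | hlt
    · simp only [sub_sub_cancel, lt_irrefl, if_false]
      rw [if_neg (by linarith)]
    · simp only
      rw [if_pos (by linarith), if_neg (by norm_num)]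
  · rcases lt_or_ge R (S.y - p) with h2 | h2
    · have hx : x ≤ p := by rcases hp with h | h <;> linarith
      have e1 : playStep R S p = ⟨-1, p + R, if S.dir = 1 then S.y :: S.out else S.out⟩ := by
        unfold playStep; rw [if_neg (by linarith), if_pos h2]
      have e2 : playStep R S x = ⟨-1, x + R, if S.dir = 1 then S.y :: S.out else S.out⟩ := by
        unfold playStep; rw [if_neg (by linarith), if_pos (by linarith)]
      refine ⟨?_, .inr (by rw [e1, e2])⟩
      rw [e1, e2]
      unfold playStep
      rcases hx.eq_or_lt with rfl | hlt
      · simp only [add_sub_cancel_left, lt_irrefl, if_false]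
        rw [if_neg (by linarith)]
      · simp only
        rw [if_neg (by linarith), if_pos (by linarith), if_neg (by norm_num)]
    · have : playStep R S p = S := playStep_of_near (by rw [abs_le]; constructor <;> linarith)
      rw [this]; exact ⟨rfl, .inl rfl⟩

/-- The play operator is rate-independent: its final state depends only on the polyline and not on
the points at which the polyline is sampled. -/
theorem Ref.playRun_eq {R : ℝ} (hR : 0 ≤ R) (d : ℝ) {Y l : List ℝ} (h : Ref Y l) :
    run (playInit d) (playStep R) Y = run (playInit d) (playStep R) l := by
  induction h with
  | single x => rfl
  | vertex x h ih => rw [run_cons _ _ _ h.ne_nil.1, run_cons _ _ _ h.ne_nil.2, ih]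
  | @slide Y w p q p' h hp ih =>
    rw [run_cons _ _ _ h.ne_nil.1, ih, run_cons _ _ p (by simp), run_cons _ _ p' (by simp)]
    exact (playStep_skip hR (playRun_near hR d q w) hp).1
  | @stay Y l x h ih =>
    rw [run_cons _ _ _ h.ne_nil.1, ih]
    exact playStep_of_near (playRun_near hR d x l)

/-- The vertices of the path of the play operator, the last one first. -/
def PlayState.final (S : PlayState) : List ℝ := if S.dir = 0 then S.out else S.y :: S.out

/-- The positions of the play operator form a refinement `Y` of its path. The slope of the last edge
has the sign `dir`, which is what allows the path to be continued in this direction. -/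
theorem exists_ref_playRun {R : ℝ} (hR : 0 ≤ R) {l : List ℝ} (hl : l ≠ []) :
    ∃ Y, List.Forall₂ (fun a b => |a - b| ≤ R) l Y ∧
      ((run (playInit 0) (playStep R) l).dir = 0 ∧
        Ref Y [(run (playInit 0) (playStep R) l).y] ∧
        (run (playInit 0) (playStep R) l).out = [(run (playInit 0) (playStep R) l).y] ∨
      ((run (playInit 0) (playStep R) l).dir = 1 ∨ (run (playInit 0) (playStep R) l).dir = -1) ∧
        Ref Y ((run (playInit 0) (playStep R) l).y :: (run (playInit 0) (playStep R) l).out) ∧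
        ∃ q w, (run (playInit 0) (playStep R) l).out = q :: w ∧
          0 ≤ (run (playInit 0) (playStep R) l).dir *
            ((run (playInit 0) (playStep R) l).y - q)) := by
  induction l with
  | nil => exact absurd rfl hl
  | cons x l ih =>
    rcases eq_or_ne l [] with rfl | hl'
    · refine ⟨[x], .cons (by simpa using hR) .nil, .inl ⟨rfl, .single _, rfl⟩⟩
    obtain ⟨Y, hY, h⟩ := ih hl'
    rw [run_cons _ _ _ hl']
    set S := run (playInit 0) (playStep R) l
    refine ⟨(playStep R S x).y :: Y, .cons (playStep_near hR S x) hY, ?_⟩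
    have n1 : (1 : ℝ) ≠ -1 := by norm_num
    have n2 : (0 : ℝ) ≠ -1 := by norm_num
    have n3 : (-1 : ℝ) ≠ 1 := by norm_num
    rcases playStep_cases R S x with h1 | h1 | h1
    · right
      rw [playStep_up h1]
      refine ⟨.inl rfl, ?_⟩
      rcases h with ⟨hd, hr, ho⟩ | ⟨hd | hd, hr, q, w, ho, hq⟩
      · rw [hd, if_neg n2, ho]
        exact ⟨.vertex _ hr, _, _, rfl, by simp only; linarith⟩
      · rw [hd, if_neg n1, ho]
        rw [ho] at hr
        rw [hd] at hq
        exact ⟨.slide _ hr (mem_uIcc.2 (.inl ⟨by linarith, by linarith⟩)), _, _, rfl,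
          by simp only; linarith⟩
      · rw [hd, if_pos rfl]
        exact ⟨.vertex _ hr, _, _, rfl, by simp only; linarith⟩
    · right
      rw [playStep_down hR h1]
      refine ⟨.inr rfl, ?_⟩
      rcases h with ⟨hd, hr, ho⟩ | ⟨hd | hd, hr, q, w, ho, hq⟩
      · rw [hd, if_neg zero_ne_one, ho]
        exact ⟨.vertex _ hr, _, _, rfl, by simp only; linarith⟩
      · rw [hd, if_pos rfl]
        exact ⟨.vertex _ hr, _, _, rfl, by simp only; linarith⟩
      · rw [hd, if_neg n3, ho]
        rw [ho] at hr
        rw [hd] at hq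
        exact ⟨.slide _ hr (mem_uIcc.2 (.inr ⟨by linarith, by linarith⟩)), _, _, rfl,
          by simp only; linarith⟩
    · rw [playStep_of_near h1]
      rcases h with ⟨hd, hr, ho⟩ | ⟨hd, hr, ho⟩
      · exact .inl ⟨hd, .stay hr, ho⟩
      · exact .inr ⟨hd, .stay hr, ho⟩

/-- The path of the play operator of radius `R` is `R`-close to its input. -/
theorem FD.play {R : ℝ} (hR : 0 ≤ R) {l : List ℝ} (hl : l ≠ []) :
    FD R (curve l) (curve (run (playInit 0) (playStep R) l).final) := by
  obtain ⟨Y, hY, ⟨hd, hr, ho⟩ | ⟨hd, hr, -⟩⟩ := exists_ref_playRun hR hl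
  · refine .of_ref (Ref.refl hl) ?_ hY
    rw [PlayState.final, if_pos hd, ho]; exact hr
  · refine .of_ref (Ref.refl hl) ?_ hY
    rw [PlayState.final, if_neg (by rcases hd with h | h <;> rw [h] <;> norm_num)]; exact hr

theorem length_out_le {R : ℝ} (hR : 0 ≤ R) (f : ℕ → ℝ) (t : ℕ) :
    (run (playInit 0) (playStep R) (pre f t)).dir = 0 ∧
        (run (playInit 0) (playStep R) (pre f t)).out.length = 1 ∨
      (run (playInit 0) (playStep R) (pre f t)).dir ≠ 0 ∧
        (run (playInit 0) (playStep R) (pre f t)).out.length ≤ t := by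
  induction t with
  | zero => left; exact ⟨rfl, rfl⟩
  | succ t ih =>
    rw [run_pre_succ]
    generalize run (playInit 0) (playStep R) (pre f t) = S at *
    have n1 : (0 : ℝ) ≠ -1 := by norm_num
    rcases playStep_cases R S (f (t + 1)) with h1 | h1 | h1
    · right
      rw [playStep_up h1]
      refine ⟨one_ne_zero, ?_⟩
      rcases ih with ⟨h, h'⟩ | ⟨h, h'⟩
      · rw [h, if_neg n1]; simp only; omega
      · split_ifs <;> simp <;> omega
    · right
      rw [playStep_down hR h1]
      refine ⟨neg_ne_zero.2 one_ne_zero, ?_⟩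
      rcases ih with ⟨h, h'⟩ | ⟨h, h'⟩
      · rw [h, if_neg zero_ne_one]; simp only; omega
      · split_ifs <;> simp <;> omega
    · rw [playStep_of_near h1]
      rcases ih with h | h
      · exact .inl h
      · exact .inr ⟨h.1, by omega⟩

/-- The path of the play operator has at most as many vertices as its input. -/
theorem length_final_le {R : ℝ} (hR : 0 ≤ R) (f : ℕ → ℝ) (t : ℕ) :
    (run (playInit 0) (playStep R) (pre f t)).final.length ≤ t + 1 := by
  unfold PlayState.final
  rcases length_out_le hR f t with ⟨h, h'⟩ | ⟨h, h'⟩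
  · rw [if_pos h]; omega
  · rw [if_neg h]; simp; omega

/-- In hindsight, the play operator could have been started with the direction of its first
movement. -/
theorem exists_initial_dir {R : ℝ} (hR : 0 ≤ R) (f : ℕ → ℝ) (t : ℕ) :
    ∃ d : ℝ, (d = 1 ∨ d = -1) ∧
      (run (playInit d) (playStep R) (pre f t)).y = (run (playInit 0) (playStep R) (pre f t)).y ∧
      (run (playInit d) (playStep R) (pre f t)).out =
        (run (playInit 0) (playStep R) (pre f t)).out ∧
      ((run (playInit 0) (playStep R) (pre f t)).dir = 0 ∧
        (run (playInit 0) (playStep R) (pre f t)).out =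
          [(run (playInit 0) (playStep R) (pre f t)).y] ∨
       (run (playInit 0) (playStep R) (pre f t)).dir =
        (run (playInit d) (playStep R) (pre f t)).dir ∧
          (run (playInit 0) (playStep R) (pre f t)).dir ≠ 0) := by
  have key : (∀ d, run (playInit d) (playStep R) (pre f t) =
        ⟨d, (run (playInit 0) (playStep R) (pre f t)).y,
          (run (playInit 0) (playStep R) (pre f t)).out⟩ ∧
        (run (playInit 0) (playStep R) (pre f t)).out =
          [(run (playInit 0) (playStep R) (pre f t)).y]) ∨
      ∃ d : ℝ, (d = 1 ∨ d = -1) ∧ run (playInit d) (playStep R) (pre f t) =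
        run (playInit 0) (playStep R) (pre f t) ∧
          (run (playInit 0) (playStep R) (pre f t)).dir ≠ 0 := by
    induction t with
    | zero => left; intro d; exact ⟨rfl, rfl⟩
    | succ t ih =>
      simp only [run_pre_succ]
      have n1 : (0 : ℝ) ≠ -1 := by norm_num
      have n2 : (1 : ℝ) ≠ -1 := by norm_num
      rcases ih with h | ⟨d, hd, h, h0⟩
      · have hO := (h 0).2
        have hS := (h 0).1
        have hd : ∀ d, run (playInit d) (playStep R) (pre f t) = _ := fun d => (h d).1
        generalize run (playInit 0) (playStep R) (pre f t) = S at *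
        have hS0 : S.dir = 0 := by rw [hS]
        rcases playStep_cases R S (f (t + 1)) with h1 | h1 | h1
        · right
          refine ⟨1, .inl rfl, ?_, by rw [playStep_up h1]; exact one_ne_zero⟩
          rw [hd 1, playStep_up h1, playStep_up (by exact h1), hS0, if_neg n1, if_neg n2]
        · right
          refine ⟨-1, .inr rfl, ?_, by rw [playStep_down hR h1]; exact neg_ne_zero.2 one_ne_zero⟩
          rw [hd (-1), playStep_down hR h1, playStep_down hR (by exact h1), hS0,
            if_neg zero_ne_one, if_neg n2.symm]
        · left
          intro d
          rw [hd d, playStep_of_near h1, playStep_of_near (by exact h1)]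
          exact ⟨rfl, hO⟩
      · right
        refine ⟨d, hd, by rw [h], ?_⟩
        generalize run (playInit 0) (playStep R) (pre f t) = S at *
        rcases playStep_cases R S (f (t + 1)) with h1 | h1 | h1
        · rw [playStep_up h1]; exact one_ne_zero
        · rw [playStep_down hR h1]; exact neg_ne_zero.2 one_ne_zero
        · rwa [playStep_of_near h1]
  rcases key with h | ⟨d, hd, h, h0⟩
  · refine ⟨1, .inl rfl, by rw [(h 1).1], by rw [(h 1).1], .inl ⟨by rw [(h 0).1], (h 0).2⟩⟩
  · exact ⟨d, hd, by rw [h], by rw [h], .inr ⟨by rw [h], h0⟩⟩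

/-! ### Turning points of the lazy path -/

/-- Until time `N`, the path `S` is lazy compared to the curve `z`: whenever it moves in a
direction, `z` is not behind it in this direction. -/
def Lazy (S : ℕ → PlayState) (z : ℕ → ℝ) (N : ℕ) : Prop :=
  ∀ t < N, S (t + 1) = S t ∨ ∃ s : ℝ, (s = 1 ∨ s = -1) ∧ 0 < s * ((S (t + 1)).y - (S t).y) ∧
    (S (t + 1)).dir = s ∧ s * (S (t + 1)).y ≤ s * z (t + 1) ∧
    (S (t + 1)).out = if (S t).dir = -s then (S t).y :: (S t).out else (S t).out

/-- The state of the play operator after reading `f 0, …, f t`. -/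
def playSeq (R d : ℝ) (f : ℕ → ℝ) (t : ℕ) : PlayState := run (playInit d) (playStep R) (pre f t)

theorem playSeq_succ (R d : ℝ) (f : ℕ → ℝ) (t : ℕ) :
    playSeq R d f (t + 1) = playStep R (playSeq R d f t) (f (t + 1)) := run_pre_succ _ _ _ _

theorem playSeq_near {R : ℝ} (hR : 0 ≤ R) (d : ℝ) (f : ℕ → ℝ) (t : ℕ) :
    |f t - (playSeq R d f t).y| ≤ R := by
  cases t with
  | zero => simp [playSeq, pre, run, playInit, hR]
  | succ t => rw [playSeq_succ]; exact playStep_near hR _ _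

/-- The play operator is lazy compared to every curve within distance `R` of its input. -/
theorem lazy_playSeq {R : ℝ} (hR : 0 ≤ R) (d : ℝ) {f z : ℕ → ℝ} {N : ℕ}
    (h : ∀ t ≤ N, |f t - z t| ≤ R) : Lazy (playSeq R d f) z N := by
  intro t ht
  have hz := abs_le.1 (h (t + 1) ht)
  rw [playSeq_succ]
  generalize playSeq R d f t = S
  rcases playStep_cases R S (f (t + 1)) with h1 | h1 | h1
  · right
    refine ⟨1, .inl rfl, ?_⟩
    rw [playStep_up h1]
    exact ⟨by simp only; linarith, rfl, by simp only; linarith, rfl⟩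
  · right
    refine ⟨-1, .inr rfl, ?_⟩
    rw [playStep_down hR h1]
    exact ⟨by simp only; linarith, rfl, by simp only; linarith, by simp⟩
  · left; exact playStep_of_near h1

theorem chain_le {z : ℕ → ℝ} {q : ℝ} {a g : ℕ} (h : ∀ t, a ≤ t → t < g → q * z t ≤ q * z (t + 1))
    {t u : ℕ} (hat : a ≤ t) (htu : t ≤ u) (hug : u ≤ g) : q * z t ≤ q * z u := by
  induction u, htu using Nat.le_induction with
  | base => exact le_rfl
  | succ u hu ih => exact (ih (by omega)).trans (h u (by omega) (by omega))

theorem sign_eq_or_neg {q s : ℝ} (hq : q = 1 ∨ q = -1) (hs : s = 1 ∨ s = -1) :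
    q = s ∨ q = -s := by
  rcases hq with rfl | rfl <;> rcases hs with rfl | rfl <;> norm_num

theorem sign_cancel {q a b : ℝ} (hq : q = 1 ∨ q = -1) (h1 : q * a ≤ q * b) (h2 : q * b ≤ q * a) :
    a = b := by
  rcases hq with rfl | rfl <;> linarith

theorem sign_abs_le {q a b : ℝ} (hq : q = 1 ∨ q = -1) : |a| ≤ b ↔ -b ≤ q * a ∧ q * a ≤ b := by
  rw [abs_le]
  rcases hq with rfl | rfl
  · simp
  · constructor <;> rintro ⟨h1, h2⟩ <;> constructor <;> linarith

/-- While `z` moves in the direction in which the lazy path moved last, the path is at rest until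
it turns back. -/
theorem Lazy.eq_of_turn {S : ℕ → PlayState} {z : ℕ → ℝ} {N : ℕ} (hL : Lazy S z N) {q : ℝ}
    {a c : ℕ} (hc : c < N)
    (hz : ∀ t, a ≤ t → t < c + 1 → q * z t ≤ q * z (t + 1)) (hd : (S c).dir = q)
    (h1 : q * (S (c + 1)).y < q * (S c).y) (h2 : q * z (c + 1) ≤ q * (S (c + 1)).y) :
    ∀ n t, t + n = c → a ≤ t → S t = S c := by
  intro n
  induction n with
  | zero => intro t ht _; rw [← ht]; rfl
  | succ n ih =>
    intro t ht hat
    have e := ih (t + 1) (by omega) (by omega)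
    rcases hL t (by omega) with h | ⟨s, hs, m1, m2, m3, -⟩
    · rw [← h, e]
    · rw [e, hd] at m2
      subst m2
      rw [e] at m1 m3
      have := chain_le hz (t := t + 1) (u := c + 1) (by omega) (by omega) le_rfl
      linarith

/-- While `z` moves against the direction of the lazy path, the path is at its next turning point
or `z` is beyond this point. -/
theorem Lazy.before_turn {S : ℕ → PlayState} {z : ℕ → ℝ} {N : ℕ} (hL : Lazy S z N) {q : ℝ}
    (hq : q = 1 ∨ q = -1) {a c : ℕ} (hc : c < N)
    (hz : ∀ t, a ≤ t → t < c + 1 → q * z (t + 1) ≤ q * z t) (hd : (S c).dir = q) :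
    ∀ n t, t + n = c → a ≤ t → q * (S t).y ≤ q * (S c).y ∧ ((S t).y = (S c).y → (S t).dir = q) ∧
      ((S t).y ≠ (S c).y → q * (S c).y ≤ q * z t) := by
  intro n
  induction n with
  | zero =>
    intro t ht _
    obtain rfl : t = c := by omega
    exact ⟨le_rfl, fun _ => hd, fun h => absurd rfl h⟩
  | succ n ih =>
    intro t ht hat
    obtain ⟨i1, i2, i3⟩ := ih (t + 1) (by omega) (by omega)
    have hzt := hz t hat (by omega)
    rcases hL t (by omega) with h | ⟨s, hs, m1, m2, m3, -⟩
    · rw [h] at i1 i2 i3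
      exact ⟨i1, i2, fun h' => (i3 h').trans hzt⟩
    · have hsq : s = q ∨ s = -q := by
        rcases hs with rfl | rfl <;> rcases hq with rfl | rfl <;> norm_num
      rcases hsq with rfl | rfl
      · have hlt : s * (S t).y < s * (S c).y := by linarith
        refine ⟨hlt.le, fun h' => absurd h' (fun h'' => by rw [h''] at hlt; exact lt_irrefl _ hlt),
          fun _ => ?_⟩
        by_cases hv : (S (t + 1)).y = (S c).y
        · rw [← hv]; exact m3.trans hzt
        · exact (i3 hv).trans hzt
      · exfalso
        by_cases hv : (S (t + 1)).y = (S c).y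
        · have := i2 hv
          rw [m2] at this
          rcases hq with rfl | rfl <;> norm_num at this
        · have h3 := i3 hv
          exact hv (sign_cancel hq i1 (by linarith))

/-- On an interval on which `z` is monotone, a lazy path that stays within distance `E` of `z` has
at most two turning points, and these have distance at most `E` from `z` at the start of the
interval. -/
theorem Lazy.cases_of_monotone {S : ℕ → PlayState} {z : ℕ → ℝ} {N : ℕ} (hL : Lazy S z N) {E : ℝ}
    (hE : ∀ t ≤ N, |z t - (S t).y| ≤ E) {p : ℝ} (hp : p = 1 ∨ p = -1) {a g : ℕ} (hag : a ≤ g)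
    (hg : g ≤ N) (hz : ∀ t, a ≤ t → t < g → p * z t ≤ p * z (t + 1))
    (ha : (S a).dir = 1 ∨ (S a).dir = -1) :
    ((S g).out = (S a).out ∧ (S g).dir = (S a).dir ∧ 0 ≤ (S a).dir * ((S g).y - (S a).y)) ∨
    (∃ v i, i ≤ N ∧ v = (S i).y ∧ (S g).out = v :: (S a).out ∧ (S g).dir = -(S a).dir ∧
      0 ≤ (S a).dir * (v - (S a).y) ∧ 0 ≤ (S g).dir * ((S g).y - v) ∧ |z a - v| ≤ E) ∨
    (∃ v i w j, i ≤ N ∧ v = (S i).y ∧ j ≤ N ∧ w = (S j).y ∧ (S g).out = w :: v :: (S a).out ∧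
      (S g).dir = (S a).dir ∧ (S g).dir = p ∧ 0 ≤ (S a).dir * (v - (S a).y) ∧
      0 ≤ -(S a).dir * (w - v) ∧ 0 ≤ (S g).dir * ((S g).y - w) ∧ |z a - v| ≤ E ∧
      |z a - w| ≤ E) := by
  induction g, hag using Nat.le_induction with
  | base => left; simp
  | succ g hg' ih =>
    have ih := ih (by omega) fun t h1 h2 => hz t h1 (by omega)
    have hdg : (S g).dir = 1 ∨ (S g).dir = -1 := by
      rcases ih with ⟨-, h, -⟩ | ⟨v, i, -, -, -, h, -⟩ | ⟨v, i, w, j, -, -, -, -, -, h, -⟩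
      · rwa [h]
      · rw [h]; rcases ha with h | h <;> rw [h] <;> norm_num
      · rwa [h]
    rcases hL g (by omega) with h | ⟨s, hs, m1, m2, m3, m4⟩
    · rwa [h]
    by_cases hsd : (S g).dir = s
    · -- no turn
      have hns : (S g).dir ≠ -s := by
        rw [hsd]; rcases hs with rfl | rfl <;> norm_num
      rw [if_neg hns] at m4
      have m2' : (S (g + 1)).dir = (S g).dir := by rw [m2, hsd]
      have m1' : 0 < (S g).dir * ((S (g + 1)).y - (S g).y) := by rwa [hsd]
      rw [m4, m2']
      rcases ih with ⟨h1, h2, h3⟩ | ⟨v, i, hi, hv, h1, h2, h3, h4, h5⟩ |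
        ⟨v, i, w, j, hi, hv, hj, hw, h1, h2, h3, h4, h5, h6, h7⟩
      · left
        rw [h2] at m1'
        exact ⟨h1, h2, by linarith⟩
      · exact .inr (.inl ⟨v, i, hi, hv, h1, h2, h3, by linarith, h5⟩)
      · exact .inr (.inr ⟨v, i, w, j, hi, hv, hj, hw, h1, h2, h3, h4, h5, by linarith, h7⟩)
    · -- the path turns at `g`
      have hsq : s = -(S g).dir := by
        rcases hs with rfl | rfl <;> rcases hdg with h | h <;> rw [h] at hsd ⊢ <;>
          first | exact absurd rfl hsd | norm_num
      rw [hsq, neg_neg, if_pos rfl] at m4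
      rw [hsq] at m1 m2 m3
      set q := (S g).dir with hqd
      have m1' : 0 < -q * ((S (g + 1)).y - (S g).y) := m1
      rw [m4, m2]
      rcases sign_eq_or_neg hdg hp with hqp | hqp
      · have hst := hL.eq_of_turn (a := a) (c := g) (by omega)
          (fun t h1 h2 => by rw [hqp]; exact hz t h1 h2) hqd.symm (by linarith) (by linarith)
          (g - a) a (by omega) le_rfl
        have hE' := hE a (by omega)
        rcases ih with ⟨h1, h2, h3⟩ | ⟨v, i, hi, hv, h1, -⟩ |
          ⟨v, i, w, j, hi, hv, hj, hw, h1, -⟩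
        · refine .inr (.inl ⟨(S g).y, g, by omega, rfl, by rw [h1], by rw [h2], h3, m1'.le, ?_⟩)
          rwa [hst] at hE'
        · rw [hst] at h1
          have := congrArg List.length h1
          simp at this
        · rw [hst] at h1
          have := congrArg List.length h1
          simp at this; omega
      · have hbt := hL.before_turn hdg (a := a) (c := g) (by omega)
          (fun t h1 h2 => by
            have := hz t h1 h2
            rcases hp with rfl | rfl <;> rw [hqp] <;> linarith) hqd.symm (g - a) a (by omega) le_rfl
        have hbd : |z a - (S g).y| ≤ E := by
          have hE' := hE a (by omega)
          by_cases hv : (S a).y = (S g).y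
          · rwa [hv] at hE'
          · have h3 := hbt.2.2 hv
            rw [sign_abs_le hdg] at hE' ⊢
            have := hbt.1
            constructor <;> linarith [hE'.1, hE'.2, abs_nonneg (z a - (S a).y), hE a (by omega)]
        rcases ih with ⟨h1, h2, h3⟩ | ⟨v, i, hi, hv, h1, h2, h3, h4, h5⟩ |
          ⟨v, i, w, j, hi, hv, hj, hw, h1, h2, h3, -⟩
        · exact .inr (.inl ⟨(S g).y, g, by omega, rfl, by rw [h1], by rw [h2], h3, m1'.le, hbd⟩)
        · refine .inr (.inr ⟨v, i, (S g).y, g, hi, hv, by omega, rfl, by rw [h1], by rw [h2]; ring,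
            by rw [hqp]; ring, h3, ?_, m1'.le, h5, hbd⟩)
          rw [← h2]; exact h4
        · exfalso
          rw [h3] at hqp
          rcases hp with rfl | rfl <;> norm_num at hqp

theorem playSeq_dir {R : ℝ} (hR : 0 ≤ R) {d : ℝ} (hd : d = 1 ∨ d = -1) (f : ℕ → ℝ) (t : ℕ) :
    (playSeq R d f t).dir = 1 ∨ (playSeq R d f t).dir = -1 := by
  induction t with
  | zero => exact hd
  | succ t ih =>
    rw [playSeq_succ]
    rcases playStep_cases R (playSeq R d f t) (f (t + 1)) with h | h | h
    · rw [playStep_up h]; exact .inl rfl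
    · rw [playStep_down hR h]; exact .inr rfl
    · rwa [playStep_of_near h]

/-- A curve that changes its direction less than `k` times forces less than `2k` turning points on
the lazy paths near it. -/
theorem length_out_le_of_close {ρ : ℝ} (hρ : 0 ≤ ρ) {X T : ℕ → ℝ} {N : ℕ}
    (h : ∀ t ≤ N, |X t - T t| ≤ ρ) :
    (playSeq ρ 0 X N).out.length ≤ 2 * (playSeq 0 0 T N).out.length + 1 := by
  obtain ⟨d, hd, -, hout, -⟩ := exists_initial_dir le_rfl T N
  obtain ⟨e, he, -, hout', -⟩ := exists_initial_dir hρ X N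
  change (playSeq 0 d T N).out = (playSeq 0 0 T N).out at hout
  change (playSeq ρ e X N).out = (playSeq ρ 0 X N).out at hout'
  rw [← hout, ← hout']
  set S := playSeq ρ e X with hS
  set U := playSeq 0 d T with hU
  have hL : Lazy S T N := lazy_playSeq hρ e h
  have hE : ∀ t ≤ N, |T t - (S t).y| ≤ 2 * ρ := fun t ht => by
    have h1 := abs_le.1 (h t ht)
    have h2 := abs_le.1 (playSeq_near hρ e X t)
    rw [abs_le]; constructor <;> linarith
  have hUT : ∀ t, (U t).y = T t := fun t => by
    have := playSeq_near le_rfl d T t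
    rw [← hU] at this
    have := abs_nonpos_iff.1 this
    linarith
  have hcount : ∀ a g, a ≤ g → g ≤ N → (∃ p : ℝ, (p = 1 ∨ p = -1) ∧
      ∀ t, a ≤ t → t < g → p * T t ≤ p * T (t + 1)) →
      (S g).out.length ≤ (S a).out.length + 2 := by
    rintro a g hag hg ⟨p, hp, hmono⟩
    rcases hL.cases_of_monotone hE hp hag hg hmono (playSeq_dir hρ he X a) with
      ⟨h1, -⟩ | ⟨v, i, -, -, h1, -⟩ | ⟨v, i, w, j, -, -, -, -, h1, -⟩ <;> rw [h1] <;> simp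
  have key : ∀ t ≤ N, ∃ a ≤ t, (∀ i, a ≤ i → i < t → (U t).dir * T i ≤ (U t).dir * T (i + 1)) ∧
      (S a).out.length + 1 ≤ 2 * (U t).out.length := by
    intro t
    induction t with
    | zero => intro _; exact ⟨0, le_rfl, fun i h1 h2 => by omega, by simp [hS, hU, playSeq, pre, run, playInit]⟩
    | succ t ih =>
      intro ht
      obtain ⟨a, ha, hm, hl⟩ := ih (by omega)
      have hUL : Lazy U T N := lazy_playSeq le_rfl d (by simp)
      rcases hUL t (by omega) with h | ⟨s, hs, m1, m2, m3, m4⟩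
      · refine ⟨a, by omega, fun i h1 h2 => ?_, by rwa [h]⟩
        rcases Nat.lt_or_ge i t with h3 | h3
        · rw [h]; exact hm i h1 h3
        · obtain rfl : i = t := by omega
          have := hUT (i + 1)
          rw [h, hUT i] at this
          rw [this]
      · rw [hUT, hUT] at m1
        by_cases hsd : (U t).dir = -s
        · refine ⟨t, by omega, fun i h1 h2 => ?_, ?_⟩
          · obtain rfl : i = t := by omega
            rw [m2]; linarith
          · rw [m4, if_pos hsd, List.length_cons]
            have := hcount a t ha (by omega) ⟨_, playSeq_dir le_rfl hd T t, hm⟩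
            omega
        · have hsd' : (U t).dir = s :=
            (sign_eq_or_neg (playSeq_dir le_rfl hd T t) hs).resolve_right hsd
          refine ⟨a, by omega, fun i h1 h2 => ?_, by rw [m4, if_neg hsd]; exact hl⟩
          rcases Nat.lt_or_ge i t with h3 | h3
          · rw [m2, ← hsd']; exact hm i h1 h3
          · obtain rfl : i = t := by omega
            rw [m2]; linarith
  obtain ⟨a, ha, hm, hl⟩ := key N le_rfl
  have := hcount a N ha le_rfl ⟨_, playSeq_dir le_rfl hd T N, hm⟩
  omega

/-! ### The guided algorithm on an input curve -/

/-- The parameters of the data structure: the mesh `μ` of the grid, the radius `ρ` of the play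
operator on the input curves, the distance `D` at which grid curves follow input curves, the range
`-H ≤ z < U - H` of the grid points `z * μ`, and the number `W` of grid points around a given
point among which a vertex is chosen, the first of them being `h` steps to the left. -/
structure Grid where
  μ : ℝ
  ρ : ℝ
  D : ℝ
  H : ℤ
  U : ℤ
  h : ℤ
  W : ℕ

/-- The state of the guided algorithm. It builds a curve with vertices on the grid next to the
input curve: `w` are the vertices so far, the last one first, with position `lv` for the last one,
and the curve has been followed from there in the direction `d` to the position `y`. The code `c`
holds the choices that are still to be made, `pl` is the play operator on the input curve, which
says when vertices may be added, and `ok` says that no error has occurred. -/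
structure GuidedState where
  pl : PlayState
  d : ℝ
  y : ℝ
  lv : ℝ
  c : ℕ
  w : List ℤ
  ok : Prop

namespace Grid

variable (G : Grid)

/-- The position of a grid point. -/
def val (z : ℤ) : ℝ := z * G.μ

/-- The grid point to the left of a position. -/
def rd (v : ℝ) : ℤ := ⌊v / G.μ⌋

/-- The grid point `z` can be used as the digit `z + H` of a word in base `U`. -/
def InRange (z : ℤ) : Prop := 0 ≤ z + G.H ∧ z + G.H < G.U

/-- The grid point near `p` chosen by the last digit of `c`. -/
def digit (p : ℝ) (c : ℕ) : ℤ := ⌊p / G.μ⌋ + (c % G.W : ℕ) - G.h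

/-- Go on to a vertex near `p`, and turn there. -/
def take (p : ℝ) (A : GuidedState) : GuidedState :=
  ⟨A.pl, -A.d, G.val (G.digit p (A.c / 2)), G.val (G.digit p (A.c / 2)), A.c / 2 / G.W,
    G.digit p (A.c / 2) :: A.w,
    A.ok ∧ 0 ≤ A.d * (G.val (G.digit p (A.c / 2)) - A.y) ∧ G.InRange (G.digit p (A.c / 2))⟩

/-- The next bit of the code decides whether a vertex near `p` is added. -/
def offer (p : ℝ) (A : GuidedState) : GuidedState :=
  if A.c % 2 = 1 then G.take p A else { A with c := A.c / 2 }

/-- Move only as far as it is needed to keep distance at most `D` from the input curve. -/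
def followPos (x : ℝ) (A : GuidedState) : ℝ :=
  if G.D < A.d * (x - A.y) then x - A.d * G.D else A.y

/-- Follow the input curve to `x`. It is an error if this requires moving against the direction
`d`. -/
def follow (x : ℝ) (A : GuidedState) : GuidedState :=
  { A with y := G.followPos x A, ok := A.ok ∧ A.d * (G.followPos x A - x) ≤ G.D }

/-- When the play operator starts or turns, up to two vertices may be added, near the point of the
input curve at which this happens. -/
def move (x : ℝ) (A : GuidedState) : GuidedState :=
  if (playStep G.ρ A.pl x).dir = A.pl.dir then { A with pl := playStep G.ρ A.pl x }
  else { G.offer (A.pl.y + (playStep G.ρ A.pl x).dir * G.ρ)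
    (G.offer (A.pl.y + (playStep G.ρ A.pl x).dir * G.ρ) A) with pl := playStep G.ρ A.pl x }

/-- The state after the next vertex `x` of the input curve. -/
def step (A : GuidedState) (x : ℝ) : GuidedState := G.follow x (G.move x A)

/-- The state at the first vertex `x`, before further vertices are added. -/
def start (c : ℕ) (x : ℝ) : GuidedState :=
  ⟨playInit 0 x, if c / G.W % 2 = 1 then 1 else -1, G.val (G.digit x c), G.val (G.digit x c),
    c / G.W / 2, [G.digit x c], G.InRange (G.digit x c)⟩

/-- The state after the first vertex `x` of the input curve. -/
def init (c : ℕ) (x : ℝ) : GuidedState := G.offer x (G.offer x (G.start c x))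

/-- The state after the guided algorithm has read the vertices of a reversed list. -/
def result (c : ℕ) (l : List ℝ) : GuidedState := run (G.init c) G.step l

/-- The relations between the parameters. -/
structure Valid : Prop where
  μ_pos : 0 < G.μ
  ρ_nonneg : 0 ≤ G.ρ
  W_eq : (G.W : ℤ) = 2 * G.h + 1
  h_nonneg : 0 ≤ G.h
  reach : 3 * G.ρ + G.μ ≤ G.h * G.μ
  le_D : (G.h + 1) * G.μ ≤ G.D

variable {G}

theorem offer_of_odd {p : ℝ} {A : GuidedState} (h : A.c % 2 = 1) : G.offer p A = G.take p A :=
  if_pos h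

theorem offer_of_even {p : ℝ} {A : GuidedState} (h : A.c % 2 ≠ 1) :
    G.offer p A = { A with c := A.c / 2 } := if_neg h

theorem offer_pl (p : ℝ) (A : GuidedState) : (G.offer p A).pl = A.pl := by
  unfold offer; split_ifs <;> rfl

theorem step_pl (A : GuidedState) (x : ℝ) : (G.step A x).pl = playStep G.ρ A.pl x := by
  unfold step follow move; split_ifs <;> rfl

theorem result_cons (c : ℕ) (x : ℝ) {l : List ℝ} (hl : l ≠ []) :
    G.result c (x :: l) = G.step (G.result c l) x := run_cons _ _ _ hl

theorem result_pl (c : ℕ) {l : List ℝ} (hl : l ≠ []) :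
    (G.result c l).pl = run (playInit 0) (playStep G.ρ) l := by
  induction l with
  | nil => exact absurd rfl hl
  | cons x l ih =>
    rcases eq_or_ne l [] with rfl | hl'
    · simp [result, run, init, offer_pl, start]
    · rw [result_cons _ _ hl', step_pl, ih hl', run_cons _ _ _ hl']

theorem Valid.D_nonneg (hG : G.Valid) : 0 ≤ G.D := by
  have h1 : (0 : ℝ) ≤ G.h := by exact_mod_cast hG.h_nonneg
  have := hG.le_D
  have := hG.μ_pos
  nlinarith

theorem rd_mul_le (hμ : 0 < G.μ) (v : ℝ) : G.rd v * G.μ ≤ v := by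
  rw [← le_div_iff₀ hμ]; exact Int.floor_le _

theorem lt_rd_mul (hμ : 0 < G.μ) (v : ℝ) : v < G.rd v * G.μ + G.μ := by
  have := (div_lt_iff₀ hμ).1 (Int.lt_floor_add_one (v / G.μ))
  unfold rd; linarith

theorem abs_val_rd_sub_le (hμ : 0 < G.μ) (v : ℝ) : |G.val (G.rd v) - v| ≤ G.μ := by
  have h1 := rd_mul_le hμ v
  have h2 := lt_rd_mul hμ v
  rw [abs_le, val]
  constructor <;> linarith

theorem abs_val_digit_sub_le (hG : G.Valid) (p : ℝ) (c : ℕ) :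
    |G.val (G.digit p c) - p| ≤ G.D := by
  have hμ := hG.μ_pos
  have h1 := rd_mul_le hμ p
  have h2 := lt_rd_mul hμ p
  have h3 := hG.le_D
  have hW : 0 < G.W := by have := hG.W_eq; have := hG.h_nonneg; omega
  have h4 : ((c % G.W : ℕ) : ℤ) ≤ 2 * G.h := by
    have := Nat.mod_lt c hW; have := hG.W_eq; omega
  have h5 : ((c % G.W : ℕ) : ℝ) ≤ 2 * G.h := by
    rw [← Int.cast_natCast (R := ℝ)]
    have := Int.cast_le (R := ℝ).2 h4
    rwa [Int.cast_mul, Int.cast_ofNat] at this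
  have h6 : (0 : ℝ) ≤ ((c % G.W : ℕ) : ℝ) := Nat.cast_nonneg _
  have h7 : G.val (G.digit p c) = G.rd p * G.μ + (c % G.W : ℕ) * G.μ - G.h * G.μ := by
    rw [val, digit, rd, Int.cast_sub, Int.cast_add, Int.cast_natCast]; ring
  rw [abs_le, h7]
  constructor <;> nlinarith

/-! ### Soundness of the guided algorithm -/

/-- The curve built so far is `D`-close to the input curve with the vertices `l`. -/
def Sound (G : Grid) (A : GuidedState) (l : List ℝ) : Prop :=
  A.ok → ∃ X Y t, Ref X l ∧ Ref Y (A.y :: A.lv :: t) ∧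
    List.Forall₂ (fun a b => |a - b| ≤ G.D) X Y ∧ A.w.map G.val = A.lv :: t ∧
    (∀ z ∈ A.w, G.InRange z) ∧ (A.d = 1 ∨ A.d = -1) ∧ 0 ≤ A.d * (A.y - A.lv)

theorem mem_uIcc_of_sign {d a y v : ℝ} (hd : d = 1 ∨ d = -1) (h1 : 0 ≤ d * (y - a))
    (h2 : 0 ≤ d * (v - y)) : y ∈ uIcc a v := by
  rw [mem_uIcc]
  rcases hd with rfl | rfl
  · left; constructor <;> linarith
  · right; constructor <;> linarith

theorem neg_sign {d : ℝ} (hd : d = 1 ∨ d = -1) : -d = 1 ∨ -d = -1 := by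
  rcases hd with rfl | rfl <;> norm_num

theorem Sound.take (hG : G.Valid) {A : GuidedState} {l l' : List ℝ} {p : ℝ} (h : G.Sound A l)
    (hl : ∀ X, Ref X l → Ref (p :: X) (p :: l')) : G.Sound (G.take p A) (p :: l') := by
  rintro ⟨hok, hm, hr⟩
  obtain ⟨X, Y, t, hX, hY, hXY, hw, hwr, hd, hy⟩ := h hok
  have hv := abs_val_digit_sub_le hG p (A.c / 2)
  rw [abs_sub_comm] at hv
  refine ⟨p :: p :: X, G.val (G.digit p (A.c / 2)) :: G.val (G.digit p (A.c / 2)) :: Y, A.lv :: t,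
    .stay (hl X hX), .vertex _ (.slide _ hY (mem_uIcc_of_sign hd hy hm)),
    .cons hv (.cons hv hXY), by simp [Grid.take, hw], ?_, neg_sign hd, by simp [Grid.take]⟩
  intro z hz
  rcases List.mem_cons.1 hz with rfl | hz
  · exact hr
  · exact hwr z hz

theorem Sound.offer_stay (hG : G.Valid) {A : GuidedState} {l : List ℝ} {p : ℝ}
    (h : G.Sound A (p :: l)) : G.Sound (G.offer p A) (p :: l) := by
  by_cases hc : A.c % 2 = 1
  · rw [offer_of_odd hc]; exact h.take hG fun X hX => .stay hX
  · rw [offer_of_even hc]; exact h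

/-- Vertices that are added at a point `p` in the interior of an edge subdivide this edge. -/
theorem Sound.offer_mid (hG : G.Valid) {A : GuidedState} {l : List ℝ} {p q : ℝ}
    (h : G.Sound A (q :: l) ∨ G.Sound A (p :: q :: l)) :
    G.Sound (G.offer p A) (q :: l) ∨ G.Sound (G.offer p A) (p :: q :: l) := by
  by_cases hc : A.c % 2 = 1
  · rw [offer_of_odd hc]
    rcases h with h | h
    · exact .inr (h.take hG fun X hX => .vertex p hX)
    · exact .inr (h.take hG fun X hX => .stay hX)
  · rw [offer_of_even hc]; exact h

theorem Sound.follow (hG : G.Valid) {A : GuidedState} {l l' : List ℝ} {x : ℝ} (h : G.Sound A l)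
    (hl : ∀ X, Ref X l → Ref (x :: X) l') : G.Sound (G.follow x A) l' := by
  rintro ⟨hok, hm⟩
  obtain ⟨X, Y, t, hX, hY, hXY, hw, hwr, hd, hy⟩ := h hok
  have hD := hG.D_nonneg
  have h1 : 0 ≤ A.d * (G.followPos x A - A.y) ∧ A.d * (x - G.followPos x A) ≤ G.D := by
    unfold followPos
    split_ifs with h1
    · rcases hd with hd | hd <;> rw [hd] at h1 ⊢ <;> constructor <;> linarith
    · exact ⟨by simp, not_lt.1 h1⟩
  refine ⟨x :: X, G.followPos x A :: Y, t, hl X hX, .slide _ hY (mem_uIcc_of_sign hd hy h1.1),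
    .cons ?_ hXY, hw, hwr, hd, ?_⟩
  · rw [sign_abs_le hd]; constructor <;> linarith
  · change 0 ≤ A.d * (G.followPos x A - A.lv); linarith

theorem Sound.step (hG : G.Valid) {A : GuidedState} {l : List ℝ} {q x : ℝ}
    (hq : |q - A.pl.y| ≤ G.ρ) (h : G.Sound A (q :: l)) : G.Sound (G.step A x) (x :: q :: l) := by
  unfold Grid.step move
  split_ifs with hs
  · exact Sound.follow hG (A := { A with pl := _ }) h fun X hX => .vertex x hX
  set p := A.pl.y + (playStep G.ρ A.pl x).dir * G.ρ with hp
  have hpx : p ∈ uIcc q x := by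
    rw [abs_le] at hq
    rw [mem_uIcc]
    rcases playStep_cases G.ρ A.pl x with h1 | h1 | h1
    · rw [playStep_up h1] at hp
      simp only [one_mul] at hp
      left; constructor <;> linarith
    · rw [playStep_down hG.ρ_nonneg h1] at hp
      right; constructor <;> linarith
    · rw [playStep_of_near h1] at hs; exact absurd rfl hs
  rcases Sound.offer_mid hG (p := p) (Sound.offer_mid hG (p := p) (.inl h)) with h' | h'
  · exact Sound.follow hG (A := { G.offer p (G.offer p A) with pl := _ }) h'
      fun X hX => .vertex x hX
  · exact Sound.follow hG (A := { G.offer p (G.offer p A) with pl := _ }) h'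
      fun X hX => .slide x hX hpx

theorem Sound.result (hG : G.Valid) (c : ℕ) {l : List ℝ} (hl : l ≠ []) :
    G.Sound (G.result c l) l := by
  induction l with
  | nil => exact absurd rfl hl
  | cons x l ih =>
    rcases eq_or_ne l [] with rfl | hl'
    · refine Sound.offer_stay hG (Sound.offer_stay hG fun hok => ?_)
      have hv := abs_val_digit_sub_le hG x c
      rw [abs_sub_comm] at hv
      refine ⟨[x, x], [G.val (G.digit x c), G.val (G.digit x c)], [], .stay (.single x),
        .vertex _ (.single _), .cons hv (.cons hv .nil), rfl, by simpa [start] using hok, ?_,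
        by simp [start]⟩
      simp only [start]; split_ifs <;> norm_num
    · rw [result_cons _ _ hl']
      obtain ⟨q, l', rfl⟩ := List.exists_cons_of_ne_nil hl'
      refine (ih hl').step hG ?_
      rw [result_pl _ hl']
      exact playRun_near hG.ρ_nonneg 0 q l'

/-- The state at the end: a last vertex may be added at the end of the input curve. -/
def finish (G : Grid) (c : ℕ) (l : List ℝ) : GuidedState := G.offer (l.headD 0) (G.result c l)

/-- No error has occurred, and the grid curve has been followed exactly to its last vertex. -/
def Accepts (G : Grid) (c : ℕ) (l : List ℝ) : Prop :=
  (G.finish c l).ok ∧ (G.finish c l).y = (G.finish c l).lv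

/-- A grid curve that the guided algorithm builds is `D`-close to the input curve. -/
theorem Accepts.fd (hG : G.Valid) {c : ℕ} {l : List ℝ} (hl : l ≠ []) (h : G.Accepts c l) :
    FD G.D (curve l) (curve ((G.finish c l).w.map G.val)) ∧
      (G.finish c l).w ≠ [] ∧ ∀ z ∈ (G.finish c l).w, G.InRange z := by
  have hS : G.Sound (G.finish c l) l := by
    obtain ⟨x, l, rfl⟩ := List.exists_cons_of_ne_nil hl
    exact (Sound.result hG c hl).offer_stay hG
  obtain ⟨X, Y, t, hX, hY, hXY, hw, hwr, -⟩ := hS h.1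
  refine ⟨?_, fun h0 => by simp [h0] at hw, hwr⟩
  rw [h.2] at hY
  have h1 := FD.of_ref hX hY hXY
  have h2 : FD 0 (curve ((G.finish c l).lv :: (G.finish c l).lv :: t))
      (curve ((G.finish c l).lv :: t)) :=
    .of_ref (Ref.refl (by simp)) (.stay (Ref.refl (by simp))) (by simp)
  rw [hw]
  simpa using h1.trans h2

/-! ### Refining the input curve -/

/-- The state `A` is at least as good as `A'`: they differ at most in that `A` lags behind `A'` on
the current edge, from where all continuations of `A'` remain possible. -/
structure Le (A A' : GuidedState) : Prop where
  pl : A.pl = A'.pl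
  d : A.d = A'.d
  lv : A.lv = A'.lv
  c : A.c = A'.c
  w : A.w = A'.w
  sign : A.d = 1 ∨ A.d = -1
  lv_le : A.d * A.lv ≤ A.d * A.y
  le : A.d * A.y ≤ A.d * A'.y
  ok : A'.ok → A.ok

theorem Le.trans {A B C : GuidedState} (h : Le A B) (h' : Le B C) : Le A C :=
  ⟨h.pl.trans h'.pl, h.d.trans h'.d, h.lv.trans h'.lv, h.c.trans h'.c, h.w.trans h'.w, h.sign,
    h.lv_le, h.le.trans (by have := h'.le; rwa [← h.d] at this), h.ok ∘ h'.ok⟩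

theorem Le.refl_right {A B : GuidedState} (h : Le A B) : Le B B :=
  ⟨rfl, rfl, rfl, rfl, rfl, h.d ▸ h.sign, by
    have := h.lv_le.trans h.le; rwa [h.d, h.lv] at this, le_rfl, id⟩

theorem Le.with_pl {A A' : GuidedState} (h : Le A A') (S : PlayState) :
    Le { A with pl := S } { A' with pl := S } :=
  ⟨rfl, h.d, h.lv, h.c, h.w, h.sign, h.lv_le, h.le, h.ok⟩

theorem Le.offer {A A' : GuidedState} (h : Le A A') (p : ℝ) :
    Le (G.offer p A) (G.offer p A') := by
  by_cases hc : A.c % 2 = 1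
  · rw [offer_of_odd hc, offer_of_odd (h.c ▸ hc)]
    unfold take
    rw [← h.c]
    refine ⟨h.pl, by simp [h.d], rfl, rfl, by simp [h.w], neg_sign h.sign, le_rfl, le_rfl, ?_⟩
    rintro ⟨h1, h2, h3⟩
    refine ⟨h.ok h1, ?_, h3⟩
    rw [← h.d] at h2
    have := h.le
    linarith
  · rw [offer_of_even hc, offer_of_even (h.c ▸ hc)]
    exact ⟨h.pl, h.d, h.lv, by simp [h.c], h.w, h.sign, h.lv_le, h.le, h.ok⟩

theorem sign_mul_followPos {A : GuidedState} (h : A.d = 1 ∨ A.d = -1) (x : ℝ) :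
    A.d * G.followPos x A = max (A.d * A.y) (A.d * x - G.D) := by
  have hd : A.d * A.d = 1 := by rcases h with h | h <;> rw [h] <;> norm_num
  unfold followPos
  split_ifs with h1
  · rw [max_eq_right (by linarith), mul_sub, ← mul_assoc, hd, one_mul]
  · rw [max_eq_left (by linarith)]

theorem Le.follow {A A' : GuidedState} (h : Le A A') (x : ℝ) :
    Le (G.follow x A) (G.follow x A') := by
  have e1 := sign_mul_followPos (G := G) h.sign x
  have e2 := sign_mul_followPos (G := G) h.refl_right.sign x
  rw [← h.d] at e2
  have hle : A.d * G.followPos x A ≤ A.d * G.followPos x A' := by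
    rw [e1, e2]; exact max_le_max_right _ h.le
  refine ⟨h.pl, h.d, h.lv, h.c, h.w, h.sign, ?_, hle, ?_⟩
  · exact h.lv_le.trans (e1 ▸ le_max_left _ _)
  · rintro ⟨h1, h2⟩
    refine ⟨h.ok h1, ?_⟩
    rw [← h.d] at h2
    linarith

theorem Le.follow_right {A A' : GuidedState} (h : Le A A') (x : ℝ) : Le A (G.follow x A') := by
  have e2 := sign_mul_followPos (G := G) h.refl_right.sign x
  rw [← h.d] at e2
  exact ⟨h.pl, h.d, h.lv, h.c, h.w, h.sign, h.lv_le, h.le.trans (e2 ▸ le_max_left _ _),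
    fun hok => h.ok hok.1⟩

theorem Le.move {A A' : GuidedState} (h : Le A A') (x : ℝ) :
    Le (G.move x A) (G.move x A') := by
  unfold Grid.move
  rw [← h.pl]
  split_ifs
  · exact h.with_pl _
  · exact ((h.offer _).offer _).with_pl _

theorem Le.step {A A' : GuidedState} (h : Le A A') (x : ℝ) :
    Le (G.step A x) (G.step A' x) := (h.move x).follow x

theorem step_of_near {A : GuidedState} {x : ℝ} (h : |x - A.pl.y| ≤ G.ρ) :
    G.step A x = G.follow x A := by
  unfold step move
  rw [playStep_of_near h, if_pos rfl]

/-- Reading an intermediate point first can only impair the state. -/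
theorem Le.skip (hG : G.Valid) {A : GuidedState} (h : Le A A) {q p x : ℝ}
    (hq : |q - A.pl.y| ≤ G.ρ) (hp : p ∈ uIcc q x) :
    Le (G.step A x) (G.step (G.step A p) x) := by
  obtain ⟨h1, h2⟩ := playStep_skip hG.ρ_nonneg hq hp
  rcases h2 with h2 | h2
  · refine Le.step ?_ x
    have : G.step A p = G.follow p A := by
      unfold Grid.step Grid.move
      rw [h2, if_pos rfl]
    rw [this]
    exact h.follow_right p
  · have h3 : (playStep G.ρ (G.step A p).pl x) = playStep G.ρ A.pl x := by rw [step_pl, h1]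
    have h4 : (G.step A p).pl.dir = (playStep G.ρ A.pl x).dir := by rw [step_pl, h2]
    refine Le.follow ?_ x
    conv_rhs => rw [Grid.move, h3, h4, if_pos rfl]
    have e : ∀ B : GuidedState, { B with pl := playStep G.ρ A.pl x } =
      { ({ B with pl := playStep G.ρ A.pl p } : GuidedState) with pl := playStep G.ρ A.pl x } :=
        fun B => rfl
    unfold Grid.step Grid.move
    rw [h2]
    split_ifs
    · exact ((h.with_pl _).follow_right p).with_pl (playStep G.ρ A.pl x)
    · exact ((((h.offer _).offer _).with_pl _).follow_right p).with_pl (playStep G.ρ A.pl x)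

theorem le_init_self (c : ℕ) (x : ℝ) : Le (G.init c x) (G.init c x) := by
  have h0 : Le (G.start c x) (G.start c x) :=
    ⟨rfl, rfl, rfl, rfl, rfl, by simp only [start]; split_ifs <;> norm_num, le_rfl, le_rfl, id⟩
  exact (h0.offer x).offer x

theorem le_result_self (c : ℕ) {l : List ℝ} (hl : l ≠ []) :
    Le (G.result c l) (G.result c l) := by
  induction l with
  | nil => exact absurd rfl hl
  | cons x l ih =>
    rcases eq_or_ne l [] with rfl | hl'
    · exact le_init_self c x
    · rw [result_cons _ _ hl']; exact (ih hl').step x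

/-- The guided algorithm does at least as well on an input curve as on a refinement of it. -/
theorem le_result_of_ref (hG : G.Valid) (c : ℕ) {Y l : List ℝ} (h : Ref Y l) :
    Le (G.result c l) (G.result c Y) := by
  induction h with
  | single x => exact le_init_self c x
  | vertex x h ih =>
    rw [result_cons _ _ h.ne_nil.1, result_cons _ _ h.ne_nil.2]; exact ih.step x
  | @slide Y w p q p' h hp ih =>
    rw [result_cons _ _ h.ne_nil.1]
    refine Le.trans ?_ (ih.step p')
    rw [result_cons _ p' (by simp), result_cons _ p (by simp)]
    refine (le_result_self c (by simp)).skip hG ?_ hp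
    rw [result_pl _ (by simp)]
    exact playRun_near hG.ρ_nonneg 0 q w
  | @stay Y l x h ih =>
    rw [result_cons _ _ h.ne_nil.1, step_of_near]
    · exact ih.follow_right x
    · rw [← ih.pl, result_pl _ (by simp)]
      exact playRun_near hG.ρ_nonneg 0 x l

theorem Accepts.of_ref (hG : G.Valid) {c : ℕ} {Y l : List ℝ} (h : Ref Y l)
    (hY : G.Accepts c Y) : G.Accepts c l ∧ (G.finish c l).w = (G.finish c Y).w := by
  obtain ⟨x, Y', l', rfl, rfl⟩ := h.exists_head
  have hL : Le (G.finish c (x :: l')) (G.finish c (x :: Y')) := (le_result_of_ref hG c h).offer x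
  refine ⟨⟨hL.ok hY.1, ?_⟩, hL.w⟩
  refine sign_cancel hL.sign ?_ hL.lv_le
  have := hL.le
  rwa [hY.2, ← hL.lv] at this

end Grid

/-! ### Completeness of the guided algorithm -/

/-- While the direction is constant, the path of the play operator is monotone. -/
theorem exists_sign_of_dir_eq {R : ℝ} (hR : 0 ≤ R) {d : ℝ} {f : ℕ → ℝ} {t g : ℕ} {q : ℝ}
    (h : ∀ i, t ≤ i → i < g → (playSeq R d f (i + 1)).dir = q) :
    ∃ p : ℝ, (p = 1 ∨ p = -1) ∧
      ∀ i, t ≤ i → i < g → p * (playSeq R d f i).y ≤ p * (playSeq R d f (i + 1)).y := by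
  refine ⟨if q = -1 then -1 else 1, by split_ifs <;> simp, fun i h1 h2 => ?_⟩
  have hq := h i h1 h2
  rw [playSeq_succ] at hq ⊢
  rcases playStep_cases R (playSeq R d f i) (f (i + 1)) with h3 | h3 | h3
  · rw [playStep_up h3] at hq ⊢
    rw [← hq, if_neg (by norm_num)]
    simp only; linarith
  · rw [playStep_down hR h3] at hq ⊢
    rw [← hq, if_pos rfl]
    simp only; linarith
  · rw [playStep_of_near h3]

/-- The play operators on two close curves, with twice the radius for the second one. -/
theorem abs_playSeq_sub_playSeq_le {ρ : ℝ} (hρ : 0 ≤ ρ) {X T : ℕ → ℝ} {N : ℕ}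
    (h : ∀ t ≤ N, |X t - T t| ≤ ρ) (d e : ℝ) :
    ∀ t ≤ N, |(playSeq ρ d X t).y - (playSeq (2 * ρ) e T t).y| ≤ 2 * ρ := by
  intro t
  induction t with
  | zero =>
    intro _
    have := h 0 (Nat.zero_le _)
    change |X 0 - T 0| ≤ 2 * ρ
    linarith
  | succ t ih =>
    intro ht
    have i1 := abs_le.1 (ih (by omega))
    have i2 := abs_le.1 (h (t + 1) ht)
    rw [playSeq_succ, playSeq_succ, abs_le]
    rcases playStep_cases ρ (playSeq ρ d X t) (X (t + 1)) with h1 | h1 | h1 <;>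
    rcases playStep_cases (2 * ρ) (playSeq (2 * ρ) e T t) (T (t + 1)) with h2 | h2 | h2 <;>
    (first | rw [playStep_up h1] | rw [playStep_down hρ h1] | rw [playStep_of_near h1]) <;>
    (first | rw [playStep_up h2] | rw [playStep_down (by linarith) h2] | rw [playStep_of_near h2]) <;>
    simp only [abs_le] at * <;> constructor <;> linarith

namespace Grid

variable {G : Grid}

theorem sign_val_rd_mono (hμ : 0 < G.μ) {d : ℝ} (hd : d = 1 ∨ d = -1) {a b : ℝ}
    (h : 0 ≤ d * (b - a)) : d * G.val (G.rd a) ≤ d * G.val (G.rd b) := by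
  have mono : ∀ a b : ℝ, a ≤ b → G.val (G.rd a) ≤ G.val (G.rd b) := fun a b hab =>
    mul_le_mul_of_nonneg_right
      (by exact_mod_cast Int.floor_mono (div_le_div_of_nonneg_right hab hμ.le)) hμ.le
  rcases hd with rfl | rfl
  · have := mono a b (by linarith); linarith
  · have := mono b a (by linarith); linarith

theorem Valid.W_pos (hG : G.Valid) : 0 < G.W := by
  have := hG.W_eq; have := hG.h_nonneg; omega

theorem Valid.le_D' (hG : G.Valid) : 3 * G.ρ + G.μ ≤ G.D := by
  have h1 := hG.reach
  have h2 := hG.le_D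
  have := hG.μ_pos
  linarith

/-- The rounding of every `v` near `p` is chosen by some digit. -/
theorem exists_digit_eq (hG : G.Valid) {p v : ℝ} (h : |v - p| ≤ 3 * G.ρ) :
    ∃ a < G.W, ∀ r, G.digit p (a + G.W * r) = G.rd v := by
  have hμ := hG.μ_pos
  rw [abs_le] at h
  have h1 := rd_mul_le hμ p
  have h2 := lt_rd_mul hμ p
  have h3 := rd_mul_le hμ v
  have h4 := lt_rd_mul hμ v
  have h5 := hG.reach
  have e1 : G.rd v ≤ G.rd p + G.h := by
    have : (G.rd v : ℝ) * G.μ < (G.rd p + G.h + 1 : ℤ) * G.μ := by push_cast; nlinarith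
    have := lt_of_mul_lt_mul_right this hμ.le
    have := Int.cast_lt.1 this
    omega
  have e2 : G.rd p ≤ G.rd v + G.h := by
    have : (G.rd p : ℝ) * G.μ < (G.rd v + G.h + 1 : ℤ) * G.μ := by push_cast; nlinarith
    have := lt_of_mul_lt_mul_right this hμ.le
    have := Int.cast_lt.1 this
    omega
  have hW := hG.W_eq
  refine ⟨(G.rd v - G.rd p + G.h).toNat, by omega, fun r => ?_⟩
  rw [digit, Nat.add_mul_mod_self_left, Nat.mod_eq_of_lt (by omega),
    Int.toNat_of_nonneg (by omega)]
  change G.rd p + (G.rd v - G.rd p + G.h) - G.h = G.rd v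
  ring

/-- Some code makes the algorithm add the rounding of `v` as a vertex, and leaves the code `r`. -/
theorem exists_take (hG : G.Valid) {p v : ℝ} (h : |v - p| ≤ 3 * G.ρ) (hr : G.InRange (G.rd v))
    (r : ℕ) : ∃ c, c + 1 ≤ 2 * G.W * (r + 1) ∧ ∀ A : GuidedState, A.c = c → A.ok →
      0 ≤ A.d * (G.val (G.rd v) - A.y) → (G.offer p A).c = r ∧ (G.offer p A).d = -A.d ∧
        (G.offer p A).y = G.val (G.rd v) ∧ (G.offer p A).lv = G.val (G.rd v) ∧
        (G.offer p A).w = G.rd v :: A.w ∧ (G.offer p A).ok := by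
  obtain ⟨a, ha, hd⟩ := exists_digit_eq hG h
  have hW := hG.W_pos
  refine ⟨1 + 2 * (a + G.W * r), by nlinarith, fun A hc hok hm => ?_⟩
  have e1 : A.c / 2 = a + G.W * r := by omega
  have e2 : (a + G.W * r) / G.W = r := by
    rw [Nat.add_mul_div_left _ _ hW, Nat.div_eq_of_lt ha, zero_add]
  rw [offer_of_odd (by omega)]
  unfold take
  rw [e1, hd, e2]
  exact ⟨rfl, rfl, rfl, rfl, rfl, hok, hm, hr⟩

/-- The vertices of the guided curve are the roundings of the turning points of `S`. -/
def Tracks (G : Grid) (A : GuidedState) (S : PlayState) : Prop :=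
  A.ok ∧ A.d = S.dir ∧ A.w = S.out.map G.rd ∧ ∃ v t, S.out = v :: t ∧ A.lv = G.val (G.rd v)

/-- The guided curve has all the turning points up to time `g` of the path `S`. If there are none
after time `t`, then it is behind this path, and otherwise it waits in the last one of them. -/
def Ahead (G : Grid) (S : ℕ → PlayState) (t g : ℕ) (A : GuidedState) : Prop :=
  G.Tracks A (S g) ∧ ((S g).out = (S t).out → A.d * A.y ≤ A.d * G.val (G.rd (S t).y)) ∧
    ((S g).out ≠ (S t).out → A.y = A.lv)

/-- While `z` is monotone, from time `t` to time `g`, two offers at a point near `z t` suffice to be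
ahead of `S` until time `g`, as `S` turns at most twice. -/
theorem Ahead.offers (hG : G.Valid) {S : ℕ → PlayState} {z : ℕ → ℝ} {N : ℕ} (hL : Lazy S z N)
    (hE : ∀ t ≤ N, |z t - (S t).y| ≤ 2 * G.ρ) (hr : ∀ i ≤ N, G.InRange (G.rd (S i).y))
    (hS : ∀ t, (S t).dir = 1 ∨ (S t).dir = -1) {t g : ℕ} (htg : t ≤ g) (hg : g ≤ N) {q : ℝ}
    (hq : q = 1 ∨ q = -1) (hz : ∀ i, t ≤ i → i < g → q * z i ≤ q * z (i + 1)) {p : ℝ}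
    (hp : |z t - p| ≤ G.ρ) (r : ℕ) :
    ∃ c, (c + 1) * G.W ^ (S t).out.length ≤ (r + 1) * 4 * G.W ^ (S g).out.length ∧
      ∀ A : GuidedState, A.c = c → G.Ahead S t t A →
        (G.offer p (G.offer p A)).c = r ∧ G.Ahead S t g (G.offer p (G.offer p A)) := by
  have hμ := hG.μ_pos
  have near : ∀ v, |z t - v| ≤ 2 * G.ρ → |v - p| ≤ 3 * G.ρ := fun v hv => by
    rw [abs_le] at *; constructor <;> linarith
  rcases hL.cases_of_monotone hE hq htg hg hz (hS t) with
    ⟨h1, h2, -⟩ | ⟨v, i, hi, hv, h1, h2, h3, -, h5⟩ |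
    ⟨v, i, w, j, hi, hv, hj, hw, h1, h2, -, h3, h4, -, h5, h6⟩
  · refine ⟨2 * (2 * r), by rw [h1]; exact Nat.mul_le_mul_right _ (by omega), fun A hc hA => ?_⟩
    rw [offer_of_even (A := A) (by omega)]
    rw [offer_of_even (by simp only; omega)]
    refine ⟨by simp only; omega, ?_, fun _ => hA.2.1 rfl, fun h => absurd h1 h⟩
    obtain ⟨a1, a2, a3, a4⟩ := hA.1
    exact ⟨a1, by rw [h2]; exact a2, by rw [h1]; exact a3, by rw [h1]; exact a4⟩
  · obtain ⟨c, hc, hct⟩ := exists_take hG (near v h5) (hv ▸ hr i hi) (2 * r)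
    refine ⟨c, ?_, fun A hAc hA => ?_⟩
    · rw [h1, List.length_cons, pow_succ]
      calc (c + 1) * G.W ^ (S t).out.length
          ≤ 2 * G.W * (2 * r + 1) * G.W ^ (S t).out.length := Nat.mul_le_mul_right _ hc
        _ ≤ 2 * G.W * (2 * r + 2) * G.W ^ (S t).out.length := by gcongr; omega
        _ = _ := by ring
    · obtain ⟨⟨a1, a2, a3, a4⟩, a5, -⟩ := hA
      have m1 := sign_val_rd_mono hμ (hS t) h3
      have m2 := a5 rfl
      rw [a2] at m2
      obtain ⟨b1, b2, b3, b4, b5, b6⟩ := hct A hAc a1 (by rw [a2]; linarith)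
      rw [offer_of_even (A := G.offer p A) (by omega)]
      refine ⟨by simp only; omega, ⟨b6, ?_, ?_, v, _, h1, b4⟩, fun h => ?_, fun _ => ?_⟩
      · simp only; rw [b2, h2, a2]
      · simp only; rw [b5, h1, a3]; rfl
      · rw [h1] at h; simpa using congrArg List.length h
      · simp only; rw [b3, b4]
  · obtain ⟨c', hc', hct'⟩ := exists_take hG (near w h6) (hw ▸ hr j hj) r
    obtain ⟨c, hc, hct⟩ := exists_take hG (near v h5) (hv ▸ hr i hi) c'
    refine ⟨c, ?_, fun A hAc hA => ?_⟩
    · rw [h1, List.length_cons, List.length_cons, pow_succ, pow_succ]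
      calc (c + 1) * G.W ^ (S t).out.length
          ≤ 2 * G.W * (c' + 1) * G.W ^ (S t).out.length := Nat.mul_le_mul_right _ hc
        _ ≤ 2 * G.W * (2 * G.W * (r + 1)) * G.W ^ (S t).out.length := by gcongr
        _ = _ := by ring
    · obtain ⟨⟨a1, a2, a3, a4⟩, a5, -⟩ := hA
      have m1 := sign_val_rd_mono hμ (hS t) h3
      have m2 := a5 rfl
      rw [a2] at m2
      have m3 := sign_val_rd_mono hμ (neg_sign (hS t)) h4
      obtain ⟨b1, b2, b3, b4, b5, b6⟩ := hct A hAc a1 (by rw [a2]; linarith)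
      obtain ⟨d1, d2, d3, d4, d5, d6⟩ := hct' (G.offer p A) b1 b6 (by rw [b2, b3, a2]; linarith)
      refine ⟨d1, ⟨d6, ?_, ?_, w, _, h1, d4⟩, fun h => ?_, fun _ => ?_⟩
      · rw [d2, b2, h2, a2, neg_neg]
      · rw [d5, b5, h1, a3]; rfl
      · rw [h1] at h; have := congrArg List.length h; simp at this; omega
      · rw [d3, d4]

/-- No error occurs when the guided curve follows the input curve. -/
theorem Ahead.follow (hG : G.Valid) {S : ℕ → PlayState} {z : ℕ → ℝ} {N : ℕ} (hL : Lazy S z N)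
    (hE : ∀ t ≤ N, |z t - (S t).y| ≤ 2 * G.ρ) (hS : ∀ t, (S t).dir = 1 ∨ (S t).dir = -1)
    {t g : ℕ} (htg : t + 1 ≤ g) (hg : g ≤ N) {q : ℝ} (hq : q = 1 ∨ q = -1)
    (hz : ∀ i, t + 1 ≤ i → i < g → q * z i ≤ q * z (i + 1)) {x : ℝ} (hx : |x - z (t + 1)| ≤ G.ρ)
    {A : GuidedState} (hA : G.Ahead S t g A) : G.Ahead S (t + 1) g (G.follow x A) := by
  have hμ := hG.μ_pos
  have hD := hG.le_D'
  have hD0 := hG.D_nonneg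
  obtain ⟨⟨a1, a2, a3, v, l, a4, a5⟩, a6, a7⟩ := hA
  have hd : A.d = 1 ∨ A.d = -1 := a2 ▸ hS g
  have hf := sign_mul_followPos (G := G) hd x
  have hcases := hL.cases_of_monotone hE hq htg hg hz (hS (t + 1))
  have hlen : (S (t + 1)).out.length ≤ (S g).out.length := by
    rcases hcases with ⟨h1, -⟩ | ⟨v, i, -, -, h1, -⟩ | ⟨v, i, w, j, -, -, -, -, h1, -⟩ <;>
      rw [h1] <;> simp only [List.length_cons] <;> omega
  have hdir : (S g).out = (S (t + 1)).out → (S g).dir = (S (t + 1)).dir := by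
    intro h0
    rcases hcases with ⟨-, h2, -⟩ | ⟨v, i, -, -, h1, -⟩ | ⟨v, i, w, j, -, -, -, -, h1, -⟩
    · exact h2
    · rw [h0] at h1; simpa using congrArg List.length h1
    · rw [h0] at h1; have := congrArg List.length h1; simp at this; omega
  -- the same for time `t + 1`, before the guided curve follows the input curve
  have key : ((S g).out = (S (t + 1)).out → A.d * A.y ≤ A.d * G.val (G.rd (S (t + 1)).y)) ∧
      ((S g).out ≠ (S (t + 1)).out → A.y = A.lv) := by
    rcases hL t (by omega) with h | ⟨s, hs, m1, m2, -, m4⟩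
    · rw [h]; exact ⟨a6, a7⟩
    · have mono := sign_val_rd_mono hμ hs m1.le
      split_ifs at m4 with hts
      · have hne : (S g).out ≠ (S t).out := fun h0 => by
          rw [m4, h0, List.length_cons] at hlen; omega
        refine ⟨fun h0 => ?_, fun _ => a7 hne⟩
        have e : v = (S t).y := by
          rw [a4, m4] at h0; exact (List.cons.inj h0).1
        rw [a7 hne, a5, e, a2, hdir h0, m2]
        exact mono
      · rw [m4]
        refine ⟨fun h0 => ?_, a7⟩
        have h1 := a6 h0
        rw [a2, hdir (h0.trans m4.symm), m2] at h1 ⊢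
        exact h1.trans mono
  have hxS : ∀ u, |z (t + 1) - u| ≤ 2 * G.ρ →
      A.d * x ≤ A.d * G.val (G.rd u) + G.D ∧ A.d * G.val (G.rd u) ≤ A.d * x + G.D := by
    intro u hu
    have h1 := abs_val_rd_sub_le hμ u
    rw [abs_le] at h1 hu hx
    rcases hd with hd | hd <;> rw [hd] <;> constructor <;> linarith
  by_cases h0 : (S g).out = (S (t + 1)).out
  · have h1 := key.1 h0
    have h2 := hxS _ (hE (t + 1) (by omega))
    have h3 : A.d * G.followPos x A ≤ A.d * G.val (G.rd (S (t + 1)).y) := by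
      rw [hf]; exact max_le h1 (by linarith)
    refine ⟨⟨⟨a1, by rw [mul_sub]; linarith⟩, a2, a3, v, l, a4, a5⟩, fun _ => h3,
      fun h => absurd h0 h⟩
  · have h1 := key.2 h0
    have hv : |z (t + 1) - v| ≤ 2 * G.ρ := by
      rcases hcases with ⟨h1, -⟩ | ⟨u, i, -, -, h1, -, -, -, h5⟩ |
        ⟨u, i, w, j, -, -, -, -, h1, -, -, -, -, -, -, h6⟩
      · exact absurd h1 h0
      · rw [a4] at h1; rw [(List.cons.inj h1).1]; exact h5
      · rw [a4] at h1; rw [(List.cons.inj h1).1]; exact h6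
    have h2 := hxS v hv
    rw [← a5, ← h1] at h2
    have h3 : G.followPos x A = A.y := by
      unfold followPos; rw [if_neg]; rw [mul_sub]; linarith
    refine ⟨⟨⟨a1, by rw [h3, mul_sub]; linarith⟩, a2, a3, v, l, a4, a5⟩,
      fun h => absurd h h0, fun _ => h3.trans h1⟩

theorem Ahead.with_pl {S : ℕ → PlayState} {t g : ℕ} {A : GuidedState} (h : G.Ahead S t g A)
    (P : PlayState) : G.Ahead S t g { A with pl := P } := h

/-- The number of bits of the code that are not spent on digits. -/
def bits (S : PlayState) : ℕ := 2 * S.out.length + if S.dir = 0 then 1 else 3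

/-- If `X` is `ρ`-close to `T`, then some code guides the algorithm on `X` along the path of the
play operator of radius `2ρ` on `T`. The turning points of this path are added when the play
operator of radius `ρ` on `X` turns or starts: until it turns again, its path is monotone, and
hence it is clear from the beginning which turning points of the path on `T` are passed. -/
theorem exists_code_ahead (hG : G.Valid) {X T : ℕ → ℝ} {N : ℕ}
    (h : ∀ t ≤ N, |X t - T t| ≤ G.ρ) {d : ℝ} (hd : d = 1 ∨ d = -1)
    (hr : ∀ i ≤ N, G.InRange (G.rd (playSeq (2 * G.ρ) d T i).y)) :
    ∀ t g, t ≤ g → g ≤ N →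
      (∀ i, t ≤ i → i ≤ g → (playSeq G.ρ 0 X i).dir = (playSeq G.ρ 0 X t).dir) →
      ∀ r : ℕ, ∃ c, c + 1 ≤ (r + 1) * 2 ^ bits (playSeq G.ρ 0 X t) *
          G.W ^ (playSeq (2 * G.ρ) d T g).out.length ∧
        (G.result c (pre X t)).c = r ∧
        G.Ahead (playSeq (2 * G.ρ) d T) t g (G.result c (pre X t)) := by
  have hρ := hG.ρ_nonneg
  have hρ2 : 0 ≤ 2 * G.ρ := by linarith
  set S := playSeq (2 * G.ρ) d T with hSdef
  set Z := playSeq G.ρ 0 X with hZdef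
  have hS : ∀ t, (S t).dir = 1 ∨ (S t).dir = -1 := playSeq_dir hρ2 hd T
  have hZX : ∀ t, |X t - (Z t).y| ≤ G.ρ := playSeq_near hρ 0 X
  have hL : Lazy S (fun t => (Z t).y) N := by
    refine lazy_playSeq hρ2 d fun t ht => ?_
    have h1 := abs_le.1 (h t ht)
    have h2 := abs_le.1 (hZX t)
    rw [abs_le]; constructor <;> linarith
  have hE : ∀ t ≤ N, |(Z t).y - (S t).y| ≤ 2 * G.ρ := abs_playSeq_sub_playSeq_le hρ h 0 d
  have hpl : ∀ c t, (G.result c (pre X t)).pl = Z t := fun c t => result_pl c (pre_ne_nil X t)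
  have hsucc : ∀ c t, G.result c (pre X (t + 1)) = G.step (G.result c (pre X t)) (X (t + 1)) :=
    fun c t => result_cons _ _ (pre_ne_nil X t)
  have hZs : ∀ t, Z (t + 1) = playStep G.ρ (Z t) (X (t + 1)) := playSeq_succ _ _ _
  intro t
  induction t with
  | zero =>
    intro g htg hg hdir r
    obtain ⟨q, hq, hz⟩ := exists_sign_of_dir_eq (g := g) (t := 0) hρ
      fun i _ h2 => hdir (i + 1) (by omega) (by omega)
    obtain ⟨c', hc', hct⟩ := Ahead.offers hG hL hE hr hS htg hg hq hz (p := X 0)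
      (by simpa [hZdef, playSeq, pre, run, playInit] using hρ) r
    have hT : |T 0 - X 0| ≤ 3 * G.ρ := by
      have := h 0 (Nat.zero_le _); rw [abs_sub_comm] at this; linarith
    obtain ⟨a, ha, had⟩ := exists_digit_eq hG hT
    have hW := hG.W_pos
    obtain ⟨b, hb, hbd⟩ : ∃ b < 2, (if b = 1 then (1 : ℝ) else -1) = d := by
      rcases hd with rfl | rfl
      · exact ⟨1, by norm_num, by simp⟩
      · exact ⟨0, by norm_num, by simp⟩
    have e2 : (a + G.W * (b + 2 * c')) / G.W = b + 2 * c' := by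
      rw [Nat.add_mul_div_left _ _ hW, Nat.div_eq_of_lt ha, zero_add]
    have hst : G.start (a + G.W * (b + 2 * c')) (X 0) = ⟨playInit 0 (X 0), d, G.val (G.rd (T 0)),
        G.val (G.rd (T 0)), c', [G.rd (T 0)], G.InRange (G.rd (T 0))⟩ := by
      unfold start
      rw [had, e2, show (b + 2 * c') % 2 = b by omega, show (b + 2 * c') / 2 = c' by omega, hbd]
    have hout : (S 0).out = [T 0] := rfl
    obtain ⟨k1, k2⟩ := hct (G.start (a + G.W * (b + 2 * c')) (X 0)) (by rw [hst]) (by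
      rw [hst]
      exact ⟨⟨hr 0 (Nat.zero_le _), rfl, rfl, T 0, [], rfl, rfl⟩, fun _ => le_rfl, fun h => absurd rfl h⟩)
    refine ⟨a + G.W * (b + 2 * c'), ?_, k1, k2⟩
    rw [hout] at hc'
    simp only [List.length_singleton, pow_one] at hc'
    have hb3 : bits (Z 0) = 3 := by simp [bits, hZdef, playSeq, pre, run, playInit]
    rw [hb3]
    calc a + G.W * (b + 2 * c') + 1 ≤ 2 * ((c' + 1) * G.W) := by nlinarith
      _ ≤ 2 * ((r + 1) * 4 * G.W ^ (S g).out.length) := Nat.mul_le_mul_left _ hc'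
      _ = _ := by ring
  | succ t ih =>
    intro g htg hg hdir r
    obtain ⟨q, hq, hz⟩ := exists_sign_of_dir_eq (g := g) (t := t) hρ
      fun i h1 h2 => hdir (i + 1) (by omega) (by omega)
    have hz' : ∀ i, t + 1 ≤ i → i < g → q * (Z i).y ≤ q * (Z (i + 1)).y :=
      fun i h1 h2 => hz i (by omega) h2
    have hnear : |X (t + 1) - (Z (t + 1)).y| ≤ G.ρ := hZX (t + 1)
    by_cases hs : (Z (t + 1)).dir = (Z t).dir
    · obtain ⟨c, hc, hcr, hcA⟩ := ih g (by omega) hg (fun i h1 h2 => by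
        rcases Nat.lt_or_ge t i with h3 | h3
        · rw [hdir i (by omega) h2, hs]
        · obtain rfl : i = t := by omega
          rfl) r
      have hb : bits (Z (t + 1)) = bits (Z t) := by
        unfold bits
        rw [hs]
        have : (Z (t + 1)).out = (Z t).out := by
          rw [hZs] at hs ⊢
          rcases playStep_cases G.ρ (Z t) (X (t + 1)) with h1 | h1 | h1
          · rw [playStep_up h1] at hs ⊢
            simp only at hs ⊢
            rw [← hs, if_neg (by norm_num)]
          · rw [playStep_down hρ h1] at hs ⊢
            simp only at hs ⊢
            rw [← hs, if_neg (by norm_num)]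
          · rw [playStep_of_near h1]
        rw [this]
      have hmove : G.move (X (t + 1)) (G.result c (pre X t)) =
          { G.result c (pre X t) with pl := playStep G.ρ (Z t) (X (t + 1)) } := by
        unfold move; rw [hpl, if_pos (by rw [← hZs, hs])]
      rw [hb]
      refine ⟨c, hc, ?_, ?_⟩
      · rw [hsucc, step, hmove]; exact hcr
      · rw [hsucc, step, hmove]
        exact (hcA.with_pl _).follow hG hL hE hS htg hg hq hz' hnear
    · have hp : |(Z t).y - ((Z t).y + (Z (t + 1)).dir * G.ρ)| ≤ G.ρ ∧
          bits (Z (t + 1)) = bits (Z t) + 2 := by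
        unfold bits
        have n1 : (1 : ℝ) ≠ -1 := by norm_num
        have n2 : (0 : ℝ) ≠ -1 := by norm_num
        have n3 : (-1 : ℝ) ≠ 1 := by norm_num
        have hZd : (Z t).dir = 0 ∨ (Z t).dir = 1 ∨ (Z t).dir = -1 := by
          generalize t = t
          induction t with
          | zero => exact .inl rfl
          | succ t iht =>
            rw [hZs]
            rcases playStep_cases G.ρ (Z t) (X (t + 1)) with h1 | h1 | h1
            · rw [playStep_up h1]; simp
            · rw [playStep_down hρ h1]; simp
            · rw [playStep_of_near h1]; exact iht
        rw [hZs] at hs ⊢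
        rcases playStep_cases G.ρ (Z t) (X (t + 1)) with h1 | h1 | h1
        · rw [playStep_up h1] at hs ⊢
          simp only at hs ⊢
          refine ⟨by simp [abs_of_nonneg hρ], ?_⟩
          rcases hZd with e | e | e
          · simp [e, n2]
          · exact absurd e.symm hs
          · simp [e]; omega
        · rw [playStep_down hρ h1] at hs ⊢
          simp only at hs ⊢
          refine ⟨by simp [abs_of_nonneg hρ], ?_⟩
          rcases hZd with e | e | e
          · simp [e]
          · simp [e]; omega
          · exact absurd e.symm hs
        · rw [playStep_of_near h1] at hs; exact absurd rfl hs
      obtain ⟨c', hc', hct⟩ := Ahead.offers hG hL hE hr hS (t := t) (by omega) hg hq hz hp.1 r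
      obtain ⟨c, hc, hcr, hcA⟩ := ih t le_rfl (by omega) (fun i h1 h2 => by
        obtain rfl : i = t := by omega
        rfl) c'
      obtain ⟨k1, k2⟩ := hct _ hcr hcA
      have hmove : G.move (X (t + 1)) (G.result c (pre X t)) =
          { G.offer ((Z t).y + (Z (t + 1)).dir * G.ρ) (G.offer ((Z t).y + (Z (t + 1)).dir * G.ρ)
            (G.result c (pre X t))) with pl := playStep G.ρ (Z t) (X (t + 1)) } := by
        unfold move; rw [hpl, ← hZs, if_neg hs]
      refine ⟨c, ?_, ?_, ?_⟩
      · rw [hp.2]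
        calc c + 1 ≤ (c' + 1) * 2 ^ bits (Z t) * G.W ^ (S t).out.length := hc
          _ = 2 ^ bits (Z t) * ((c' + 1) * G.W ^ (S t).out.length) := by ring
          _ ≤ 2 ^ bits (Z t) * ((r + 1) * 4 * G.W ^ (S g).out.length) := Nat.mul_le_mul_left _ hc'
          _ = _ := by ring
      · rw [hsucc, step, hmove]; exact k1
      · rw [hsucc, step, hmove]
        exact (k2.with_pl _).follow hG hL hE hS htg hg hq hz' hnear

theorem _root_.Ref.abs_le {Y l : List ℝ} (h : Ref Y l) {a : ℝ} (hl : ∀ x ∈ l, |x| ≤ a) :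
    ∀ x ∈ Y, |x| ≤ a := by
  induction h with
  | single x => exact hl
  | vertex x h ih =>
    simp only [List.mem_cons, forall_eq_or_imp] at hl ⊢
    exact ⟨hl.1, ih hl.2⟩
  | @slide Y w p q p' h hp ih =>
    simp only [List.mem_cons, forall_eq_or_imp] at hl ih ⊢
    refine ⟨hl.1, ih ⟨?_, hl.2⟩⟩
    have h1 := _root_.abs_le.1 hl.1
    have h2 := _root_.abs_le.1 hl.2.1
    rw [mem_uIcc] at hp
    rw [_root_.abs_le]
    rcases hp with hp | hp <;> constructor <;> linarith
  | stay h ih =>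
    simp only [List.mem_cons, forall_eq_or_imp] at ih ⊢
    simp only [List.mem_cons, forall_eq_or_imp] at hl
    exact ⟨hl.1, ih hl⟩

/-- An input curve at distance at most `ρ` from the query curve with `k` vertices has a code below
`64 * (16 * W) ^ k` with which the guided algorithm finds the rounded path of the play operator of
radius `2ρ` on the query curve. -/
theorem exists_code (hG : G.Valid) {f g : ℕ → ℝ} {M K : ℕ}
    (hFD : FD G.ρ (curve (pre f M)) (curve (pre g K))) {a : ℝ} (ha : ∀ x ∈ pre f M, |x| ≤ a)
    (hr : ∀ v, |v| ≤ a + 3 * G.ρ → G.InRange (G.rd v)) :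
    ∃ c < 64 * (16 * G.W) ^ (K + 1), G.Accepts c (pre f M) ∧
      (G.finish c (pre f M)).w = (playSeq (2 * G.ρ) 0 g K).final.map G.rd := by
  have hρ := hG.ρ_nonneg
  have hρ2 : 0 ≤ 2 * G.ρ := by linarith
  have hμ := hG.μ_pos
  have hW := hG.W_pos
  obtain ⟨LX, LY, hX, hY, hXY⟩ := hFD.exists_ref
  obtain ⟨N, hN⟩ : ∃ N, LX.length = N + 1 :=
    ⟨LX.length - 1, by have := List.length_pos_iff.2 hX.ne_nil.1; omega⟩
  have eX := eq_pre_node hN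
  have eY := eq_pre_node (l := LY) (N := N) (by rw [← hXY.length_eq, hN])
  set X := node LX
  set T := node LY
  have hc : ∀ t ≤ N, |X t - T t| ≤ G.ρ := fun t ht => forall₂_node hXY t (by omega)
  have hXa : ∀ t ≤ N, |X t| ≤ a := by
    intro t ht
    have hmem : X t ∈ LX := by
      simp only [X, node]
      rw [List.getD_eq_getElem _ _ (by simp; omega)]
      exact List.mem_reverse.1 (List.getElem_mem _)
    exact hX.abs_le ha _ hmem
  obtain ⟨d, hd, hy, hout, hdir⟩ := exists_initial_dir hρ2 T N
  change (playSeq (2 * G.ρ) d T N).y = (playSeq (2 * G.ρ) 0 T N).y at hy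
  change (playSeq (2 * G.ρ) d T N).out = (playSeq (2 * G.ρ) 0 T N).out at hout
  have hnear : ∀ i ≤ N, |(playSeq (2 * G.ρ) d T i).y - X i| ≤ 3 * G.ρ := fun i hi => by
    have h1 := abs_le.1 (playSeq_near hρ2 d T i)
    have h2 := abs_le.1 (hc i hi)
    rw [_root_.abs_le]; constructor <;> linarith
  have hr' : ∀ i ≤ N, G.InRange (G.rd (playSeq (2 * G.ρ) d T i).y) := fun i hi => by
    refine hr _ ?_
    have h1 := abs_le.1 (hnear i hi)
    have h2 := abs_le.1 (hXa i hi)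
    rw [_root_.abs_le]; constructor <;> linarith
  -- the play operator is rate-independent
  have hT : playSeq (2 * G.ρ) 0 T N = playSeq (2 * G.ρ) 0 g K := by
    have := hY.playRun_eq hρ2 0; rwa [eY] at this
  have hT0 : playSeq 0 0 T N = playSeq 0 0 g K := by
    have := hY.playRun_eq le_rfl 0; rwa [eY] at this
  have hlen : (playSeq (2 * G.ρ) 0 T N).final.length ≤ K + 1 := by
    rw [hT]; exact length_final_le hρ2 g K
  have hbits : bits (playSeq G.ρ 0 X N) ≤ 4 * (K + 1) + 5 := by
    have h1 := length_out_le_of_close hρ hc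
    rw [hT0] at h1
    have h2 : (playSeq 0 0 g K).out.length ≤ K + 1 := by
      rcases length_out_le le_rfl g K with ⟨-, h⟩ | ⟨-, h⟩
      · exact h.le.trans (by omega)
      · exact h.trans (by omega)
    unfold bits
    split_ifs <;> omega
  obtain ⟨r, hrb, hrf⟩ : ∃ r : ℕ, (r + 1) * G.W ^ (playSeq (2 * G.ρ) d T N).out.length ≤
      2 * G.W ^ (playSeq (2 * G.ρ) 0 T N).final.length ∧
      ∀ A : GuidedState, A.c = r → G.Ahead (playSeq (2 * G.ρ) d T) N N A →
        A.d * A.lv ≤ A.d * A.y →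
        (G.offer (X N) A).ok ∧ (G.offer (X N) A).y = (G.offer (X N) A).lv ∧
        (G.offer (X N) A).w = (playSeq (2 * G.ρ) 0 T N).final.map G.rd := by
    rcases hdir with ⟨h0, h1⟩ | ⟨h0, h1⟩
    · change (playSeq (2 * G.ρ) 0 T N).dir = 0 at h0
      change (playSeq (2 * G.ρ) 0 T N).out = [(playSeq (2 * G.ρ) 0 T N).y] at h1
      refine ⟨0, by rw [hout, PlayState.final, if_pos h0]; omega, fun A hc hA hle => ?_⟩
      obtain ⟨⟨a1, a2, a3, v, t, a4, a5⟩, a6, -⟩ := hA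
      rw [offer_of_even (by omega), PlayState.final, if_pos h0]
      refine ⟨a1, sign_cancel (a2 ▸ playSeq_dir hρ2 hd T N) ?_ hle, by rw [← hout]; exact a3⟩
      have e : v = (playSeq (2 * G.ρ) d T N).y := by
        rw [hout, h1, ← hy] at a4; exact (List.cons.inj a4).1.symm
      rw [a5, e]
      exact a6 rfl
    · change (playSeq (2 * G.ρ) 0 T N).dir ≠ 0 at h1
      obtain ⟨c, hc, hct⟩ := exists_take hG (hnear N le_rfl) (hr' N le_rfl) 0
      refine ⟨c, ?_, fun A hAc hA hle => ?_⟩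
      · rw [hout, PlayState.final, if_neg h1, List.length_cons, pow_succ]
        calc (c + 1) * G.W ^ (playSeq (2 * G.ρ) 0 T N).out.length
            ≤ 2 * G.W * (0 + 1) * G.W ^ (playSeq (2 * G.ρ) 0 T N).out.length :=
              Nat.mul_le_mul_right _ hc
          _ = _ := by ring
      · obtain ⟨⟨a1, a2, a3, -⟩, a6, -⟩ := hA
        have := a6 rfl
        obtain ⟨-, -, b3, b4, b5, b6⟩ := hct A hAc a1 (by rw [mul_sub]; linarith)
        refine ⟨b6, b3.trans b4.symm, ?_⟩
        rw [b5, a3, PlayState.final, if_neg h1, List.map_cons, hy, hout]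
  obtain ⟨c, hcb, hcr, hcA⟩ := exists_code_ahead hG hc hd hr' N N le_rfl le_rfl
    (fun i h1 h2 => by rw [le_antisymm h2 h1]) r
  obtain ⟨k1, k2, k3⟩ := hrf _ hcr hcA (le_result_self c (pre_ne_nil X N)).lv_le
  have hfin : G.finish c LX = G.offer (X N) (G.result c (pre X N)) := by
    rw [eX]; unfold finish; cases N <;> rfl
  have hacc := Accepts.of_ref hG hX (c := c) ⟨by rw [hfin]; exact k1, by rw [hfin]; exact k2⟩
  refine ⟨c, ?_, hacc.1, by rw [hacc.2, hfin, k3, hT]⟩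
  calc c + 1 ≤ (r + 1) * 2 ^ bits (playSeq G.ρ 0 X N) *
        G.W ^ (playSeq (2 * G.ρ) d T N).out.length := hcb
    _ = 2 ^ bits (playSeq G.ρ 0 X N) *
        ((r + 1) * G.W ^ (playSeq (2 * G.ρ) d T N).out.length) := by ring
    _ ≤ 2 ^ (4 * (K + 1) + 5) * (2 * G.W ^ (K + 1)) := by
        exact Nat.mul_le_mul (Nat.pow_le_pow_right two_pos hbits)
          (hrb.trans (Nat.mul_le_mul_left _ (Nat.pow_le_pow_right hW hlen)))
    _ = 64 * (16 * G.W) ^ (K + 1) := by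
        rw [mul_pow, pow_add, pow_mul]; norm_num; ring

end Grid

/-! ### Words as numbers -/

namespace Grid

/-- The number with the digits `z + H` in base `U` and a leading digit `1`. -/
def enc (G : Grid) : List ℤ → ℤ
  | [] => 1
  | z :: w => enc G w * G.U + (z + G.H)

variable {G : Grid}

theorem enc_bounds {w : List ℤ} (h : ∀ z ∈ w, G.InRange z) :
    1 ≤ G.enc w ∧ G.enc w + 1 ≤ 2 * G.U ^ w.length := by
  induction w with
  | nil => simp [enc]
  | cons z w ih =>
    obtain ⟨h1, h2⟩ := ih fun a ha => h a (List.mem_cons_of_mem _ ha)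
    obtain ⟨h3, h4⟩ := h z (by simp)
    rw [enc, List.length_cons, pow_succ]
    constructor <;> nlinarith

theorem enc_injective (hU : 2 ≤ G.U) {w w' : List ℤ} (h : ∀ z ∈ w, G.InRange z) (h' : ∀ z ∈ w', G.InRange z)
    (e : G.enc w = G.enc w') : w = w' := by
  induction w generalizing w' with
  | nil =>
    cases w' with
    | nil => rfl
    | cons z w' =>
      obtain ⟨h3, h4⟩ := h' z (by simp)
      have := (enc_bounds fun a ha => h' a (List.mem_cons_of_mem _ ha)).1
      rw [enc, enc] at e
      nlinarith
  | cons z w ih =>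
    obtain ⟨h3, h4⟩ := h z (by simp)
    have hw := fun a ha => h a (List.mem_cons_of_mem z (a := a) ha)
    cases w' with
    | nil =>
      have := (enc_bounds hw).1
      rw [enc, enc] at e
      nlinarith
    | cons z' w' =>
      obtain ⟨h5, h6⟩ := h' z' (by simp)
      have hw' := fun a ha => h' a (List.mem_cons_of_mem z' (a := a) ha)
      rw [enc, enc] at e
      have e1 : G.enc w = G.enc w' := by
        rcases lt_trichotomy (G.enc w) (G.enc w') with hlt | heq | hgt
        · nlinarith
        · exact heq
        · nlinarith
      rw [e1] at e
      rw [ih hw hw' e1, show z = z' by linarith]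

end Grid

/-! ### The memory layout -/

namespace Cell

/-! The cell `0` receives the answer. The cells `1` to `17` hold the parameters and the dictionary,
and queries do not change them. -/

abbrev ans : ℕ := 0
abbrev k : ℕ := 1
abbrev μ : ℕ := 2
abbrev ρ : ℕ := 3
abbrev R : ℕ := 4
abbrev D : ℕ := 5
abbrev H : ℕ := 6
abbrev U : ℕ := 7
abbrev h : ℕ := 8
abbrev W : ℕ := 9
abbrev KM : ℕ := 10
abbrev n : ℕ := 11
abbrev m : ℕ := 12
abbrev NC : ℕ := 13
abbrev B : ℕ := 14
abbrev F : ℕ := 15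
abbrev P : ℕ := 16
abbrev Q : ℕ := 17
abbrev max : ℕ := 18
abbrev i : ℕ := 19
abbrev c₀ : ℕ := 20
abbrev j : ℕ := 21
abbrev x : ℕ := 22
abbrev z : ℕ := 23
abbrev e : ℕ := 24
abbrev d : ℕ := 25
abbrev y : ℕ := 26
abbrev lv : ℕ := 27
abbrev c : ℕ := 28
abbrev key : ℕ := 29
abbrev ok : ℕ := 30
abbrev s : ℕ := 31
abbrev p : ℕ := 32
abbrev g : ℕ := 33
abbrev v : ℕ := 34
abbrev a : ℕ := 35
abbrev size : ℕ := 36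

end Cell

open RExpr (var)
open RProg (set check ifEq)

/-- The parameters are stored in the memory. -/
structure Stores (G : Grid) (M : ℕ → ℝ) : Prop where
  μ : M Cell.μ = G.μ
  ρ : M Cell.ρ = G.ρ
  R : M Cell.R = 2 * G.ρ
  D : M Cell.D = G.D
  H : M Cell.H = G.H
  U : M Cell.U = G.U
  h : M Cell.h = G.h
  W : M Cell.W = G.W

/-- The state of the guided algorithm is stored in the memory. -/
structure Holds (G : Grid) (A : GuidedState) (M : ℕ → ℝ) : Prop where
  z : M Cell.z = A.pl.y
  e : M Cell.e = A.pl.dir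
  d : M Cell.d = A.d
  y : M Cell.y = A.y
  lv : M Cell.lv = A.lv
  c : M Cell.c = A.c
  key : M Cell.key = G.enc A.w
  ok : 1 ≤ M Cell.ok ↔ A.ok

theorem Stores.of_eq {G : Grid} {M M' : ℕ → ℝ} (h : Stores G M)
    (e : ∀ a ∈ List.range 10, M' a = M a) : Stores G M' := by
  simp only [List.mem_range] at e
  constructor <;> rw [e _ (by decide)]
  exacts [h.μ, h.ρ, h.R, h.D, h.H, h.U, h.h, h.W]

/-! ### The programs -/

namespace Prog

/-- Append the grid point in the cell `g` to the word whose number is in the cell `key`. -/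
def push : RProg :=
  check Cell.ok 0 (var Cell.g + var Cell.H) ;;
  check Cell.ok (var Cell.g + var Cell.H + 1) (var Cell.U) ;;
  set Cell.key (var Cell.key * var Cell.U + (var Cell.g + var Cell.H))

/-- Choose a grid point near the position in the cell `p` by the last digit of the number in the
cell `s`. -/
def digit : RProg :=
  set Cell.c (var Cell.s / var Cell.W).floor ;;
  set Cell.g ((var Cell.p / var Cell.μ).floor + (var Cell.s - var Cell.W * var Cell.c) -
    var Cell.h) ;;
  set Cell.v (var Cell.g * var Cell.μ)

/-- The program for `Grid.take`. -/
def take : RProg :=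
  digit ;;
  check Cell.ok 0 (var Cell.d * (var Cell.v - var Cell.y)) ;;
  push ;;
  set Cell.y (var Cell.v) ;;
  set Cell.lv (var Cell.v) ;;
  set Cell.d (0 - var Cell.d)

/-- The program for `Grid.offer`, with the position in the cell `p`. -/
def offer : RProg :=
  set Cell.s (var Cell.c / 2).floor ;;
  ifEq (var Cell.c - 2 * var Cell.s) 1 take (set Cell.c (var Cell.s))

/-- The program for `Grid.follow`, with the vertex in the cell `x`. -/
def follow : RProg :=
  .ite (var Cell.d * (var Cell.x - var Cell.y)) (var Cell.D) .skip
    (set Cell.y (var Cell.x - var Cell.d * var Cell.D)) ;;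
  check Cell.ok (var Cell.d * (var Cell.y - var Cell.x)) (var Cell.D)

/-- The play operator on the input curve moves in the direction `s`. -/
def turn (s : RExpr) : RProg :=
  ifEq s (var Cell.e) .skip (set Cell.p (var Cell.z + s * var Cell.ρ) ;; offer ;; offer) ;;
  set Cell.e s ;;
  set Cell.z (var Cell.x - s * var Cell.ρ)

/-- The program for `Grid.move`, with the vertex in the cell `x`. -/
def move : RProg :=
  .ite (var Cell.x - var Cell.z) (var Cell.ρ)
    (.ite (var Cell.z - var Cell.x) (var Cell.ρ) .skip (turn (0 - 1))) (turn 1)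

/-- One step of the guided algorithm, for the vertex in the cell `x`. -/
def step : RProg := move ;; follow

/-- The start of the guided algorithm with the code in the cell `c₀`, for the first vertex in the
cells `x` and `p`. -/
def start : RProg :=
  set Cell.s (var Cell.c₀) ;;
  digit ;;
  set Cell.s (var Cell.c / 2).floor ;;
  ifEq (var Cell.c - 2 * var Cell.s) 1 (set Cell.d 1) (set Cell.d (0 - 1)) ;;
  set Cell.c (var Cell.s) ;;
  set Cell.z (var Cell.x) ;;
  set Cell.e 0 ;;
  set Cell.y (var Cell.v) ;;
  set Cell.lv (var Cell.v) ;;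
  set Cell.key 1 ;;
  set Cell.ok 1 ;;
  push

/-- The program for `Grid.init`, with the vertex in the cell `x`. -/
def init : RProg := set Cell.p (var Cell.x) ;; start ;; offer ;; offer

/-- Append the rounded position of the play operator on the query curve to its word. -/
def round : RProg := set Cell.g (var Cell.y / var Cell.μ).floor ;; push

/-- The play operator on the query curve moves in the direction `s`, opposite to `s'`. -/
def queryTurn (s s' : RExpr) : RProg :=
  ifEq (var Cell.e) s' round .skip ;;
  set Cell.e s ;;
  set Cell.y (var Cell.x - s * var Cell.R)

/-- A step of the play operator on the query curve, for the vertex in the cell `x`. -/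
def queryStep : RProg :=
  .ite (var Cell.x - var Cell.y) (var Cell.R)
    (.ite (var Cell.y - var Cell.x) (var Cell.R) .skip (queryTurn (0 - 1) 1))
    (queryTurn 1 (0 - 1))

/-- Start the play operator at the first vertex of the query curve. -/
def queryInit : RProg :=
  set Cell.x (.input 0) ;;
  set Cell.y (var Cell.x) ;;
  set Cell.e 0 ;;
  set Cell.key 1 ;;
  set Cell.ok 1 ;;
  round ;;
  set Cell.j 1

/-- Append the last position of the play operator, unless it has never moved. -/
def queryFinal : RProg := ifEq (var Cell.e) 0 .skip round

end Prog

theorem one_le_ite_zero {p : Prop} [Decidable p] {a : ℝ} : 1 ≤ (if p then a else 0) ↔ p ∧ 1 ≤ a := by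
  split_ifs with h <;> simp [h]

theorem floor_natCast_div (a b : ℕ) : ((⌊(a : ℝ) / b⌋ : ℤ) : ℝ) = ((a / b : ℕ) : ℝ) := by
  rw [← Nat.floor_div_eq_div (K := ℝ), natCast_floor_eq_intCast_floor (by positivity)]

theorem cast_sub_mul_div (a b : ℕ) : (a : ℝ) - b * ((a / b : ℕ) : ℝ) = ((a % b : ℕ) : ℝ) := by
  have := Nat.div_add_mod a b
  have : (b : ℝ) * ((a / b : ℕ) : ℝ) + ((a % b : ℕ) : ℝ) = a := by exact_mod_cast this
  linarith

theorem intCast_inRange {G : Grid} {z : ℤ} : ((0 : ℝ) ≤ z + G.H ∧ (z : ℝ) + G.H + 1 ≤ G.U) ↔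
    G.InRange z := by
  unfold Grid.InRange
  have e1 : ((0 : ℝ) ≤ z + G.H) ↔ 0 ≤ z + G.H := by exact_mod_cast Iff.rfl
  have e2 : ((z : ℝ) + G.H + 1 ≤ G.U) ↔ z + G.H + 1 ≤ G.U := by exact_mod_cast Iff.rfl
  rw [e1, e2, Int.add_one_le_iff]

theorem floor_natCast_div_two (a : ℕ) : ((⌊(a : ℝ) / 2⌋ : ℤ) : ℝ) = ((a / 2 : ℕ) : ℝ) := by
  exact_mod_cast floor_natCast_div a 2

theorem cast_sub_two_mul (a : ℕ) : (a : ℝ) - 2 * ((a / 2 : ℕ) : ℝ) = ((a % 2 : ℕ) : ℝ) := by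
  exact_mod_cast cast_sub_mul_div a 2

theorem lf_digit {G : Grid} {p : ℝ} {c : ℕ} (x : ℕ → ℝ) {M : ℕ → ℝ} (hG : Stores G M)
    (hp : M Cell.p = p) (hs : M Cell.s = c) :
    Prog.digit.lf x M = Function.update (Function.update (Function.update M Cell.c
        ((c / G.W : ℕ) : ℝ)) Cell.g (G.digit p c)) Cell.v (G.val (G.digit p c)) := by
  have hv : (((⌊p / G.μ⌋ : ℤ) : ℝ) + ((c % G.W : ℕ) : ℝ) - G.h) = (G.digit p c : ℝ) := by
    rw [Grid.digit, Int.cast_sub, Int.cast_add, Int.cast_natCast]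
  simp [Prog.digit, hs, hG.W, hG.μ, hG.h, hp, floor_natCast_div, cast_sub_mul_div, hv,
    Grid.val, -Nat.cast_ofNat]

theorem Stores.lf {G : Grid} {M : ℕ → ℝ} (h : Stores G M) (x : ℕ → ℝ) {p : RProg}
    (hs : p.isStatic Cell.size = true) (hw : (p.writes.all fun a => decide (10 ≤ a)) = true) :
    Stores G (p.lf x M) :=
  h.of_eq fun a ha => p.lf_eq_of_notMem x M hs fun hm => by
    have := List.all_eq_true.1 hw a hm
    simp only [List.mem_range, decide_eq_true_eq] at ha this
    omega

/-- The effect of `push`: the word is extended, and its new digit is checked. -/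
theorem lf_push {G : Grid} {z : ℤ} {w : List ℤ} (x : ℕ → ℝ) {M : ℕ → ℝ} (hG : Stores G M)
    (hz : M Cell.g = z) (hw : M Cell.key = G.enc w) :
    Prog.push.lf x M Cell.key = G.enc (z :: w) ∧
      (1 ≤ Prog.push.lf x M Cell.ok ↔ 1 ≤ M Cell.ok ∧ G.InRange z) ∧
      ∀ a, a ≠ Cell.key → a ≠ Cell.ok → Prog.push.lf x M a = M a := by
  refine ⟨?_, ?_, fun a h1 h2 => ?_⟩
  · simp [Prog.push, hG.H, hG.U, hz, hw, Grid.enc]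
  · rw [← intCast_inRange]
    simp [Prog.push, hG.H, hG.U, hz, one_le_ite_zero]
    tauto
  · simp [Prog.push, h1, h2]

theorem holds_take {G : Grid} {A : GuidedState} {p : ℝ} (x : ℕ → ℝ) {M : ℕ → ℝ}
    (hG : Stores G M) (hA : Holds G A M) (hp : M Cell.p = p)
    (hs : M Cell.s = ((A.c / 2 : ℕ) : ℝ)) : Holds G (G.take p A) (Prog.take.lf x M) := by
  obtain ⟨M1, hM1⟩ : ∃ M1, M1 = Prog.digit.lf x M := ⟨_, rfl⟩
  have hG1 : Stores G M1 := hM1 ▸ hG.lf x (by decide) (by decide)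
  rw [lf_digit x hG hp hs] at hM1
  obtain ⟨M2, hM2⟩ : ∃ M2, M2 = (check Cell.ok 0 (var Cell.d * (var Cell.v - var Cell.y))).lf x M1 :=
    ⟨_, rfl⟩
  have hG2 : Stores G M2 := hM2 ▸ hG1.lf x (by decide) (by decide)
  obtain ⟨e1, e2, e3⟩ := lf_push x hG2 (z := G.digit p (A.c / 2)) (w := A.w)
    (by simp [hM2, hM1]) (by simp [hM2, hM1, hA.key])
  rw [Prog.take, lf_seq, lf_digit x hG hp hs, ← hM1, lf_seq, ← hM2]
  constructor <;> simp [e1, e2, e3, Grid.take]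
  · simp [hM2, hM1, hA.z]
  · simp [hM2, hM1, hA.e]
  · simp [hM2, hM1, hA.d]
  · simp [hM2, hM1]
  · simp [hM2, hM1]
  · simp [hM2, hM1]
  · simp [hM2, hM1, hA.d, hA.y, ← hA.ok, one_le_ite_zero]
    tauto

theorem holds_offer {G : Grid} {A : GuidedState} {p : ℝ} (x : ℕ → ℝ) {M : ℕ → ℝ}
    (hG : Stores G M) (hA : Holds G A M) (hp : M Cell.p = p) :
    Holds G (G.offer p A) (Prog.offer.lf x M) := by
  obtain ⟨M1, hM1⟩ : ∃ M1, M1 = Function.update M Cell.s ((A.c / 2 : ℕ) : ℝ) := ⟨_, rfl⟩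
  have e : Prog.offer.lf x M = if ((A.c % 2 : ℕ) : ℝ) = 1 then Prog.take.lf x M1 else
      Function.update M1 Cell.c ((A.c / 2 : ℕ) : ℝ) := by
    simp [Prog.offer, hA.c, floor_natCast_div_two, hM1, cast_sub_two_mul, -Nat.cast_ofNat]
  have hG1 : Stores G M1 := by
    refine hG.of_eq fun a ha => ?_
    rw [hM1, Function.update_of_ne]
    rintro rfl
    exact absurd ha (by decide)
  rw [e]
  unfold Grid.offer
  simp only [Nat.cast_eq_one]
  split_ifs with h
  · refine holds_take x hG1 ?_ (by simp [hM1, hp]) (by simp [hM1])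
    constructor <;> simp [hM1, hA.z, hA.e, hA.d, hA.y, hA.lv, hA.c, hA.key, hA.ok]
  · constructor <;> simp [hM1, hA.z, hA.e, hA.d, hA.y, hA.lv, hA.key, hA.ok]

theorem Stores.update {G : Grid} {M : ℕ → ℝ} (h : Stores G M) {a : ℕ} (ha : 10 ≤ a) (v : ℝ) :
    Stores G (Function.update M a v) :=
  h.of_eq fun b hb => Function.update_of_ne (by rw [List.mem_range] at hb; omega) _ _

theorem holds_offer_offer {G : Grid} {A : GuidedState} {p : ℝ} (x : ℕ → ℝ) {M : ℕ → ℝ}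
    (hG : Stores G M) (hA : Holds G A M) (hp : M Cell.p = p) :
    Holds G (G.offer p (G.offer p A)) ((Prog.offer ;; Prog.offer).lf x M) := by
  refine holds_offer x (hG.lf x (by decide) (by decide)) (holds_offer x hG hA hp) ?_
  rw [Prog.offer.lf_eq_of_notMem (K := Cell.size) x M (by decide) (by decide), hp]

theorem holds_follow {G : Grid} {A : GuidedState} {a : ℝ} (x : ℕ → ℝ) {M : ℕ → ℝ}
    (hG : Stores G M) (hA : Holds G A M) (ha : M Cell.x = a) :
    Holds G (G.follow a A) (Prog.follow.lf x M) := by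
  have e : Prog.follow.lf x M = (check Cell.ok (var Cell.d * (var Cell.y - var Cell.x))
      (var Cell.D)).lf x (Function.update M Cell.y (G.followPos a A)) := by
    unfold Grid.followPos
    simp only [Prog.follow, lf_seq]
    congr 1
    simp only [lf_ite, eval_mul, eval_sub, eval_var, hA.d, hA.y, ha, hG.D, lf_skip, lf_set]
    by_cases h1 : A.d * (a - A.y) ≤ G.D
    · rw [if_pos h1, if_neg (not_lt.2 h1), ← hA.y, Function.update_eq_self]
    · rw [if_neg h1, if_pos (not_le.1 h1)]
  rw [e]
  constructor <;>
    simp [Grid.follow, hA.z, hA.e, hA.d, hA.lv, hA.c, hA.key, ← hA.ok, hG.D, ha,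
      one_le_ite_zero, and_comm]

theorem holds_turn {G : Grid} {A : GuidedState} {a s : ℝ} (x : ℕ → ℝ) {M : ℕ → ℝ}
    (hG : Stores G M) (hA : Holds G A M) (ha : M Cell.x = a) {e : RExpr}
    (he : ∀ M, e.eval x M = s) {S : PlayState} (hd : S.dir = s) (hy : S.y = a - s * G.ρ) :
    Holds G (if S.dir = A.pl.dir then { A with pl := S }
      else { G.offer (A.pl.y + S.dir * G.ρ) (G.offer (A.pl.y + S.dir * G.ρ) A) with pl := S })
      ((Prog.turn e).lf x M) := by
  have key : ∀ (B : GuidedState) (M1 : ℕ → ℝ), Holds G B M1 → M1 Cell.x = a → M1 Cell.ρ = G.ρ →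
      Holds G { B with pl := S }
        ((set Cell.e e ;; set Cell.z (var Cell.x - e * var Cell.ρ)).lf x M1) := by
    intro B M1 hB h1 h2
    constructor <;>
      simp [he, h1, h2, hd, hy, hB.d, hB.y, hB.lv, hB.c, hB.key, hB.ok]
  rw [Prog.turn, lf_seq, lf_ifEq, he, eval_var, hA.e, hd]
  split_ifs with h
  · exact key _ _ hA ha hG.ρ
  · have e1 : (set Cell.p (var Cell.z + e * var Cell.ρ)).lf x M =
        Function.update M Cell.p (A.pl.y + s * G.ρ) := by simp [he, hA.z, hG.ρ]
    rw [lf_seq x M (set Cell.p _), e1]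
    have hG1 := hG.update (a := Cell.p) (by decide) (A.pl.y + s * G.ρ)
    refine key _ _ (holds_offer_offer x hG1 ?_ (Function.update_self _ _ _)) ?_ ?_
    · constructor <;>
        simp [hA.z, hA.e, hA.d, hA.y, hA.lv, hA.c, hA.key, hA.ok]
    · rw [(Prog.offer ;; Prog.offer).lf_eq_of_notMem (K := Cell.size) x _ (by decide) (by decide)]
      simp [ha]
    · exact (hG1.lf x (p := Prog.offer ;; Prog.offer) (by decide) (by decide)).ρ

theorem holds_move {G : Grid} (hρ : 0 ≤ G.ρ) {A : GuidedState} {a : ℝ} (x : ℕ → ℝ) {M : ℕ → ℝ}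
    (hG : Stores G M) (hA : Holds G A M) (ha : M Cell.x = a) :
    Holds G (G.move a A) (Prog.move.lf x M) := by
  simp only [Prog.move, lf_ite, eval_sub, eval_var, ha, hA.z, hG.ρ, lf_skip]
  unfold Grid.move
  by_cases h1 : a - A.pl.y ≤ G.ρ
  · rw [if_pos h1]
    by_cases h2 : A.pl.y - a ≤ G.ρ
    · rw [if_pos h2, playStep_of_near (by rw [abs_le]; constructor <;> linarith), if_pos rfl]
      exact hA
    · rw [if_neg h2]
      have e := playStep_down hρ (not_le.1 h2)
      exact holds_turn x hG hA ha (s := -1) (by simp) (by rw [e]) (by rw [e]; simp)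
  · rw [if_neg h1]
    have e := playStep_up (not_le.1 h1)
    exact holds_turn x hG hA ha (s := 1) (by simp) (by rw [e]) (by rw [e]; simp)

theorem holds_step {G : Grid} (hρ : 0 ≤ G.ρ) {A : GuidedState} {a : ℝ} (x : ℕ → ℝ) {M : ℕ → ℝ}
    (hG : Stores G M) (hA : Holds G A M) (ha : M Cell.x = a) :
    Holds G (G.step A a) (Prog.step.lf x M) := by
  refine holds_follow x (hG.lf x (by decide) (by decide)) (holds_move hρ x hG hA ha) ?_
  rw [Prog.move.lf_eq_of_notMem (K := Cell.size) x M (by decide) (by decide), ha]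

theorem holds_start {G : Grid} {c : ℕ} {a : ℝ} (x : ℕ → ℝ) {M : ℕ → ℝ}
    (hG : Stores G M) (hc : M Cell.c₀ = c) (ha : M Cell.x = a) (hp : M Cell.p = a) :
    Holds G (G.start c a) (Prog.start.lf x M) := by
  obtain ⟨M1, hM1⟩ : ∃ M1, M1 = Function.update M Cell.s c := ⟨_, rfl⟩
  have hG1 : Stores G M1 := hM1 ▸ hG.update (by decide) _
  obtain ⟨M2, hM2⟩ : ∃ M2, M2 = Prog.digit.lf x M1 := ⟨_, rfl⟩
  have hG2 : Stores G M2 := hM2 ▸ hG1.lf x (by decide) (by decide)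
  rw [lf_digit x hG1 (p := a) (c := c) (by simp [hM1, hp]) (by simp [hM1])] at hM2
  have m1 : M2 Cell.c = (c / G.W : ℕ) := by simp [hM2]
  have m2 : M2 Cell.g = G.digit a c := by simp [hM2]
  have m3 : M2 Cell.v = G.val (G.digit a c) := by simp [hM2]
  have m4 : M2 Cell.x = a := by simp [hM2, hM1, ha]
  obtain ⟨M3, hM3⟩ : ∃ M3, M3 = Function.update (Function.update (Function.update
      (Function.update (Function.update (Function.update (Function.update (Function.update
      (Function.update M2 Cell.s ((c / G.W / 2 : ℕ) : ℝ)) Cell.d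
      (if c / G.W % 2 = 1 then 1 else -1)) Cell.c ((c / G.W / 2 : ℕ) : ℝ)) Cell.z a)
      Cell.e 0) Cell.y (G.val (G.digit a c))) Cell.lv (G.val (G.digit a c))) Cell.key 1)
      Cell.ok 1 := ⟨_, rfl⟩
  have hG3 : Stores G M3 := by
    rw [hM3]
    iterate 9 refine Stores.update ?_ (by decide) _
    exact hG2
  have e : Prog.start.lf x M = Prog.push.lf x M3 := by
    have h0 : (set Cell.s (var Cell.c₀)).lf x M = M1 := by simp [hM1, hc]
    have h1 : Prog.digit.lf x M1 = M2 := by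
      rw [lf_digit x hG1 (p := a) (c := c) (by simp [hM1, hp]) (by simp [hM1]), hM2]
    rw [Prog.start, lf_seq, h0, lf_seq, h1, lf_seq, lf_seq, lf_set, lf_ifEq, lf_set, lf_set]
    simp only [eval_sub, eval_mul, eval_var, eval_floor, eval_div, eval_ofNat, eval_one, eval_zero,
      m1, floor_natCast_div_two, Function.update_self]
    rw [Function.update_of_ne (by decide), m1, cast_sub_two_mul]
    simp only [Nat.cast_eq_one]
    rw [hM3]
    split_ifs <;> simp [m3, m4]
  obtain ⟨e1, e2, e3⟩ := lf_push x hG3 (z := G.digit a c) (w := [])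
    (by simp [hM3, m2]) (by simp [hM3, Grid.enc])
  rw [e]
  constructor <;> simp [e1, e2, e3, Grid.start] <;> simp [hM3, playInit]

theorem holds_init {G : Grid} {c : ℕ} {a : ℝ} (x : ℕ → ℝ) {M : ℕ → ℝ}
    (hG : Stores G M) (hc : M Cell.c₀ = c) (ha : M Cell.x = a) :
    Holds G (G.init c a) (Prog.init.lf x M) := by
  have hG1 : Stores G (Function.update M Cell.p a) := hG.update (by decide) a
  have e : Prog.init.lf x M = (Prog.offer ;; Prog.offer).lf x
      (Prog.start.lf x (Function.update M Cell.p a)) := by simp [Prog.init, ha]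
  rw [e]
  refine holds_offer_offer x (hG1.lf x (by decide) (by decide))
    (holds_start x hG1 (by simp [hc]) (by simp [ha]) (by simp)) ?_
  rw [Prog.start.lf_eq_of_notMem (K := Cell.size) x _ (by decide) (by decide),
    Function.update_self]

/-- The state of the play operator on the query curve is stored in the memory. -/
structure QueryHolds (G : Grid) (S : PlayState) (M : ℕ → ℝ) : Prop where
  y : M Cell.y = S.y
  e : M Cell.e = S.dir
  key : M Cell.key = G.enc (S.out.map G.rd)
  ok : 1 ≤ M Cell.ok ↔ ∀ z ∈ S.out.map G.rd, G.InRange z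

theorem lf_round {G : Grid} {u : ℝ} {w : List ℤ} (x : ℕ → ℝ) {M : ℕ → ℝ} (hG : Stores G M)
    (hu : M Cell.y = u) (hw : M Cell.key = G.enc w) :
    Prog.round.lf x M Cell.key = G.enc (G.rd u :: w) ∧
      (1 ≤ Prog.round.lf x M Cell.ok ↔ 1 ≤ M Cell.ok ∧ G.InRange (G.rd u)) ∧
      ∀ a, a ≠ Cell.key → a ≠ Cell.ok → a ≠ Cell.g → Prog.round.lf x M a = M a := by
  have e : Prog.round.lf x M = Prog.push.lf x (Function.update M Cell.g (G.rd u)) := by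
    simp [Prog.round, hu, hG.μ, Grid.rd]
  obtain ⟨h1, h2, h3⟩ := lf_push x (hG.update (a := Cell.g) (by decide) (G.rd u)) (z := G.rd u)
    (w := w) (Function.update_self _ _ _) (by simp [hw])
  rw [e]
  refine ⟨h1, by rw [h2]; simp, fun a a1 a2 a3 => ?_⟩
  rw [h3 a a1 a2, Function.update_of_ne a3]

theorem queryHolds_turn {G : Grid} {S : PlayState} {a s : ℝ} (x : ℕ → ℝ) {M : ℕ → ℝ}
    (hG : Stores G M) (hS : QueryHolds G S M) (ha : M Cell.x = a) {e e' : RExpr}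
    (he : ∀ M, e.eval x M = s) (he' : ∀ M, e'.eval x M = -s) :
    QueryHolds G ⟨s, a - s * (2 * G.ρ), if S.dir = -s then S.y :: S.out else S.out⟩
      ((Prog.queryTurn e e').lf x M) := by
  rw [Prog.queryTurn, lf_seq, lf_ifEq, he', eval_var, hS.e]
  split_ifs with h
  · obtain ⟨h1, h2, h3⟩ := lf_round x hG hS.y hS.key
    constructor <;> simp [he, h1, h2, h3, hS.ok, ha, hG.R]
    tauto
  · constructor <;> simp [he, hS.ok, hS.key, ha, hG.R]

theorem queryHolds_step {G : Grid} (hρ : 0 ≤ G.ρ) {S : PlayState} {a : ℝ} (x : ℕ → ℝ) {M : ℕ → ℝ}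
    (hG : Stores G M) (hS : QueryHolds G S M) (ha : M Cell.x = a) :
    QueryHolds G (playStep (2 * G.ρ) S a) (Prog.queryStep.lf x M) := by
  simp only [Prog.queryStep, lf_ite, eval_sub, eval_var, ha, hS.y, hG.R, lf_skip]
  by_cases h1 : a - S.y ≤ 2 * G.ρ
  · rw [if_pos h1]
    by_cases h2 : S.y - a ≤ 2 * G.ρ
    · rw [if_pos h2, playStep_of_near (by rw [abs_le]; constructor <;> linarith)]
      exact hS
    · rw [if_neg h2]
      rw [playStep_down (by linarith) (not_le.1 h2)]
      have := queryHolds_turn x hG hS ha (e := 0 - 1) (e' := 1) (s := -1) (by simp) (by simp)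
      simpa using this
  · rw [if_neg h1, playStep_up (not_le.1 h1)]
    have := queryHolds_turn x hG hS ha (e := 1) (e' := 0 - 1) (s := 1) (by simp) (by simp)
    simpa using this

theorem queryHolds_init {G : Grid} (x : ℕ → ℝ) {M : ℕ → ℝ} (hG : Stores G M) :
    QueryHolds G (playInit 0 (x 0)) (Prog.queryInit.lf x M) ∧
      Prog.queryInit.lf x M Cell.j = 1 := by
  have e : Prog.queryInit.lf x M = Function.update (Prog.round.lf x (Function.update
      (Function.update (Function.update (Function.update (Function.update M Cell.x (x 0))
        Cell.y (x 0)) Cell.e 0) Cell.key 1) Cell.ok 1)) Cell.j 1 := by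
    simp [Prog.queryInit]
  obtain ⟨h1, h2, h3⟩ := lf_round (G := G) (u := x 0) (w := []) x (M := Function.update
      (Function.update (Function.update (Function.update (Function.update M Cell.x (x 0))
        Cell.y (x 0)) Cell.e 0) Cell.key 1) Cell.ok 1) (by
      iterate 5 refine Stores.update ?_ (by decide) _
      exact hG) (by simp) (by simp [Grid.enc])
  rw [e]
  refine ⟨?_, by simp⟩
  constructor <;> simp [h1, h2, h3, playInit]

theorem queryFinal_spec {G : Grid} {S : PlayState} (x : ℕ → ℝ) {M : ℕ → ℝ}
    (hG : Stores G M) (hS : QueryHolds G S M) :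
    Prog.queryFinal.lf x M Cell.key = G.enc (S.final.map G.rd) ∧
      (1 ≤ Prog.queryFinal.lf x M Cell.ok ↔ ∀ z ∈ S.final.map G.rd, G.InRange z) := by
  rw [Prog.queryFinal, lf_ifEq, eval_var, eval_zero, hS.e, PlayState.final]
  split_ifs with h
  · exact ⟨hS.key, hS.ok⟩
  · obtain ⟨h1, h2, h3⟩ := lf_round x hG hS.y hS.key
    refine ⟨h1, ?_⟩
    rw [h2, hS.ok]
    simp only [List.map_cons, List.mem_cons, forall_eq_or_imp]
    tauto

/-! ### The dictionary in the memory -/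

/-- The keys of `L` are distinct numbers between `0` and `K`, its values lie between `0` and `n`,
and the base `B` is large enough for `N` entries. -/
structure Dict.Valid (B K n : ℤ) (N : ℕ) (L : List (ℤ × ℤ)) : Prop where
  nodup : (L.map Prod.fst).Nodup
  mem : ∀ p ∈ L, 0 ≤ p.1 ∧ p.1 ≤ K ∧ 0 ≤ p.2 ∧ p.2 ≤ n
  length_le : L.length ≤ N
  K_nonneg : 0 ≤ K
  one_le : 1 ≤ n
  lt_base : K + n * (2 * (K + 1) ^ 2) ^ N < B

/-- The remainder of `u` modulo `v`, by floor arithmetic. -/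
def rem (u v : ℝ) : ℝ := u - v * (⌊u / v⌋ : ℤ)

theorem rem_intCast (u : ℤ) {v : ℤ} (hv : 0 < v) : rem (u : ℝ) (v : ℝ) = ((u % v : ℤ) : ℝ) :=
  sub_mul_floor_div u hv

theorem Dict.Valid.lookup {B K n : ℤ} {N : ℕ} {L : List (ℤ × ℤ)} (h : Dict.Valid B K n N L) {a : ℤ}
    (ha : 0 ≤ a) (haK : a ≤ K) :
    (rem (Dict.F L B) ((B : ℝ) - a) = 0 ↔ a ∈ L.map Prod.fst) ∧
      ∀ v, (a, v) ∈ L → rem (Dict.P L B) ((B : ℝ) - a) / rem (Dict.Q L B) ((B : ℝ) - a) = v := by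
  have hB : 0 < B - a := by
    have h1 := h.lt_base
    have h2 : 0 ≤ n * (2 * (K + 1) ^ 2) ^ N := mul_nonneg (by linarith [h.one_le]) (by positivity)
    linarith
  obtain ⟨e1, e2, e3⟩ := Dict.emod_eq h.K_nonneg h.one_le h.mem ha haK h.length_le h.lt_base
  rw [← Int.cast_sub, rem_intCast _ hB, rem_intCast _ hB, rem_intCast _ hB, e1, e2, e3]
  refine ⟨by rw [Int.cast_eq_zero, Dict.F_eq_zero], fun v hv => ?_⟩
  obtain ⟨h1, h2⟩ := Dict.Q_pos_and_P_eq h.nodup hv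
  have h3 : ((Dict.Q L a : ℤ) : ℝ) ≠ 0 := by exact_mod_cast h1.ne'
  rw [h2, Int.cast_mul, mul_div_cancel_right₀ _ h3]

/-- The dictionary `L` is stored in the memory. -/
structure DictHolds (B : ℤ) (L : List (ℤ × ℤ)) (M : ℕ → ℝ) : Prop where
  B_eq : M Cell.B = B
  F_eq : M Cell.F = Dict.F L B
  P_eq : M Cell.P = Dict.P L B
  Q_eq : M Cell.Q = Dict.Q L B

namespace Prog

/-- The remainder modulo the number in the cell `a`. -/
def remE (e : RExpr) : RExpr := e - var Cell.a * (e / var Cell.a).floor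

/-- Add the key in the cell `key` with the value in the cell `i`, unless there is such a key. -/
def insert : RProg :=
  set Cell.a (var Cell.B - var Cell.key) ;;
  ifEq (remE (var Cell.F)) 0 .skip
    (set Cell.P (var Cell.P * (var Cell.a * var Cell.a) + var Cell.i * var Cell.F) ;;
     set Cell.Q (var Cell.Q * (var Cell.a * var Cell.a) + var Cell.F) ;;
     set Cell.F (var Cell.F * (var Cell.a * var Cell.a)))

/-- Look up the key in the cell `key`. -/
def lookup : RProg :=
  set Cell.ans (0 - 1) ;;
  .ite 1 (var Cell.ok)
    (set Cell.a (var Cell.B - var Cell.key) ;;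
     ifEq (remE (var Cell.F)) 0
       (set Cell.ans (remE (var Cell.P) / remE (var Cell.Q))) .skip) .skip

/-- Run the play operator of radius `2ρ` on the query curve, and look up its rounded path. -/
def query : RProg :=
  queryInit ;;
  .loop (var Cell.j + 1) (var Cell.k)
    (set Cell.x (.input (var Cell.j)) ;; queryStep ;; set Cell.j (var Cell.j + 1)) ;;
  queryFinal ;;
  lookup

end Prog

theorem eval_remE (x M : ℕ → ℝ) (e : RExpr) :
    (Prog.remE e).eval x M = rem (e.eval x M) (M Cell.a) := by
  simp [Prog.remE, rem]

theorem dictHolds_insert {B : ℤ} {L : List (ℤ × ℤ)} (x : ℕ → ℝ) {M : ℕ → ℝ}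
    (hM : DictHolds B L M) {a i : ℤ} (ha : M Cell.key = a) (hi : M Cell.i = i) :
    DictHolds B (if rem (Dict.F L B) ((B : ℝ) - a) = 0 then L else (a, i) :: L)
      (Prog.insert.lf x M) := by
  rw [Prog.insert, lf_seq, lf_set, lf_ifEq, eval_remE]
  have e : rem ((var Cell.F).eval x (Function.update M Cell.a ((var Cell.B - var Cell.key).eval x M)))
      (Function.update M Cell.a ((var Cell.B - var Cell.key).eval x M) Cell.a) =
      rem (Dict.F L B) ((B : ℝ) - a) := by
    simp [hM.F_eq, hM.B_eq, ha]
  rw [e, eval_zero]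
  split_ifs with h
  · constructor <;> simp [hM.B_eq, hM.F_eq, hM.P_eq, hM.Q_eq]
  · constructor <;> simp [hM.B_eq, hM.F_eq, hM.P_eq, hM.Q_eq, ha, hi, Dict.F, Dict.P, Dict.Q, pow_two]

theorem lookup_spec {B K n : ℤ} {N : ℕ} {L : List (ℤ × ℤ)} (hL : Dict.Valid B K n N L)
    (x : ℕ → ℝ) {M : ℕ → ℝ} (hM : DictHolds B L M) {a : ℤ} (ha : M Cell.key = a)
    (hr : 1 ≤ M Cell.ok → 0 ≤ a ∧ a ≤ K) :
    (1 ≤ M Cell.ok ∧ ∃ v, (a, v) ∈ L ∧ Prog.lookup.lf x M Cell.ans = v) ∨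
      ((1 ≤ M Cell.ok → a ∉ L.map Prod.fst) ∧ Prog.lookup.lf x M Cell.ans = -1) := by
  by_cases hok : 1 ≤ M Cell.ok
  · obtain ⟨h1, h2⟩ := hL.lookup (hr hok).1 (hr hok).2
    have e : Prog.lookup.lf x M Cell.ans = if rem (Dict.F L B) ((B : ℝ) - a) = 0 then
        rem (Dict.P L B) ((B : ℝ) - a) / rem (Dict.Q L B) ((B : ℝ) - a) else -1 := by
      simp [Prog.lookup, hok, eval_remE, hM.F_eq, hM.B_eq, hM.P_eq, hM.Q_eq, ha]
      split_ifs <;> simp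
    rw [e]
    by_cases h : a ∈ L.map Prod.fst
    · left
      obtain ⟨⟨a', v⟩, hv, rfl⟩ := List.mem_map.1 h
      exact ⟨hok, v, hv, by rw [if_pos (h1.2 h), h2 v hv]⟩
    · right
      exact ⟨fun _ => h, by rw [if_neg fun h0 => h (h1.1 h0)]⟩
  · right
    exact ⟨fun h => absurd h hok, by simp [Prog.lookup, hok]⟩

/-! ### The query program -/

/-- The part of the memory that the queries use but do not change. -/
structure DataHolds (G : Grid) (k : ℕ) (B : ℤ) (L : List (ℤ × ℤ)) (M : ℕ → ℝ) : Prop where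
  stores : Stores G M
  k : M Cell.k = k
  dict : DictHolds B L M

theorem DataHolds.of_eq {G : Grid} {k : ℕ} {B : ℤ} {L : List (ℤ × ℤ)} {M M' : ℕ → ℝ}
    (h : DataHolds G k B L M) (e : ∀ a, a ≠ Cell.ans → a < Cell.max → M' a = M a) :
    DataHolds G k B L M' := by
  have hs := h.stores
  have hd := h.dict
  refine ⟨?_, by rw [e _ (by decide) (by decide), h.k], ?_⟩
  · constructor <;> rw [e _ (by decide) (by decide)]
    exacts [hs.μ, hs.ρ, hs.R, hs.D, hs.H, hs.U, hs.h, hs.W]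
  · constructor <;> rw [e _ (by decide) (by decide)]
    exacts [hd.B_eq, hd.F_eq, hd.P_eq, hd.Q_eq]

/-- A static program that writes only to cells from `K'` on does not change the other cells. -/
theorem RProg.lf_eq_of_lt {p : RProg} (x M : ℕ → ℝ) {K' : ℕ} (hs : p.isStatic Cell.size = true)
    (hw : (p.writes.all fun a => decide (K' ≤ a)) = true) {a : ℕ} (ha : a < K') :
    p.lf x M a = M a :=
  p.lf_eq_of_notMem x M hs fun hm => by
    have := List.all_eq_true.1 hw a hm
    simp only [decide_eq_true_eq] at this
    omega

theorem DataHolds.lf {G : Grid} {k : ℕ} {B : ℤ} {L : List (ℤ × ℤ)} {M : ℕ → ℝ}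
    (h : DataHolds G k B L M) (x : ℕ → ℝ) {p : RProg} (hs : p.isStatic Cell.size = true)
    (hw : (p.writes.all fun a => decide (Cell.max ≤ a)) = true) :
    DataHolds G k B L (p.lf x M) :=
  h.of_eq fun _ _ ha => p.lf_eq_of_lt x M hs hw ha

theorem cast_add_one_le_cast_iff {a b : ℕ} : (a : ℝ) + 1 ≤ b ↔ a < b := by
  exact_mod_cast Nat.succ_le_iff

/-- After the query program, the answer cell holds the result of the lookup for the rounded path
of the play operator on the query curve. -/
theorem exists_query_time : ∃ κ : ℕ, ∀ {G : Grid} {k : ℕ} {B K n : ℤ} {N : ℕ} {L : List (ℤ × ℤ)}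
    (x : ℕ → ℝ), 0 ≤ G.ρ → 1 ≤ k → Dict.Valid B K n N L →
    ∀ w, w = (playSeq (2 * G.ρ) 0 x (k - 1)).final.map G.rd →
    ((∀ z ∈ w, G.InRange z) → 0 ≤ G.enc w ∧ G.enc w ≤ K) →
    Tri x Prog.query (κ * k) (DataHolds G k B L) fun M =>
      ((∀ z ∈ w, G.InRange z) ∧ ∃ v, (G.enc w, v) ∈ L ∧ M Cell.ans = v) ∨
      (((∀ z ∈ w, G.InRange z) → G.enc w ∉ L.map Prod.fst) ∧ M Cell.ans = -1) := by
  obtain ⟨body, hbody⟩ : ∃ p, p = (set Cell.x (.input (var Cell.j)) ;; Prog.queryStep ;;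
    set Cell.j (var Cell.j + 1)) := ⟨_, rfl⟩
  obtain ⟨last, hlast⟩ : ∃ p, p = (Prog.queryFinal ;; Prog.lookup) := ⟨_, rfl⟩
  obtain ⟨g, hg⟩ : ∃ g, g = (var Cell.j + 1).cost + (var Cell.k).cost + 1 := ⟨_, rfl⟩
  refine ⟨Prog.queryInit.lfTime + (body.lfTime + g + g) + last.lfTime,
    fun {G k B K n N L} x hρ hk hL w hw hwK => ?_⟩
  have h1 : Tri x Prog.queryInit Prog.queryInit.lfTime (DataHolds G k B L) fun M =>
      DataHolds G k B L M ∧ QueryHolds G (playSeq (2 * G.ρ) 0 x 0) M ∧ M Cell.j = (0 : ℕ) + 1 := by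
    refine Tri.of_lf (by decide) fun M hM => ?_
    obtain ⟨e1, e2⟩ := queryHolds_init x hM.stores
    exact ⟨hM.lf x (by decide) (by decide), e1, by rw [e2]; simp⟩
  have h2 := Tri.loop (x := x) (p := body) (t := body.lfTime) (e := var Cell.j + 1)
    (f := var Cell.k) (k - 1) (fun t M => DataHolds G k B L M ∧
      QueryHolds G (playSeq (2 * G.ρ) 0 x t) M ∧ M Cell.j = (t : ℕ) + 1) (by
      rintro t ht M ⟨hM, -, hj⟩
      have : (var Cell.j + 1).eval x M = ((t + 1 : ℕ) : ℝ) + 1 := by simp [hj]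
      rw [this, eval_var, hM.k, cast_add_one_le_cast_iff]
      omega) (by
      rintro t ht
      refine Tri.of_lf (by rw [hbody]; decide) ?_
      rintro M ⟨hM, hS, hj⟩
      have e0 : (set Cell.x (.input (var Cell.j))).lf x M =
          Function.update M Cell.x (x (t + 1)) := by
        rw [lf_set, eval_input, eval_var, hj,
          show ((t : ℝ) + 1) = ((t + 1 : ℕ) : ℝ) by push_cast; rfl, Nat.floor_natCast]
      rw [hbody, lf_seq, lf_seq, e0]
      have hM1 : DataHolds G k B L (Function.update M Cell.x (x (t + 1))) :=
        hM.of_eq fun a _ ha => Function.update_of_ne (by rintro rfl; exact absurd ha (by decide)) _ _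
      have hS1 : QueryHolds G (playSeq (2 * G.ρ) 0 x t) (Function.update M Cell.x (x (t + 1))) := by
        constructor <;> simp [hS.y, hS.e, hS.key, hS.ok]
      have hS2 := queryHolds_step hρ x hM1.stores hS1 (Function.update_self _ _ _)
      rw [← playSeq_succ] at hS2
      have hM2 := hM1.lf x (p := Prog.queryStep) (by decide) (by decide)
      have hj2 : Prog.queryStep.lf x (Function.update M Cell.x (x (t + 1))) Cell.j = t + 1 := by
        rw [Prog.queryStep.lf_eq_of_notMem (K := Cell.size) x _ (by decide) (by decide)]
        simp [hj]
      refine ⟨hM2.lf x (p := set Cell.j (var Cell.j + 1)) (by decide) (by decide), ?_, ?_⟩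
      · constructor <;> simp [hS2.y, hS2.e, hS2.key, hS2.ok]
      · simp [hj2])
  have h3 : Tri x last last.lfTime (fun M => DataHolds G k B L M ∧
      QueryHolds G (playSeq (2 * G.ρ) 0 x (k - 1)) M ∧ M Cell.j = (k - 1 : ℕ) + 1) fun M =>
      ((∀ z ∈ w, G.InRange z) ∧ ∃ v, (G.enc w, v) ∈ L ∧ M Cell.ans = v) ∨
      (((∀ z ∈ w, G.InRange z) → G.enc w ∉ L.map Prod.fst) ∧ M Cell.ans = -1) := by
    refine Tri.of_lf (by rw [hlast]; decide) ?_
    rintro M ⟨hM, hS, -⟩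
    obtain ⟨e1, e2⟩ := queryFinal_spec x hM.stores hS
    rw [← hw] at e1 e2
    rw [hlast, lf_seq]
    have := lookup_spec hL x (hM.lf x (p := Prog.queryFinal) (by decide) (by decide)).dict e1
      fun h => hwK (e2.1 h)
    rwa [e2] at this
  have h := h1.seq (h2.seq h3)
  rw [hlast, hbody] at h
  refine h.weaken ?_ (fun _ h => h) fun _ h => h
  rw [← hbody, ← hlast, ← hg]
  obtain ⟨k, rfl⟩ : ∃ l, k = l + 1 := ⟨k - 1, by omega⟩
  rw [Nat.add_sub_cancel]
  nlinarith [Nat.zero_le (k * g), Nat.zero_le (k * last.lfTime), Nat.zero_le (k * Prog.queryInit.lfTime)]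

/-! ### Building the dictionary -/

namespace Prog

/-- The first step of the guided algorithm on the curve with the index in the cell `i`. -/
def trialInit : RProg :=
  set Cell.x (.input (5 + var Cell.i * var Cell.m)) ;; init ;; set Cell.j 1

/-- The step of the guided algorithm for the vertex with the index in the cell `j`. -/
def trialStep : RProg :=
  set Cell.x (.input (5 + var Cell.i * var Cell.m + var Cell.j)) ;;
  step ;;
  set Cell.j (var Cell.j + 1)

/-- The program for the last step of `Grid.finish`. -/
def finish : RProg := set Cell.p (var Cell.x) ;; offer

/-- If the guided algorithm accepts, the number of the grid curve is added to the dictionary. -/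
def accept : RProg :=
  .ite 1 (var Cell.ok)
    (ifEq (var Cell.y) (var Cell.lv) (.ite (var Cell.key) (var Cell.KM) insert .skip) .skip) .skip

/-- Finish a trial after the last vertex of the input curve. -/
def trialEnd : RProg := finish ;; accept

/-- Run the guided algorithm with the code in the cell `c₀` on the curve with the index in the
cell `i`. -/
def trial : RProg :=
  trialInit ;; .loop (var Cell.j + 1) (var Cell.m) trialStep ;; trialEnd

/-- Try all codes on all input curves. -/
def build : RProg :=
  .loop (var Cell.i + 1) (var Cell.n)
    (set Cell.c₀ 0 ;;
     .loop (var Cell.c₀ + 1) (var Cell.NC) (trial ;; set Cell.c₀ (var Cell.c₀ + 1)) ;;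
     set Cell.i (var Cell.i + 1))

end Prog

/-- A loop with at most `T` rounds. -/
theorem loop_time_le {N T t g : ℕ} (hN : N ≤ T) (hT : 1 ≤ T) :
    N * (t + g) + g ≤ (t + 2 * g) * T := by
  nlinarith [Nat.mul_le_mul_right (t + g) hN, Nat.mul_le_mul_left g hT]

theorem Holds.of_eq {G : Grid} {A : GuidedState} {M M' : ℕ → ℝ} (h : Holds G A M)
    (e : ∀ a, 23 ≤ a → a < 31 → M' a = M a) : Holds G A M' := by
  constructor <;> rw [e _ (by decide) (by decide)]
  exacts [h.z, h.e, h.d, h.y, h.lv, h.c, h.key, h.ok]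

/-- The dictionary after the trial of the code `c` on the curve `l` with the index `i`. -/
def addTrial (G : Grid) (B K : ℤ) (c : ℕ) (l : List ℝ) (i : ℕ) (L : List (ℤ × ℤ)) :
    List (ℤ × ℤ) :=
  open Classical in
  if G.Accepts c l ∧ G.enc (G.finish c l).w ≤ K ∧
    rem (Dict.F L B) ((B : ℝ) - G.enc (G.finish c l).w) ≠ 0 then
  (G.enc (G.finish c l).w, (i : ℤ)) :: L else L

/-- A trial takes time linear in the complexity of the input curve. -/
theorem exists_trial_time : ∃ κ : ℕ, ∀ {G : Grid} {m i c : ℕ} {B K : ℤ} {L : List (ℤ × ℤ)}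
    (x : ℕ → ℝ) (M₀ : ℕ → ℝ), 0 ≤ G.ρ → 1 ≤ m → Stores G M₀ → M₀ Cell.m = m → M₀ Cell.i = i →
    M₀ Cell.c₀ = c → M₀ Cell.KM = K → DictHolds B L M₀ →
    Tri x Prog.trial (κ * m) (fun M => M = M₀) fun M =>
      (∀ a, a < 21 → a ≠ Cell.F → a ≠ Cell.P → a ≠ Cell.Q → M a = M₀ a) ∧
      DictHolds B (addTrial G B K c (pre (fun t => x (5 + i * m + t)) (m - 1)) i L) M := by
  obtain ⟨g, hg⟩ : ∃ g, g = (var Cell.j + 1).cost + (var Cell.m).cost + 1 := ⟨_, rfl⟩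
  refine ⟨Prog.trialInit.lfTime + (Prog.trialStep.lfTime + g + g) + Prog.trialEnd.lfTime,
    fun {G m i c B K L} x M₀ hρ hm hG hMm hMi hMc hMK hL => ?_⟩
  set f : ℕ → ℝ := fun t => x (5 + i * m + t) with hf
  have stores : ∀ M : ℕ → ℝ, (∀ a < 21, M a = M₀ a) → Stores G M := fun M hM =>
    hG.of_eq fun a ha => hM a (by rw [List.mem_range] at ha; omega)
  have h1 : Tri x Prog.trialInit Prog.trialInit.lfTime (fun M => M = M₀) fun M =>
      (∀ a < 21, M a = M₀ a) ∧ Holds G (G.result c (pre f 0)) M ∧ M Cell.x = f 0 ∧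
        M Cell.j = (0 : ℕ) + 1 := by
    refine Tri.of_lf (by decide) ?_
    rintro M rfl
    have e0 : (set Cell.x (.input (5 + var Cell.i * var Cell.m))).lf x M =
        Function.update M Cell.x (f 0) := by
      rw [lf_set, eval_input, eval_add, eval_mul, eval_var, eval_var, eval_ofNat, hMi, hMm,
        show ((5 : ℝ) + i * m) = ((5 + i * m : ℕ) : ℝ) by push_cast; rfl, Nat.floor_natCast]
      rfl
    have h0 := holds_init x (hG.update (a := Cell.x) (by decide) (f 0)) (c := c) (a := f 0)
      (by simp [hMc]) (by simp)
    refine ⟨fun a ha => Prog.trialInit.lf_eq_of_lt x M (by decide) (by decide) ha, ?_, ?_, ?_⟩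
    · rw [Prog.trialInit, lf_seq, lf_seq, e0]
      refine h0.of_eq fun a a1 a2 => ?_
      rw [lf_set, Function.update_of_ne (by simp only [Cell.j]; omega)]
    · rw [Prog.trialInit, lf_seq, lf_seq, e0, lf_set, Function.update_of_ne (by decide),
        Prog.init.lf_eq_of_notMem (K := Cell.size) x _ (by decide) (by decide),
        Function.update_self]
    · rw [Prog.trialInit, lf_seq, lf_seq, lf_set, Function.update_self]; simp
  have h2 := Tri.loop (x := x) (p := Prog.trialStep) (t := Prog.trialStep.lfTime)
    (e := var Cell.j + 1) (f := var Cell.m) (m - 1) (fun t M => (∀ a < 21, M a = M₀ a) ∧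
      Holds G (G.result c (pre f t)) M ∧ M Cell.x = f t ∧ M Cell.j = (t : ℕ) + 1) (by
      rintro t ht M ⟨hM, -, -, hj⟩
      have : (var Cell.j + 1).eval x M = ((t + 1 : ℕ) : ℝ) + 1 := by simp [hj]
      rw [this, eval_var, hM _ (by decide), hMm, cast_add_one_le_cast_iff]
      omega) (by
      rintro t ht
      refine Tri.of_lf (by decide) ?_
      rintro M ⟨hM, hA, -, hj⟩
      have e0 : (set Cell.x (.input (5 + var Cell.i * var Cell.m + var Cell.j))).lf x M =
          Function.update M Cell.x (f (t + 1)) := by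
        rw [lf_set, eval_input, eval_add, eval_add, eval_mul, eval_var, eval_var, eval_var,
          eval_ofNat, hM _ (by decide), hM _ (by decide), hMi, hMm, hj,
          show ((5 : ℝ) + i * m + (t + 1)) = ((5 + i * m + (t + 1) : ℕ) : ℝ) by push_cast; rfl,
          Nat.floor_natCast]
      have hA1 : Holds G (G.result c (pre f t)) (Function.update M Cell.x (f (t + 1))) :=
        hA.of_eq fun a a1 a2 => Function.update_of_ne (by simp only [Cell.x]; omega) _ _
      have hA2 := holds_step hρ x ((stores M hM).update (a := Cell.x) (by decide) (f (t + 1))) hA1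
        (Function.update_self _ _ _)
      refine ⟨fun a ha => ?_, ?_, ?_, ?_⟩
      · rw [Prog.trialStep.lf_eq_of_lt x M (by decide) (by decide) ha, hM a ha]
      · rw [Prog.trialStep, lf_seq, lf_seq, e0]
        have e : G.result c (pre f (t + 1)) = G.step (G.result c (pre f t)) (f (t + 1)) :=
          Grid.result_cons c _ (pre_ne_nil f t)
        rw [e]
        refine hA2.of_eq fun a a1 a2 => ?_
        rw [lf_set, Function.update_of_ne (by simp only [Cell.j]; omega)]
      · rw [Prog.trialStep, lf_seq, lf_seq, e0, lf_set, Function.update_of_ne (by decide),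
          Prog.step.lf_eq_of_notMem (K := Cell.size) x _ (by decide) (by decide),
          Function.update_self]
      · rw [Prog.trialStep, lf_seq, lf_seq, e0, lf_set, Function.update_self, eval_add, eval_var,
          Prog.step.lf_eq_of_notMem (K := Cell.size) x _ (by decide) (by decide)]
        simp [hj])
  have h3 : Tri x Prog.trialEnd Prog.trialEnd.lfTime (fun M => (∀ a < 21, M a = M₀ a) ∧
      Holds G (G.result c (pre f (m - 1))) M ∧ M Cell.x = f (m - 1) ∧
        M Cell.j = (m - 1 : ℕ) + 1) fun M =>
      (∀ a, a < 21 → a ≠ Cell.F → a ≠ Cell.P → a ≠ Cell.Q → M a = M₀ a) ∧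
      DictHolds B (addTrial G B K c (pre f (m - 1)) i L) M := by
    refine Tri.of_lf (by decide) ?_
    rintro M ⟨hM, hA, hx, -⟩
    constructor
    · intro a ha h4 h5 h6
      rw [← hM a ha]
      have hw : Prog.trialEnd.writes.all
          (fun a => decide (21 ≤ a) || (a == Cell.F || (a == Cell.P || a == Cell.Q))) = true := by
        decide
      refine Prog.trialEnd.lf_eq_of_notMem (K := Cell.size) x M (by decide) fun hm' => ?_
      have := List.all_eq_true.1 hw a hm'
      simp only [Bool.or_eq_true, decide_eq_true_eq, beq_iff_eq] at this
      rcases this with h | h | h | h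
      · omega
      · exact h4 h
      · exact h5 h
      · exact h6 h
    · have hfin : G.finish c (pre f (m - 1)) = G.offer (f (m - 1)) (G.result c (pre f (m - 1))) := by
        unfold Grid.finish; cases m - 1 <;> rfl
      have hA1 : Holds G (G.finish c (pre f (m - 1))) (Prog.finish.lf x M) := by
        have e0 : Prog.finish.lf x M = Prog.offer.lf x (Function.update M Cell.p (f (m - 1))) := by
          simp [Prog.finish, hx]
        rw [hfin, e0]
        exact holds_offer x ((stores M hM).update (by decide) _)
          (hA.of_eq fun a a1 a2 => Function.update_of_ne (by simp only [Cell.p]; omega) _ _)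
          (Function.update_self _ _ _)
      have hM1 : ∀ a < 21, Prog.finish.lf x M a = M₀ a := fun a ha => by
        rw [Prog.finish.lf_eq_of_lt x M (by decide) (by decide) ha, hM a ha]
      have hL1 : DictHolds B L (Prog.finish.lf x M) := by
        constructor <;> rw [hM1 _ (by decide)]
        exacts [hL.B_eq, hL.F_eq, hL.P_eq, hL.Q_eq]
      have hi := dictHolds_insert x hL1 hA1.key (i := (i : ℤ)) (by rw [hM1 _ (by decide), hMi]; simp)
      have hok : RExpr.eval x (Prog.finish.lf x M) 1 ≤
          Prog.finish.lf x M Cell.ok ↔ (G.finish c (pre f (m - 1))).ok := by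
        rw [eval_one]; exact hA1.ok
      rw [Prog.trialEnd, lf_seq, Prog.accept, lf_ite, lf_ifEq, lf_ite]
      simp only [eval_var, lf_skip, hA1.y, hA1.lv, hA1.key, hM1 Cell.KM (by decide),
        hMK, Int.cast_le]
      unfold addTrial Grid.Accepts
      by_cases c1 : (G.finish c (pre f (m - 1))).ok
      · rw [if_pos (hok.2 c1)]
        by_cases c2 : (G.finish c (pre f (m - 1))).y = (G.finish c (pre f (m - 1))).lv
        · by_cases c3 : G.enc (G.finish c (pre f (m - 1))).w ≤ K
          · simp only [c1, c2, c3, true_and, if_true, and_true]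
            simp only [ne_eq, ite_not]
            exact hi
          · simp only [c1, c2, c3, if_true, if_false, false_and, and_false]
            exact hL1
        · simp only [c1, c2, if_false, false_and, and_false]
          exact hL1
      · rw [if_neg (hok.not.2 c1)]
        simp only [c1, if_false, false_and]
        exact hL1
  refine (h1.seq (h2.seq h3)).weaken ?_ (fun _ h => h) fun _ h => h
  rw [← hg]
  obtain ⟨m, rfl⟩ : ∃ l, m = l + 1 := ⟨m - 1, by omega⟩
  rw [Nat.add_sub_cancel]
  generalize Prog.trialEnd.lfTime = a, Prog.trialInit.lfTime = b, Prog.trialStep.lfTime = c'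
  nlinarith [Nat.zero_le (m * g), Nat.zero_le (m * a), Nat.zero_le (m * b)]

/-- The dictionary `L` contains the numbers of the grid curves that are accepted in the first `t`
trials, each of them with the index of an input curve for which it is accepted. The trials are
ordered by the input curve `f i` and then by the code. -/
structure Table (G : Grid) (f : ℕ → List ℝ) (B K : ℤ) (n NC t : ℕ) (L : List (ℤ × ℤ)) : Prop where
  valid : Dict.Valid B K n (n * NC) L
  length_le : L.length ≤ t
  sound : ∀ p ∈ L, ∃ i c : ℕ, i < n ∧ G.Accepts c (f i) ∧ p = (G.enc (G.finish c (f i)).w, (i : ℤ))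
  complete : ∀ i c : ℕ, c < NC → i * NC + c < t → G.Accepts c (f i) →
    G.enc (G.finish c (f i)).w ≤ K → G.enc (G.finish c (f i)).w ∈ L.map Prod.fst

theorem Table.addTrial {G : Grid} (hG : G.Valid) {f : ℕ → List ℝ} (hf : ∀ i, f i ≠ []) {B K : ℤ}
    {n NC i c : ℕ} {L : List (ℤ × ℤ)} (h : Table G f B K n NC (i * NC + c) L) (hi : i < n)
    (hc : c < NC) :
    Table G f B K n NC (i * NC + (c + 1)) (addTrial G B K c (f i) i L) := by
  have hN : i * NC + c + 1 ≤ n * NC := by nlinarith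
  have huniq : ∀ i' c', c' < NC → i' * NC + c' < i * NC + (c + 1) →
      i' * NC + c' < i * NC + c ∨ i' = i ∧ c' = c := by
    intro i' c' hc' hlt
    rcases Nat.lt_or_ge (i' * NC + c') (i * NC + c) with h1 | h1
    · exact .inl h1
    · right
      have e : i' * NC + c' = i * NC + c := by omega
      rcases lt_trichotomy i' i with h2 | h2 | h2
      · nlinarith
      · subst h2; omega
      · nlinarith
  have hpos : G.Accepts c (f i) → 0 ≤ G.enc (G.finish c (f i)).w := fun ha => by
    have := (Grid.enc_bounds (ha.fd hG (hf i)).2.2).1; omega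
  unfold _root_.addTrial
  split_ifs with ht
  · obtain ⟨ha, hK, hr⟩ := ht
    have hnot : G.enc (G.finish c (f i)).w ∉ L.map Prod.fst := fun hm =>
      hr ((h.valid.lookup (hpos ha) hK).1.2 hm)
    refine ⟨⟨?_, ?_, ?_, h.valid.K_nonneg, h.valid.one_le, h.valid.lt_base⟩, ?_, ?_, ?_⟩
    · rw [List.map_cons, List.nodup_cons]; exact ⟨hnot, h.valid.nodup⟩
    · intro p hp
      rcases List.mem_cons.1 hp with rfl | hp
      · exact ⟨hpos ha, hK, by simp, by simp; omega⟩
      · exact h.valid.mem p hp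
    · rw [List.length_cons]; exact (Nat.succ_le_succ h.length_le).trans hN
    · rw [List.length_cons]; have := h.length_le; omega
    · intro p hp
      rcases List.mem_cons.1 hp with rfl | hp
      · exact ⟨i, c, hi, ha, rfl⟩
      · exact h.sound p hp
    · intro i' c' hc' hlt ha' hK'
      rw [List.map_cons, List.mem_cons]
      rcases huniq i' c' hc' hlt with h1 | ⟨rfl, rfl⟩
      · exact .inr (h.complete i' c' hc' h1 ha' hK')
      · exact .inl rfl
  · refine ⟨h.valid, h.length_le.trans (by omega), h.sound, ?_⟩
    intro i' c' hc' hlt ha' hK'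
    rcases huniq i' c' hc' hlt with h1 | ⟨rfl, rfl⟩
    · exact h.complete i' c' hc' h1 ha' hK'
    · by_contra hm
      exact ht ⟨ha', hK', fun h0 => hm ((h.valid.lookup (hpos ha') hK').1.1 h0)⟩

/-- The part of the memory that is constant while the dictionary is built. -/
structure Env (G : Grid) (k n m NC : ℕ) (K : ℤ) (M : ℕ → ℝ) : Prop where
  stores : Stores G M
  k_eq : M Cell.k = k
  n_eq : M Cell.n = n
  m_eq : M Cell.m = m
  NC_eq : M Cell.NC = NC
  KM_eq : M Cell.KM = K

theorem Env.of_eq {G : Grid} {k n m NC : ℕ} {K : ℤ} {M M' : ℕ → ℝ} (h : Env G k n m NC K M)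
    (e : ∀ a < 14, M' a = M a) : Env G k n m NC K M' := by
  refine ⟨h.stores.of_eq fun a ha => e a (by rw [List.mem_range] at ha; omega), ?_, ?_, ?_, ?_, ?_⟩
    <;> rw [e _ (by decide)]
  exacts [h.k_eq, h.n_eq, h.m_eq, h.NC_eq, h.KM_eq]

/-- The dictionary is built in time proportional to the size of the input times the number of
codes. -/
theorem exists_build_time : ∃ κ : ℕ, ∀ {G : Grid} {k n m NC : ℕ} {B K : ℤ} (x : ℕ → ℝ), G.Valid →
    1 ≤ n → 1 ≤ m → 1 ≤ NC →
    Tri x Prog.build (κ * (n * m * NC))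
      (fun M => Env G k n m NC K M ∧ M Cell.i = 0 ∧ DictHolds B [] M ∧
        Dict.Valid B K n (n * NC) [])
      fun M => Env G k n m NC K M ∧ ∃ L, DictHolds B L M ∧
        Table G (fun i => pre (fun t => x (5 + i * m + t)) (m - 1)) B K n NC (n * NC) L := by
  obtain ⟨κ, hκ⟩ := exists_trial_time
  obtain ⟨u, hu⟩ : ∃ p, p = set Cell.c₀ (var Cell.c₀ + 1) := ⟨_, rfl⟩
  obtain ⟨u', hu'⟩ : ∃ p, p = set Cell.i (var Cell.i + 1) := ⟨_, rfl⟩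
  obtain ⟨v, hv⟩ : ∃ p, p = set Cell.c₀ 0 := ⟨_, rfl⟩
  obtain ⟨g, hg⟩ : ∃ g, g = (var Cell.c₀ + 1).cost + (var Cell.NC).cost + 1 := ⟨_, rfl⟩
  obtain ⟨g', hg'⟩ : ∃ g, g = (var Cell.i + 1).cost + (var Cell.n).cost + 1 := ⟨_, rfl⟩
  refine ⟨v.lfTime + (κ + u.lfTime + 2 * g) + u'.lfTime + 2 * g',
    fun {G k n m NC B K} x hG hn hm hNC => ?_⟩
  set f : ℕ → List ℝ := fun i => pre (fun t => x (5 + i * m + t)) (m - 1) with hf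
  have inner : ∀ i < n, Tri x (.loop (var Cell.c₀ + 1) (var Cell.NC) (Prog.trial ;; u))
      (NC * (κ * m + u.lfTime + g) + g)
      (fun M => Env G k n m NC K M ∧ M Cell.i = i ∧ M Cell.c₀ = (0 : ℕ) ∧ ∃ L, DictHolds B L M ∧
        Table G f B K n NC (i * NC + 0) L)
      (fun M => Env G k n m NC K M ∧ M Cell.i = i ∧ M Cell.c₀ = NC ∧ ∃ L, DictHolds B L M ∧
        Table G f B K n NC (i * NC + NC) L) := by
    intro i hi
    rw [hg]
    refine Tri.loop NC (fun c M => Env G k n m NC K M ∧ M Cell.i = i ∧ M Cell.c₀ = c ∧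
      ∃ L, DictHolds B L M ∧ Table G f B K n NC (i * NC + c) L) ?_ ?_
    · rintro c hc M ⟨hM, -, h, -⟩
      rw [eval_add, eval_var, eval_var, eval_one, h, hM.NC_eq, cast_add_one_le_cast_iff]
    · intro c hc
      have h1 : Tri x Prog.trial (κ * m)
          (fun M => Env G k n m NC K M ∧ M Cell.i = i ∧ M Cell.c₀ = c ∧
            ∃ L, DictHolds B L M ∧ Table G f B K n NC (i * NC + c) L)
          (fun M => Env G k n m NC K M ∧ M Cell.i = i ∧ M Cell.c₀ = c ∧
            ∃ L, DictHolds B L M ∧ Table G f B K n NC (i * NC + (c + 1)) L) := by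
        rintro ω s ⟨hM, hMi, hMc, L, hL, hT⟩
        obtain ⟨s', e, ht, hF, hL'⟩ := hκ x s.mem hG.ρ_nonneg hm hM.stores hM.m_eq hMi hMc hM.KM_eq hL
          ω s rfl
        refine ⟨s', e, ht, hM.of_eq fun a ha => hF a (by omega) ?_ ?_ ?_, ?_, ?_, _, hL',
          hT.addTrial hG (fun i => pre_ne_nil _ _) hi hc⟩
        · simp only [Cell.F]; omega
        · simp only [Cell.P]; omega
        · simp only [Cell.Q]; omega
        · rw [hF _ (by decide) (by decide) (by decide) (by decide), hMi]
        · rw [hF _ (by decide) (by decide) (by decide) (by decide), hMc]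
      refine h1.seq (Tri.of_lf (by rw [hu]; decide) ?_)
      rintro M ⟨hM, hMi, hMc, L, hL, hT⟩
      rw [hu, lf_set, eval_add, eval_var, eval_one, hMc]
      refine ⟨hM.of_eq fun a ha => Function.update_of_ne (by simp only [Cell.c₀]; omega) _ _,
        by simp [hMi], by simp, L, ?_, hT⟩
      constructor <;> simp [hL.B_eq, hL.F_eq, hL.P_eq, hL.Q_eq]
  have outer := Tri.loop (x := x) (p := v ;; .loop (var Cell.c₀ + 1) (var Cell.NC) (Prog.trial ;; u)
      ;; u') (t := v.lfTime + (NC * (κ * m + u.lfTime + g) + g + u'.lfTime)) (e := var Cell.i + 1)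
      (f := var Cell.n) n (fun i M => Env G k n m NC K M ∧ M Cell.i = i ∧ ∃ L, DictHolds B L M ∧
        Table G f B K n NC (i * NC) L) (by
      rintro i hi M ⟨hM, h, -⟩
      rw [eval_add, eval_var, eval_var, eval_one, h, hM.n_eq, cast_add_one_le_cast_iff]) (by
      intro i hi
      refine Tri.seq (Tri.of_lf (by rw [hv]; decide) ?_) ((inner i hi).seq
        (Tri.of_lf (by rw [hu']; decide) ?_))
      · rintro M ⟨hM, hMi, L, hL, hT⟩
        rw [hv, lf_set, eval_zero]
        refine ⟨hM.of_eq fun a ha => Function.update_of_ne (by simp only [Cell.c₀]; omega) _ _,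
          by simp [hMi], by simp, L, ?_, hT⟩
        constructor <;> simp [hL.B_eq, hL.F_eq, hL.P_eq, hL.Q_eq]
      · rintro M ⟨hM, hMi, -, L, hL, hT⟩
        rw [hu', lf_set, eval_add, eval_var, eval_one, hMi]
        refine ⟨hM.of_eq fun a ha => Function.update_of_ne (by simp only [Cell.i]; omega) _ _,
          by simp, L, ?_, by rwa [Nat.succ_mul]⟩
        constructor <;> simp [hL.B_eq, hL.F_eq, hL.P_eq, hL.Q_eq])
  rw [hu, hv, hu'] at outer
  refine outer.weaken ?_ ?_ ?_
  · rw [← hu, ← hv, ← hu', ← hg']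
    have t1 : NC * (κ * m + u.lfTime + g) + g ≤ (κ + u.lfTime + 2 * g) * (m * NC) := by
      have : κ * m + u.lfTime + g ≤ (κ + u.lfTime + g) * m := by nlinarith [Nat.mul_le_mul_left (u.lfTime + g) hm]
      calc NC * (κ * m + u.lfTime + g) + g ≤ NC * ((κ + u.lfTime + g) * m) + g * (m * NC) :=
            Nat.add_le_add (Nat.mul_le_mul_left _ this)
              (Nat.le_mul_of_pos_right _ (Nat.mul_pos hm hNC))
        _ = _ := by ring
    have t2 : v.lfTime + (NC * (κ * m + u.lfTime + g) + g + u'.lfTime) + g' ≤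
        (v.lfTime + (κ + u.lfTime + 2 * g) + u'.lfTime + g') * (m * NC) := by
      have : v.lfTime + u'.lfTime + g' ≤ (v.lfTime + u'.lfTime + g') * (m * NC) :=
        Nat.le_mul_of_pos_right _ (Nat.mul_pos hm hNC)
      calc _ = (NC * (κ * m + u.lfTime + g) + g) + (v.lfTime + u'.lfTime + g') := by ring
        _ ≤ (κ + u.lfTime + 2 * g) * (m * NC) + (v.lfTime + u'.lfTime + g') * (m * NC) :=
          Nat.add_le_add t1 this
        _ = _ := by ring
    calc _ ≤ n * ((v.lfTime + (κ + u.lfTime + 2 * g) + u'.lfTime + g') * (m * NC)) +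
          g' * (n * (m * NC)) := Nat.add_le_add (Nat.mul_le_mul_left _ t2)
            (Nat.le_mul_of_pos_right _ (Nat.mul_pos hn (Nat.mul_pos hm hNC)))
      _ = _ := by ring
  · rintro M ⟨hM, hMi, hL, hV⟩
    exact ⟨hM, by simpa using hMi, [], hL, hV, by simp, by simp, by simp⟩
  · rintro M ⟨hM, -, L, hL, hT⟩
    exact ⟨hM, L, hL, hT⟩

/-! ### The choice of the parameters -/

/-- The grid for the approximation parameter `ε` and the distance threshold `r`, for input curves
with values between `-a` and `a`. As the approximation error is `2ρ + μ + D = 5r + 9μ`, a mesh of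
`εr/20` is fine enough. -/
def fineGrid (ε r a : ℝ) : Grid where
  μ := ε * r / 20
  ρ := r + ε * r / 20
  D := 3 * (r + ε * r / 20) + 3 * (ε * r / 20)
  H := ⌊(a + 3 * (r + ε * r / 20)) / (ε * r / 20)⌋ + 2
  U := 2 * (⌊(a + 3 * (r + ε * r / 20)) / (ε * r / 20)⌋ + 2) + 2
  h := ⌊3 * (r + ε * r / 20) / (ε * r / 20)⌋ + 2
  W := (2 * (⌊3 * (r + ε * r / 20) / (ε * r / 20)⌋ + 2) + 1).toNat

section

variable {ε r a : ℝ}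

theorem fineGrid_h_nonneg (hε : 0 < ε) (hr : 0 < r) : 0 ≤ (fineGrid ε r a).h := by
  have : 0 ≤ ⌊3 * (r + ε * r / 20) / (ε * r / 20)⌋ := Int.floor_nonneg.2 (by positivity)
  simp only [fineGrid]; omega

theorem fineGrid_W (hε : 0 < ε) (hr : 0 < r) :
    ((fineGrid ε r a).W : ℤ) = 2 * (fineGrid ε r a).h + 1 := by
  have := fineGrid_h_nonneg (a := a) hε hr
  simp only [fineGrid] at this ⊢
  omega

theorem fineGrid_valid (hε : 0 < ε) (hr : 0 < r) : (fineGrid ε r a).Valid := by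
  have hμ : 0 < ε * r / 20 := by positivity
  have h1 := Int.floor_le (3 * (r + ε * r / 20) / (ε * r / 20))
  have h2 := Int.lt_floor_add_one (3 * (r + ε * r / 20) / (ε * r / 20))
  rw [le_div_iff₀ hμ] at h1
  rw [div_lt_iff₀ hμ] at h2
  refine ⟨hμ, by simp only [fineGrid]; positivity, fineGrid_W hε hr, fineGrid_h_nonneg hε hr, ?_, ?_⟩
  · simp only [fineGrid]; push_cast; linarith
  · simp only [fineGrid]; push_cast; linarith

theorem two_le_fineGrid_U (hε : 0 < ε) (hr : 0 < r) (ha : 0 ≤ a) : 2 ≤ (fineGrid ε r a).U := by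
  have : 0 ≤ ⌊(a + 3 * (r + ε * r / 20)) / (ε * r / 20)⌋ := Int.floor_nonneg.2 (by positivity)
  simp only [fineGrid]; omega

theorem fineGrid_inRange (hε : 0 < ε) (hr : 0 < r) {v : ℝ} (hv : |v| ≤ a + 3 * (fineGrid ε r a).ρ) :
    (fineGrid ε r a).InRange ((fineGrid ε r a).rd v) := by
  have hμ : 0 < ε * r / 20 := by positivity
  simp only [Grid.InRange, Grid.rd, fineGrid] at hv ⊢
  set b := (a + 3 * (r + ε * r / 20)) / (ε * r / 20) with hb
  obtain ⟨h1, h2⟩ := abs_le.1 hv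
  have h3 : v / (ε * r / 20) ≤ b := div_le_div_of_nonneg_right h2 hμ.le
  have h4 : -b ≤ v / (ε * r / 20) := by
    rw [hb, ← neg_div]; exact div_le_div_of_nonneg_right h1 hμ.le
  have h5 := Int.lt_floor_add_one b
  have h6 := Int.floor_le_floor h3
  have h7 : -(⌊b⌋ + 1) ≤ ⌊v / (ε * r / 20)⌋ := Int.le_floor.2 (by push_cast; linarith)
  constructor <;> omega

theorem fineGrid_W_le (hε : 0 < ε) (hε1 : ε ≤ 1) (hr : 0 < r) :
    ((fineGrid ε r a).W : ℝ) ≤ 131 / ε := by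
  have hW : ((fineGrid ε r a).W : ℝ) = 2 * (⌊3 * (r + ε * r / 20) / (ε * r / 20)⌋ + 2) + 1 := by
    have := fineGrid_W (a := a) hε hr
    simp only [fineGrid] at this ⊢
    exact_mod_cast this
  have h1 := Int.floor_le (3 * (r + ε * r / 20) / (ε * r / 20))
  have h2 : 3 * (r + ε * r / 20) / (ε * r / 20) = 60 / ε + 3 := by field_simp; ring
  have h3 : 1 ≤ 1 / ε := by rw [le_div_iff₀ hε]; linarith
  rw [h2] at h1
  have h4 : 131 / ε = 2 * (60 / ε) + 11 * (1 / ε) := by ring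
  rw [hW, h2, h4]
  linarith

end

/-! ### The preprocessing program -/

namespace Prog

/-- Read the parameters. -/
def setup : RProg :=
  set Cell.n (.input 0) ;; set Cell.m (.input 1) ;; set Cell.k (.input 2) ;;
  set Cell.μ (.input 3 * .input 4 / 20) ;;
  set Cell.ρ (.input 4 + var Cell.μ) ;;
  set Cell.R (2 * var Cell.ρ) ;;
  set Cell.D (3 * var Cell.ρ + 3 * var Cell.μ) ;;
  set Cell.h ((3 * var Cell.ρ / var Cell.μ).floor + 2) ;;
  set Cell.W (2 * var Cell.h + 1) ;;
  set Cell.max 0 ;; set Cell.i 0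

/-- Update the greatest absolute value that has been read so far. -/
def scanStep : RProg :=
  set Cell.x (.input (5 + var Cell.i)) ;;
  .ite (var Cell.x) (var Cell.max) .skip (set Cell.max (var Cell.x)) ;;
  .ite (0 - var Cell.x) (var Cell.max) .skip (set Cell.max (0 - var Cell.x)) ;;
  set Cell.i (var Cell.i + 1)

/-- Compute the range of the grid from the greatest absolute value that has been read. The cells `KM`
and `NC` are going to hold the greatest key and the number of codes. -/
def range : RProg :=
  set Cell.H (((var Cell.max + 3 * var Cell.ρ) / var Cell.μ).floor + 2) ;;
  set Cell.U (2 * var Cell.H + 2) ;;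
  set Cell.KM 2 ;; set Cell.NC 64 ;; set Cell.i 0

/-- One of the `k` factors of the greatest key and of the number of codes. -/
def powerStep : RProg :=
  set Cell.KM (var Cell.KM * var Cell.U) ;; set Cell.NC (var Cell.NC * (16 * var Cell.W)) ;;
  set Cell.i (var Cell.i + 1)

/-- Prepare the computation of the base of the dictionary. -/
def baseInit : RProg := set Cell.B 1 ;; set Cell.i 0

/-- One of the factors of the base of the dictionary. -/
def baseStep : RProg :=
  set Cell.B (var Cell.B * (2 * ((var Cell.KM + 1) * (var Cell.KM + 1)))) ;;
  set Cell.i (var Cell.i + 1)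

/-- Store the base and the empty dictionary. -/
def empty : RProg :=
  set Cell.B (var Cell.KM + 1 + var Cell.n * var Cell.B) ;;
  set Cell.F 1 ;; set Cell.P 0 ;; set Cell.Q 0 ;; set Cell.i 0

/-- The preprocessing program. -/
def preprocess : RProg :=
  setup ;;
  .loop (var Cell.i + 1) (var Cell.n * var Cell.m) scanStep ;;
  range ;;
  .loop (var Cell.i + 1) (var Cell.k) powerStep ;;
  baseInit ;;
  .loop (var Cell.i + 1) (var Cell.n * var Cell.NC) baseStep ;;
  empty ;;
  build

end Prog

/-- The parameters that do not depend on the input curves are stored in the memory. -/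
structure SetupHolds (ε r : ℝ) (k n m : ℕ) (M : ℕ → ℝ) : Prop where
  μ : M Cell.μ = ε * r / 20
  ρ : M Cell.ρ = r + ε * r / 20
  R : M Cell.R = 2 * (r + ε * r / 20)
  D : M Cell.D = 3 * (r + ε * r / 20) + 3 * (ε * r / 20)
  h : M Cell.h = (⌊3 * (r + ε * r / 20) / (ε * r / 20)⌋ : ℤ) + 2
  W : M Cell.W = 2 * ((⌊3 * (r + ε * r / 20) / (ε * r / 20)⌋ : ℤ) + 2) + 1
  k : M Cell.k = k
  n : M Cell.n = n
  m : M Cell.m = m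

theorem SetupHolds.of_eq {ε r : ℝ} {k n m : ℕ} {M M' : ℕ → ℝ} (h : SetupHolds ε r k n m M)
    (e : ∀ a < 18, M' a = M a) : SetupHolds ε r k n m M' := by
  constructor <;> rw [e _ (by decide)]
  exacts [h.μ, h.ρ, h.R, h.D, h.h, h.W, h.k, h.n, h.m]

theorem setup_spec {x : ℕ → ℝ} {ε r : ℝ} {k n m : ℕ} (h0 : x 0 = n) (h1 : x 1 = m) (h2 : x 2 = k)
    (h3 : x 3 = ε) (h4 : x 4 = r) :
    Tri x Prog.setup Prog.setup.lfTime (fun _ => True) fun M =>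
      SetupHolds ε r k n m M ∧ M Cell.i = (0 : ℕ) ∧ 0 ≤ M Cell.max ∧
        ∀ j < 0, |x (5 + j)| ≤ M Cell.max := by
  refine Tri.of_lf (by decide) fun M _ => ⟨?_, ?_, ?_, by simp⟩
  · constructor <;> simp [Prog.setup, h0, h1, h2, h3, h4]
  · simp [Prog.setup]
  · simp [Prog.setup]

theorem scan_spec {x : ℕ → ℝ} {ε r : ℝ} {k n m : ℕ} :
    Tri x (.loop (var Cell.i + 1) (var Cell.n * var Cell.m) Prog.scanStep)
      (n * m * (Prog.scanStep.lfTime +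
          ((var Cell.i + 1).cost + (var Cell.n * var Cell.m).cost + 1)) +
        ((var Cell.i + 1).cost + (var Cell.n * var Cell.m).cost + 1))
      (fun M => SetupHolds ε r k n m M ∧ M Cell.i = (0 : ℕ) ∧ 0 ≤ M Cell.max ∧
        ∀ j < 0, |x (5 + j)| ≤ M Cell.max)
      (fun M => SetupHolds ε r k n m M ∧ M Cell.i = (n * m : ℕ) ∧ 0 ≤ M Cell.max ∧
        ∀ j < n * m, |x (5 + j)| ≤ M Cell.max) := by
  refine Tri.loop (n * m) (fun t M => SetupHolds ε r k n m M ∧ M Cell.i = (t : ℕ) ∧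
    0 ≤ M Cell.max ∧ ∀ j < t, |x (5 + j)| ≤ M Cell.max) ?_ ?_
  · rintro t - M ⟨hM, hi, -⟩
    rw [eval_add, eval_mul, eval_var, eval_var, eval_var, eval_one, hi, hM.n, hM.m, ← Nat.cast_mul,
      cast_add_one_le_cast_iff]
  · intro t _
    refine Tri.of_lf (by decide) ?_
    rintro M ⟨hM, hi, h0, hmax⟩
    have e1 : Prog.scanStep.lf x M Cell.max = max (M Cell.max) |x (5 + t)| := by
      have e0 : (set Cell.x (.input (5 + var Cell.i))).lf x M =
          Function.update M Cell.x (x (5 + t)) := by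
        rw [lf_set, eval_input, eval_add, eval_var, hi, eval_ofNat,
          show ((5 : ℝ) + t) = ((5 + t : ℕ) : ℝ) by push_cast; rfl, Nat.floor_natCast]
      have e2 : ∀ (e : RExpr) (M' : ℕ → ℝ), (RProg.ite e (var Cell.max) .skip (set Cell.max e)).lf x M' =
          Function.update M' Cell.max (max (M' Cell.max) (e.eval x M')) := by
        intro e M'
        rw [lf_ite, lf_skip, lf_set, eval_var]
        split_ifs with h
        · rw [max_eq_left h, Function.update_eq_self]
        · rw [max_eq_right (not_le.1 h).le]
      rw [Prog.scanStep, lf_seq, e0, lf_seq, e2, lf_seq, e2, lf_set, abs, ← max_assoc]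
      simp
    refine ⟨hM.of_eq fun a ha => Prog.scanStep.lf_eq_of_lt x M (by decide) (by decide) ha, ?_, ?_, ?_⟩
    · simp only [Prog.scanStep, lf_seq, lf_set, Function.update_self, eval_add, eval_var, eval_one]
      rw [RProg.lf_eq_of_notMem (K := Cell.size) x _ (by decide) (by decide),
        RProg.lf_eq_of_notMem (K := Cell.size) x _ (by decide) (by decide)]
      simp [hi]
    · rw [e1]; exact h0.trans (le_max_left _ _)
    · intro j hj
      rw [e1]
      rcases Nat.lt_succ_iff_lt_or_eq.1 hj with h | rfl
      · exact (hmax j h).trans (le_max_left _ _)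
      · exact le_max_right _ _

theorem range_spec {x : ℕ → ℝ} {ε r : ℝ} {k n m : ℕ} (hε : 0 < ε) (hr : 0 < r) (a : ℝ) :
    Tri x Prog.range Prog.range.lfTime (fun M => SetupHolds ε r k n m M ∧ M Cell.max = a) fun M =>
      Env (fineGrid ε r a) k n m (64 * (16 * (fineGrid ε r a).W) ^ 0)
        (2 * (fineGrid ε r a).U ^ 0) M ∧ M Cell.i = (0 : ℕ) := by
  refine Tri.of_lf (by decide) ?_
  rintro M ⟨hM, rfl⟩
  have hW : ((fineGrid ε r (M Cell.max)).W : ℝ) =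
      2 * ((⌊3 * (r + ε * r / 20) / (ε * r / 20)⌋ : ℤ) + 2) + 1 := by
    have := fineGrid_W (a := M Cell.max) hε hr
    simp only [fineGrid] at this ⊢
    exact_mod_cast this
  refine ⟨⟨?_, ?_, ?_, ?_, ?_, ?_⟩, ?_⟩
  · constructor
    · simp [Prog.range, hM.μ, fineGrid]
    · simp [Prog.range, hM.ρ, fineGrid]
    · simp [Prog.range, hM.R, fineGrid]
    · simp [Prog.range, hM.D, fineGrid]
    · simp [Prog.range, hM.μ, hM.ρ, fineGrid]
    · simp [Prog.range, hM.μ, hM.ρ, fineGrid]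
    · simp [Prog.range, hM.h, fineGrid]
    · rw [hW]; simp [Prog.range, hM.W]
  · simp [Prog.range, hM.k]
  · simp [Prog.range, hM.n]
  · simp [Prog.range, hM.m]
  · simp [Prog.range]
  · simp [Prog.range]
  · simp [Prog.range]

theorem power_spec {x : ℕ → ℝ} {G : Grid} {k n m : ℕ} :
    Tri x (.loop (var Cell.i + 1) (var Cell.k) Prog.powerStep)
      (k * (Prog.powerStep.lfTime + ((var Cell.i + 1).cost + (var Cell.k).cost + 1)) +
        ((var Cell.i + 1).cost + (var Cell.k).cost + 1))
      (fun M => Env G k n m (64 * (16 * G.W) ^ 0) (2 * G.U ^ 0) M ∧ M Cell.i = (0 : ℕ))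
      (fun M => Env G k n m (64 * (16 * G.W) ^ k) (2 * G.U ^ k) M ∧ M Cell.i = k) := by
  refine Tri.loop k (fun t M => Env G k n m (64 * (16 * G.W) ^ t) (2 * G.U ^ t) M ∧
    M Cell.i = (t : ℕ)) ?_ ?_
  · rintro t - M ⟨hM, hi⟩
    rw [eval_add, eval_var, eval_var, eval_one, hi, hM.k_eq, cast_add_one_le_cast_iff]
  · intro t _
    refine Tri.of_lf (by decide) ?_
    rintro M ⟨hM, hi⟩
    refine ⟨⟨hM.stores.of_eq fun a ha => ?_, ?_, ?_, ?_, ?_, ?_⟩, ?_⟩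
    · rw [List.mem_range] at ha
      exact Prog.powerStep.lf_eq_of_lt x M (by decide) (by decide) ha
    · simp [Prog.powerStep, hM.k_eq]
    · simp [Prog.powerStep, hM.n_eq]
    · simp [Prog.powerStep, hM.m_eq]
    · simp [Prog.powerStep, hM.NC_eq, hM.stores.W]; ring
    · simp [Prog.powerStep, hM.KM_eq, hM.stores.U]; ring
    · simp [Prog.powerStep, hi]

theorem base_spec {x : ℕ → ℝ} {G : Grid} {k n m NC : ℕ} {K : ℤ} :
    Tri x (.loop (var Cell.i + 1) (var Cell.n * var Cell.NC) Prog.baseStep)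
      (n * NC * (Prog.baseStep.lfTime +
          ((var Cell.i + 1).cost + (var Cell.n * var Cell.NC).cost + 1)) +
        ((var Cell.i + 1).cost + (var Cell.n * var Cell.NC).cost + 1))
      (fun M => Env G k n m NC K M ∧ M Cell.i = (0 : ℕ) ∧
        M Cell.B = (2 * ((K : ℝ) + 1) ^ 2) ^ 0)
      (fun M => Env G k n m NC K M ∧ M Cell.i = (n * NC : ℕ) ∧
        M Cell.B = (2 * ((K : ℝ) + 1) ^ 2) ^ (n * NC)) := by
  refine Tri.loop (n * NC) (fun t M => Env G k n m NC K M ∧ M Cell.i = (t : ℕ) ∧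
        M Cell.B = (2 * ((K : ℝ) + 1) ^ 2) ^ t) ?_ ?_
  · rintro t - M ⟨hM, hi, -⟩
    rw [eval_add, eval_mul, eval_var, eval_var, eval_var, eval_one, hi, hM.n_eq, hM.NC_eq,
      ← Nat.cast_mul, cast_add_one_le_cast_iff]
  · intro t _
    refine Tri.of_lf (by decide) ?_
    rintro M ⟨hM, hi, hB⟩
    refine ⟨hM.of_eq fun a ha => Prog.baseStep.lf_eq_of_lt x M (by decide) (by decide) ha, ?_, ?_⟩
    · simp [Prog.baseStep, hi]
    · simp [Prog.baseStep, hB, hM.KM_eq]; ring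

/-- A number that is large enough to be the base of a dictionary with `N` entries, keys up to `K`
and values up to `n`. -/
def base (K n : ℤ) (N : ℕ) : ℤ := K + 1 + n * (2 * (K + 1) ^ 2) ^ N

theorem empty_spec {x : ℕ → ℝ} {G : Grid} {k n m NC : ℕ} {K : ℤ} :
    Tri x Prog.empty Prog.empty.lfTime
      (fun M => Env G k n m NC K M ∧ M Cell.i = (n * NC : ℕ) ∧
        M Cell.B = (2 * ((K : ℝ) + 1) ^ 2) ^ (n * NC))
      (fun M => Env G k n m NC K M ∧ M Cell.i = 0 ∧ DictHolds (base K n (n * NC)) [] M) := by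
  refine Tri.of_lf (by decide) ?_
  rintro M ⟨hM, -, hB⟩
  refine ⟨hM.of_eq fun a ha => Prog.empty.lf_eq_of_lt x M (by decide) (by decide) ha, ?_, ?_⟩
  · simp [Prog.empty]
  · constructor
    · simp [Prog.empty, base, hB, hM.KM_eq, hM.n_eq]
    · simp [Prog.empty, Dict.F]
    · simp [Prog.empty, Dict.P]
    · simp [Prog.empty, Dict.Q]

/-- After the preprocessing, the memory holds a dictionary of all grid curves that are accepted for
some input curve and some code. -/
theorem exists_preprocess_time : ∃ κ : ℕ, ∀ {x : ℕ → ℝ} {ε r : ℝ} {k n m : ℕ}, 0 < ε → 0 < r →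
    1 ≤ n → 1 ≤ m → x 0 = n → x 1 = m → x 2 = k → x 3 = ε → x 4 = r →
    Tri x Prog.preprocess (κ * (n * m * (64 * (16 * (fineGrid ε r 0).W) ^ k))) (fun _ => True)
      fun M => ∃ a, 0 ≤ a ∧ (∀ j < n * m, |x (5 + j)| ≤ a) ∧
        ∃ B L, DataHolds (fineGrid ε r a) k B L M ∧
        Table (fineGrid ε r a) (fun i => pre (fun t => x (5 + i * m + t)) (m - 1)) B
          (2 * (fineGrid ε r a).U ^ k) n (64 * (16 * (fineGrid ε r 0).W) ^ k)
          (n * (64 * (16 * (fineGrid ε r 0).W) ^ k)) L := by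
  obtain ⟨κ, hκ⟩ := exists_build_time
  obtain ⟨g1, hg1⟩ : ∃ g, g = (var Cell.i + 1).cost + (var Cell.n * var Cell.m).cost + 1 := ⟨_, rfl⟩
  obtain ⟨g2, hg2⟩ : ∃ g, g = (var Cell.i + 1).cost + (var Cell.k).cost + 1 := ⟨_, rfl⟩
  obtain ⟨g3, hg3⟩ : ∃ g, g = (var Cell.i + 1).cost + (var Cell.n * var Cell.NC).cost + 1 :=
    ⟨_, rfl⟩
  refine ⟨Prog.setup.lfTime + (Prog.scanStep.lfTime + 2 * g1) + Prog.range.lfTime +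
    (Prog.powerStep.lfTime + 2 * g2) + Prog.baseInit.lfTime + (Prog.baseStep.lfTime + 2 * g3) +
    Prog.empty.lfTime + κ, fun {x ε r k n m} hε hr hn hm h0 h1 h2 h3 h4 => ?_⟩
  have hW : 1 ≤ (fineGrid ε r 0).W := by
    have := fineGrid_W (a := 0) hε hr
    have := fineGrid_h_nonneg (a := 0) hε hr
    omega
  set NC := 64 * (16 * (fineGrid ε r 0).W) ^ k with hNC
  have hk : k ≤ NC := by
    have : k < (16 * (fineGrid ε r 0).W) ^ k := Nat.lt_pow_self (by omega)
    omega
  have hNC1 : 1 ≤ NC := by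
    have : 0 < (16 * (fineGrid ε r 0).W) ^ k := by positivity
    omega
  have hT1 : 1 ≤ n * m * NC := Nat.mul_pos (Nat.mul_pos hn hm) hNC1
  have hTm : n * m ≤ n * m * NC := Nat.le_mul_of_pos_right _ hNC1
  have hTk : k ≤ n * m * NC := hk.trans (Nat.le_mul_of_pos_left _ (Nat.mul_pos hn hm))
  have hTN : n * NC ≤ n * m * NC := Nat.mul_le_mul_right _ (Nat.le_mul_of_pos_right _ hm)
  have tail : ∀ a, 0 ≤ a → Tri x (Prog.range ;; .loop (var Cell.i + 1) (var Cell.k) Prog.powerStep ;;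
      Prog.baseInit ;; .loop (var Cell.i + 1) (var Cell.n * var Cell.NC) Prog.baseStep ;;
      Prog.empty ;; Prog.build) (Prog.range.lfTime + (k * (Prog.powerStep.lfTime + g2) + g2 +
      (Prog.baseInit.lfTime + (n * NC * (Prog.baseStep.lfTime + g3) + g3 +
      (Prog.empty.lfTime + κ * (n * m * NC)))))) (fun M => SetupHolds ε r k n m M ∧ M Cell.max = a)
      fun M => ∃ B L, DataHolds (fineGrid ε r a) k B L M ∧
        Table (fineGrid ε r a) (fun i => pre (fun t => x (5 + i * m + t)) (m - 1)) B
          (2 * (fineGrid ε r a).U ^ k) n NC (n * NC) L := by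
    intro a ha
    rw [hg2, hg3]
    have hG := fineGrid_valid (a := a) hε hr
    have hU := two_le_fineGrid_U hε hr ha
    have hK : (0 : ℤ) ≤ 2 * (fineGrid ε r a).U ^ k := by positivity
    refine (range_spec hε hr a).seq (power_spec.seq (Tri.seq (Mid := fun M =>
      Env (fineGrid ε r a) k n m NC (2 * (fineGrid ε r a).U ^ k) M ∧ M Cell.i = (0 : ℕ) ∧
        M Cell.B = (2 * (((2 * (fineGrid ε r a).U ^ k : ℤ) : ℝ) + 1) ^ 2) ^ 0)
      (Tri.of_lf (by decide) ?_) (base_spec.seq (empty_spec.seq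
      ((hκ (k := k) (K := 2 * (fineGrid ε r a).U ^ k)
        (B := base (2 * (fineGrid ε r a).U ^ k) n (n * NC)) x hG hn hm hNC1).weaken le_rfl
        ?_ ?_)))))
    · rintro M ⟨hM, -⟩
      exact ⟨hM.of_eq fun a ha => Prog.baseInit.lf_eq_of_lt x M (by decide) (by decide) ha,
        by simp [Prog.baseInit], by simp [Prog.baseInit]⟩
    · rintro M ⟨hM, hi, hL⟩
      exact ⟨hM, hi, hL, by simp, by simp, by simp, hK, by exact_mod_cast hn,
        by unfold base; linarith⟩
    · rintro M ⟨hM, L, hL, hT⟩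
      exact ⟨_, L, ⟨hM.stores, hM.k_eq, hL⟩, hT⟩
  have all := (setup_spec h0 h1 h2 h3 h4).seq ((scan_spec (x := x)).seq
    (q := Prog.range ;; .loop (var Cell.i + 1) (var Cell.k) Prog.powerStep ;;
      Prog.baseInit ;; .loop (var Cell.i + 1) (var Cell.n * var Cell.NC) Prog.baseStep ;;
      Prog.empty ;; Prog.build) (Post := fun M => ∃ a, 0 ≤ a ∧ (∀ j < n * m, |x (5 + j)| ≤ a) ∧
        ∃ B L, DataHolds (fineGrid ε r a) k B L M ∧
        Table (fineGrid ε r a) (fun i => pre (fun t => x (5 + i * m + t)) (m - 1)) B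
          (2 * (fineGrid ε r a).U ^ k) n NC (n * NC) L) (by
    rintro ω s ⟨hM, -, ha, hmax⟩
    obtain ⟨s', e, ht, hs⟩ := tail (s.mem Cell.max) ha ω s ⟨hM, rfl⟩
    exact ⟨s', e, ht, _, ha, hmax, hs⟩))
  rw [← hg1] at all
  refine all.weaken ?_ (fun _ h => h) fun _ h => h
  have l1 := loop_time_le (t := Prog.scanStep.lfTime) (g := g1) hTm hT1
  have l2 := loop_time_le (t := Prog.powerStep.lfTime) (g := g2) hTk hT1
  have l3 := loop_time_le (t := Prog.baseStep.lfTime) (g := g3) hTN hT1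
  generalize n * m * NC = T at *
  have s1 : Prog.setup.lfTime ≤ Prog.setup.lfTime * T := Nat.le_mul_of_pos_right _ hT1
  have s2 : Prog.range.lfTime ≤ Prog.range.lfTime * T := Nat.le_mul_of_pos_right _ hT1
  have s3 : Prog.baseInit.lfTime ≤ Prog.baseInit.lfTime * T := Nat.le_mul_of_pos_right _ hT1
  have s4 : Prog.empty.lfTime ≤ Prog.empty.lfTime * T := Nat.le_mul_of_pos_right _ hT1
  simp only [Nat.add_mul] at l1 l2 l3 ⊢
  generalize Prog.setup.lfTime = b1, Prog.scanStep.lfTime = b2, Prog.range.lfTime = b3,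
    Prog.powerStep.lfTime = b4, Prog.baseInit.lfTime = b5, Prog.baseStep.lfTime = b6,
    Prog.empty.lfTime = b7 at *
  linarith

/-! ### Correctness of the answers -/

theorem pre_congr {f g : ℕ → ℝ} {N : ℕ} (h : ∀ i ≤ N, f i = g i) : pre f N = pre g N := by
  induction N with
  | zero => simp [pre, h 0 le_rfl]
  | succ N ih => rw [pre, pre, h _ le_rfl, ih fun i hi => h i (by omega)]

theorem preInput_eq {n m : ℕ} (k : ℕ) (ε r : ℝ) (P : Fin n → Fin m → ℝ) {i t : ℕ} (hi : i < n)
    (ht : t < m) : preInput k ε r P (5 + i * m + t) = seqAt (P ⟨i, hi⟩) t := by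
  have e : 5 + i * m + t - 5 = t + m * i := by rw [Nat.mul_comm m i]; omega
  have e1 : (5 + i * m + t - 5) / m = i := by
    rw [e, Nat.add_mul_div_left _ _ (by omega), Nat.div_eq_of_lt ht, Nat.zero_add]
  have e2 : (5 + i * m + t - 5) % m = t := by
    rw [e, Nat.add_mul_mod_self_left, Nat.mod_eq_of_lt ht]
  unfold preInput
  simp only [e1, e2, hi, dif_pos]
  rw [if_neg (by omega), if_neg (by omega), if_neg (by omega), if_neg (by omega), if_neg (by omega)]

/-- The reversed list of the vertices of the input curve with the index `i`. -/
def inputCurve {n m : ℕ} (k : ℕ) (ε r : ℝ) (P : Fin n → Fin m → ℝ) (i : ℕ) : List ℝ :=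
  pre (fun t => preInput k ε r P (5 + i * m + t)) (m - 1)

theorem inputCurve_ne_nil {n m : ℕ} (k : ℕ) (ε r : ℝ) (P : Fin n → Fin m → ℝ) (i : ℕ) :
    inputCurve k ε r P i ≠ [] := pre_ne_nil _ _

theorem curve_inputCurve {n m : ℕ} (hm : 1 ≤ m) (k : ℕ) (ε r : ℝ) (P : Fin n → Fin m → ℝ) {i : ℕ}
    (hi : i < n) : curve (inputCurve k ε r P i) = timeSeries (P ⟨i, hi⟩) := by
  rw [← curve_pre_seqAt hm, inputCurve,
    pre_congr fun t ht => preInput_eq k ε r P hi (t := t) (by omega)]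

theorem mem_inputCurve {n m : ℕ} (hm : 1 ≤ m) {k : ℕ} {ε r : ℝ} {P : Fin n → Fin m → ℝ} {i : ℕ}
    (hi : i < n) {a : ℝ} (ha : ∀ j < n * m, |preInput k ε r P (5 + j)| ≤ a) :
    ∀ v ∈ inputCurve k ε r P i, |v| ≤ a := by
  have key : ∀ N, N < m → ∀ v ∈ pre (fun t => preInput k ε r P (5 + i * m + t)) N, |v| ≤ a := by
    have hb : ∀ t < m, |preInput k ε r P (5 + i * m + t)| ≤ a := fun t ht => by
      rw [Nat.add_assoc]; exact ha _ (by nlinarith)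
    intro N
    induction N with
    | zero => intro h v hv; simp only [pre, List.mem_singleton] at hv; rw [hv]; exact hb 0 h
    | succ N ih =>
      intro h v hv
      rcases List.mem_cons.1 hv with rfl | hv
      · exact hb _ h
      · exact ih (by omega) v hv
  exact key _ (by omega)

/-- The rounded path of the play operator on the query curve. -/
def queryPath {k : ℕ} (G : Grid) (τ : Fin k → ℝ) : List ℤ :=
  (playSeq (2 * G.ρ) 0 (seqAt τ) (k - 1)).final.map G.rd

theorem length_queryPath_le {G : Grid} (hρ : 0 ≤ G.ρ) {k : ℕ} (hk : 1 ≤ k) (τ : Fin k → ℝ) :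
    (queryPath G τ).length ≤ k := by
  rw [queryPath, List.length_map]
  have := length_final_le (R := 2 * G.ρ) (by linarith) (seqAt τ) (k - 1)
  unfold playSeq
  omega

/-- The keys of the dictionary are large enough for all query curves. -/
theorem enc_queryPath_bounds {G : Grid} (hρ : 0 ≤ G.ρ) (hU : 2 ≤ G.U) {k : ℕ} (hk : 1 ≤ k)
    (τ : Fin k → ℝ) (h : ∀ z ∈ queryPath G τ, G.InRange z) :
    0 ≤ G.enc (queryPath G τ) ∧ G.enc (queryPath G τ) ≤ 2 * G.U ^ k := by
  obtain ⟨h1, h2⟩ := Grid.enc_bounds h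
  have h3 : G.U ^ (queryPath G τ).length ≤ G.U ^ k :=
    pow_le_pow_right₀ (by linarith) (length_queryPath_le hρ hk τ)
  constructor <;> linarith

/-- The query curve is close to its rounded path. -/
theorem fd_queryPath {G : Grid} (hG : G.Valid) {k : ℕ} (hk : 1 ≤ k) (τ : Fin k → ℝ)
    (hw : queryPath G τ ≠ []) :
    FD (G.μ + 2 * G.ρ) (curve ((queryPath G τ).map G.val)) (timeSeries τ) := by
  have h1 := FD.play (R := 2 * G.ρ) (by linarith [hG.ρ_nonneg]) (pre_ne_nil (seqAt τ) (k - 1))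
  rw [curve_pre_seqAt hk] at h1
  refine FD.trans (FD.of_ref (Ref.refl ?_) (Ref.refl ?_) ?_) h1.symm
  · simpa using hw
  · intro h
    exact hw (by rw [queryPath, playSeq, h, List.map_nil])
  · rw [queryPath, playSeq, List.map_map, List.forall₂_map_left_iff, List.forall₂_same]
    exact fun v _ => Grid.abs_val_rd_sub_le hG.μ_pos v

/-- A lookup of the rounded path of a query curve in the dictionary gives a correct answer. -/
theorem exists_isANNAnswer {n m k : ℕ} {ε r a : ℝ} {P : Fin n → Fin m → ℝ} {B : ℤ}
    {L : List (ℤ × ℤ)} (hm : 1 ≤ m) (hk : 1 ≤ k) (hε : 0 < ε) (hr : 0 < r) (ha : 0 ≤ a)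
    (hb : ∀ j < n * m, |preInput k ε r P (5 + j)| ≤ a)
    (hT : Table (fineGrid ε r a) (inputCurve k ε r P) B (2 * (fineGrid ε r a).U ^ k) n
      (64 * (16 * (fineGrid ε r a).W) ^ k) (n * (64 * (16 * (fineGrid ε r a).W) ^ k)) L)
    (τ : Fin k → ℝ) {b : ℝ}
    (h : ((∀ z ∈ queryPath (fineGrid ε r a) τ, (fineGrid ε r a).InRange z) ∧
        ∃ v, ((fineGrid ε r a).enc (queryPath (fineGrid ε r a) τ), v) ∈ L ∧ b = v) ∨
      (((∀ z ∈ queryPath (fineGrid ε r a) τ, (fineGrid ε r a).InRange z) →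
        (fineGrid ε r a).enc (queryPath (fineGrid ε r a) τ) ∉ L.map Prod.fst) ∧ b = -1)) :
    ∃ ans : Option (Fin n), b = encodeAnswer ans ∧
      IsANNAnswer (5 + ε) r (fun i => timeSeries (P i)) (timeSeries τ) ans := by
  have hG := fineGrid_valid (a := a) hε hr
  have hU := two_le_fineGrid_U hε hr ha
  have eρ : (fineGrid ε r a).ρ = r + ε * r / 20 := rfl
  have eμ : (fineGrid ε r a).μ = ε * r / 20 := rfl
  have eD : (fineGrid ε r a).D = 3 * (r + ε * r / 20) + 3 * (ε * r / 20) := rfl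
  have hin : ∀ v : ℝ, |v| ≤ a + 3 * (fineGrid ε r a).ρ →
    (fineGrid ε r a).InRange ((fineGrid ε r a).rd v) := fun v hv => fineGrid_inRange hε hr hv
  have hεr : 0 < ε * r := mul_pos hε hr
  generalize fineGrid ε r a = G at *
  rcases h with ⟨hR, v, hv, rfl⟩ | ⟨hR, rfl⟩
  · obtain ⟨i, c, hi, hA, e⟩ := hT.sound _ hv
    obtain ⟨e1, rfl⟩ := Prod.mk.inj e
    obtain ⟨h1, h2, h3⟩ := hA.fd hG (inputCurve_ne_nil _ _ _ _ _)
    rw [curve_inputCurve hm _ _ _ _ hi] at h1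
    have e2 := Grid.enc_injective hU hR h3 e1
    rw [← e2] at h1 h2
    have hd : frechetDist (timeSeries (P ⟨i, hi⟩)) (timeSeries τ) < (5 + ε) * r := by
      refine (h1.trans (fd_queryPath hG hk τ h2)).frechetDist_le.trans_lt ?_
      rw [eρ, eμ, eD]
      linarith
    refine ⟨some ⟨i, hi⟩, by simp [encodeAnswer], ?_, ?_, ?_⟩
    · exact fun _ => ⟨_, rfl, hd.le⟩
    · exact fun h => absurd (h ⟨i, hi⟩) (not_le.2 hd)
    · intro j hj
      rw [← Option.some.inj hj]
      exact hd.le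
  · refine ⟨none, rfl, ?_, fun _ => rfl, fun j hj => by simp at hj⟩
    rintro ⟨⟨i, hi⟩, hd⟩
    exfalso
    have hlt : frechetDist (timeSeries (P ⟨i, hi⟩)) (timeSeries τ) < G.ρ := by
      rw [eρ]; linarith
    have hFD := FD.of_frechetDist_lt (continuous_timeSeries hm _) (continuous_timeSeries hk _) hlt
    rw [← curve_inputCurve hm k ε r P hi, ← curve_pre_seqAt hk τ] at hFD
    obtain ⟨c, hc, hA, hw⟩ := Grid.exists_code hG hFD (mem_inputCurve hm hi hb) hin
    rw [Nat.sub_add_cancel hk] at hc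
    change (G.finish c (inputCurve k ε r P i)).w = queryPath G τ at hw
    have h3 := (hA.fd hG (inputCurve_ne_nil _ _ _ _ _)).2.2
    have hle := enc_queryPath_bounds hG.ρ_nonneg hU hk τ (hw ▸ h3)
    have := hT.complete i c hc (by nlinarith) hA (by rw [hw]; exact hle.2)
    rw [hw] at this
    exact hR (hw ▸ h3) this

/-! ### The bounds for time and space -/

/-- The number of codes is `O(1/ε)ᵏ`. -/
theorem codes_le {ε r : ℝ} (hε : 0 < ε) (hε1 : ε ≤ 1) (hr : 0 < r) (k : ℕ) :
    ((64 * (16 * (fineGrid ε r 0).W) ^ k : ℕ) : ℝ) ≤ 64 * (2096 / ε) ^ k := by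
  have h := fineGrid_W_le (a := 0) hε hε1 hr
  have h2 : 16 * ((fineGrid ε r 0).W : ℝ) ≤ 2096 / ε := by
    have e : 2096 / ε = 16 * (131 / ε) := by ring
    linarith
  push_cast
  gcongr

theorem Reachable.peak_le {p q : RProg} {k K : ℕ} {x : ℕ → ℝ} {ω : RandomSource} {s : RState}
    (h : Reachable p q k x ω s) (hp : p.isStatic K = true) (hq : q.isStatic K = true) :
    s.peak ≤ K := by
  induction h with
  | preprocess e => simpa [RState.init] using e.peak_le hp
  | query τ ω' _ e ih =>
    have := e.peak_le hq
    simp only [RState.restart] at this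
    omega

/-- Preprocessing leaves the memory in the state that queries need, and queries keep it. -/
theorem Reachable.dataHolds {k : ℕ} {x : ℕ → ℝ} {ω : RandomSource} {s : RState}
    (h : Reachable Prog.preprocess Prog.query k x ω s) {t : ℕ} {Post : Grid → ℤ → List (ℤ × ℤ) → Prop}
    (hp : Tri x Prog.preprocess t (fun _ => True)
      fun M => ∃ G B L, DataHolds G k B L M ∧ Post G B L) :
    ∃ G B L, DataHolds G k B L s.mem ∧ Post G B L := by
  induction h with
  | preprocess e =>
    obtain ⟨s', e', -, h⟩ := hp ω RState.init trivial
    rwa [RProg.exec_det _ _ _ e e']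
  | query τ ω' _ e ih =>
    obtain ⟨G, B, L, h, hP⟩ := ih
    refine ⟨G, B, L, h.of_eq fun b h0 hb => ?_, hP⟩
    have hs : Prog.query.isStatic Cell.size = true := by decide
    have hw : Prog.query.writes.all (fun b => b == Cell.ans || decide (Cell.max ≤ b)) = true := by
      decide
    refine e.mem_eq hs fun hm => ?_
    have := List.all_eq_true.1 hw b hm
    simp only [Bool.or_eq_true, decide_eq_true_eq, beq_iff_eq] at this
    rcases this with h1 | h1
    · exact h0 h1
    · omega

end

theorem mainTheorem2 :
    ∃ (pre qry : RProg) (C : ℝ), 0 < C ∧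
      ∀ (n m k : ℕ) (ε r : ℝ) (P : Fin n → Fin m → ℝ),
        1 ≤ n → 1 ≤ m → 1 ≤ k → 0 < ε → ε ≤ 1 → 0 < r →
          (∫⁻ ω, pre.runtime (preInput k ε r P) ω ∂randomLaw
              ≤ ENNReal.ofReal (C * (n * m) * (C / ε) ^ k)) ∧
          ∀ (ω : RandomSource) (s : RState), Reachable pre qry k (preInput k ε r P) ω s →
            (s.peak : ℝ) ≤ n * (C / ε) ^ k + C * (n * m) ∧
            ∀ (τ : Fin k → ℝ) (ω' : RandomSource),
              ∃ s' : RState, qry.Exec (seqAt τ) ω' s.restart s' ∧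
                (s'.time : ℝ) ≤ C * k ∧
                ∃ ans : Option (Fin n), s'.mem 0 = encodeAnswer ans ∧
                  IsANNAnswer (5 + ε) r (fun i => timeSeries (P i)) (timeSeries τ) ans := by
  obtain ⟨κ, hκ⟩ := exists_preprocess_time
  obtain ⟨κ', hκ'⟩ := exists_query_time
  set C : ℝ := 64 * κ + κ' + 2096 with hC
  have hκ0 : (0 : ℝ) ≤ κ := Nat.cast_nonneg _
  have hκ0' : (0 : ℝ) ≤ κ' := Nat.cast_nonneg _
  refine ⟨Prog.preprocess, Prog.query, C, by positivity, ?_⟩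
  intro n m k ε r P hn hm hk hε hε1 hr
  have hnm : (1 : ℝ) ≤ n * m := by exact_mod_cast Nat.mul_pos hn hm
  have hpre : Tri (preInput k ε r P) Prog.preprocess
      (κ * (n * m * (64 * (16 * (fineGrid ε r 0).W) ^ k))) (fun _ => True) _ :=
    hκ hε hr hn hm (by simp [preInput]) (by simp [preInput]) (by simp [preInput])
      (by simp [preInput]) (by simp [preInput])
  constructor
  · have htime : ((κ * (n * m * (64 * (16 * (fineGrid ε r 0).W) ^ k)) : ℕ) : ℝ) ≤
        C * (n * m) * (C / ε) ^ k := by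
      have h1 := codes_le hε hε1 hr k
      have h2 : (2096 / ε) ^ k ≤ (C / ε) ^ k :=
        pow_le_pow_left₀ (by positivity) (div_le_div_of_nonneg_right (by linarith) hε.le) k
      have h3 : (0 : ℝ) < (2096 / ε) ^ k := by positivity
      rw [Nat.cast_mul, Nat.cast_mul, Nat.cast_mul]
      calc (κ : ℝ) * (n * m * ((64 * (16 * (fineGrid ε r 0).W) ^ k : ℕ) : ℝ))
          ≤ κ * (n * m * (64 * (2096 / ε) ^ k)) := by gcongr
        _ = (64 * κ) * (n * m) * (2096 / ε) ^ k := by ring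
        _ ≤ C * (n * m) * (C / ε) ^ k := by gcongr; linarith
    have hrun : ∀ ω, Prog.preprocess.runtime (preInput k ε r P) ω ≤
        ENNReal.ofReal (C * (n * m) * (C / ε) ^ k) := by
      intro ω
      obtain ⟨s, e, ht, -⟩ := hpre ω RState.init trivial
      refine (iInf₂_le s e).trans ?_
      rw [← ENNReal.ofReal_natCast]
      refine ENNReal.ofReal_le_ofReal (le_trans ?_ htime)
      rw [show RState.init.time = 0 from rfl, Nat.zero_add] at ht
      exact_mod_cast ht
    have : IsProbabilityMeasure randomLaw := by unfold randomLaw; infer_instance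
    calc ∫⁻ ω, Prog.preprocess.runtime (preInput k ε r P) ω ∂randomLaw
        ≤ ∫⁻ _, ENNReal.ofReal (C * (n * m) * (C / ε) ^ k) ∂randomLaw := lintegral_mono hrun
      _ = _ := by rw [lintegral_const, measure_univ, mul_one]
  · intro ω s hs
    constructor
    · have h1 : s.peak ≤ Cell.size := hs.peak_le (by decide) (by decide)
      have h2 : (s.peak : ℝ) ≤ 36 := by exact_mod_cast h1
      have h3 : (0 : ℝ) ≤ n * (C / ε) ^ k := by positivity
      nlinarith
    · intro τ ω'
      obtain ⟨G, B, L, hD, a, ha, rfl, hb, hT⟩ := hs.dataHolds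
        (Post := fun G B L => ∃ a, 0 ≤ a ∧ G = fineGrid ε r a ∧
          (∀ j < n * m, |preInput k ε r P (5 + j)| ≤ a) ∧
          Table G (inputCurve k ε r P) B (2 * G.U ^ k) n (64 * (16 * G.W) ^ k)
            (n * (64 * (16 * G.W) ^ k)) L)
        (hpre.weaken le_rfl (fun _ h => h) fun M ⟨a, ha, hb, B, L, hD, hT⟩ =>
          ⟨fineGrid ε r a, B, L, hD, a, ha, rfl, hb, hT⟩)
      have hG := fineGrid_valid (a := a) hε hr
      have hU := two_le_fineGrid_U hε hr ha
      obtain ⟨s', e, ht, hans⟩ := hκ' (seqAt τ) hG.ρ_nonneg hk hT.valid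
        (queryPath (fineGrid ε r a) τ) rfl (enc_queryPath_bounds hG.ρ_nonneg hU hk τ) ω' s.restart hD
      refine ⟨s', e, ?_, exists_isANNAnswer hm hk hε hr ha hb hT τ hans⟩
      rw [show s.restart.time = 0 from rfl, Nat.zero_add] at ht
      have h1 : (s'.time : ℝ) ≤ κ' * k := by exact_mod_cast ht
      have h2 : (κ' : ℝ) * k ≤ C * k := mul_le_mul_of_nonneg_right (by linarith) (Nat.cast_nonneg _)
      exact h1.trans h2
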